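/- Let $q\ge 2$ be an integer and let $\mathfrak X$ be the (vertex set of the) $(q+1)$-regular tree, with distance $d$ and a reference vertex $o$. Let $\Omega$ be its boundary (the half geodesics from $o$; equivalently the classes of half geodesics that meet at infinity), and for $x\in\mathfrak X$, $\omega\in\Omega$ let $[x,\omega)$ be the half geodesic from $x$ to $\omega$. For $x,y\in\mathfrak X$ let $\Omega(x,y)$ be the set of $\omega$ such that $[x,\omega)$ passes through $y$; these sets form a basis of the topology of $\Omega$. Put $\Omega_n(x,\omega)=\Omega(x,x_n)$, where $x_n$ is the $n$-th vertex of $[x,\omega)$. Let $\nu_x$ be the Borel probability measure on $\Omega$ with $\nu_x(\Omega(x,y))=\frac1{(q+1)q^{n-1}}$ whenever $d(x,y)=n\ge1$, and let $\mathcal E^x_n\eta(\omega)=\nu_x(\Omega_n(x,\omega))^{-1}\int_{\Omega_n(x,\omega)}\eta\,d\nu_x$ for $n\in\mathbb N=\{0,1,2,\dots\}$; applied to a function of $(y,\omega,s)$, this operator acts on the variable $\omega$. Let $h_\omega(x)=\lim_m (m-d(x,\omega_m))$ be the height function of $\omega=(o,\omega_1,\omega_2,\dots)$. Let $\tau=\pi/\log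 q$ and let $\mu$ be the Plancherel probability measure on $[0,\tau]$, $$d\mu(s)=2\cdot\frac{q\log q}{4\pi(q+1)}\cdot\frac{(q+1)^2}{q}\cdot\frac{4\sin^2(s\log q)}{q+q^{-1}-2\cos(2s\log q)}\,ds .$$ For $a:\mathfrak X\times\Omega\times[0,\tau]\to\mathbb C$ let $$k_a(x,y)=\int_\Omega\int_0^\tau q^{(\frac12+is)(h_\omega(y)-h_\omega(x))}a(x,\omega,s)\,d\mu(s)\,d\nu_x(\omega),\qquad \mathrm{Op}(a)u(x)=\sum_y k_a(x,y)u(y)$$ for finitely supported $u$. The class $S$ consists of the functions $a(x,\omega,s)$ that are smooth in $s\in[0,\tau]$ (one-sided derivatives at the ends) and such that: for all $k$ and $x$, $\partial_s^ka(x,\cdot,\cdot)$ is continuous on $\Omega\times[0,\tau]$; for all $k$, $\|\partial_s^ka\|_\infty<\infty$; for every $l$ there is $C_l$ with $|(a-\mathcal E^x_na)(x,\omega,s)|\le C_l(1+n)^{-l}$ for all $n,x,\omega,s$; and $\partial_s^ka(x,\omega,0)=\partial_s^ka(x,\omega,\tau)=0$ for all $k,x,\omega$. The class $S_{sc}$ consists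 of the families $b=(b_\varepsilon)_{\varepsilon>0}$ of elements of $S$ such that, with constants independent of $\varepsilon$: (i) for every $k$ there is $C_k$ with $|\partial_s^kb_\varepsilon(x,\omega,s)-\partial_s^kb_\varepsilon(y,\omega,s)|\le C_k\,\varepsilon\, d(x,y)$ for all $\varepsilon>0,x,y,\omega,s$; (ii) for every $l$ there is a function $t\mapsto C_l(t)$ with $$|(b_\varepsilon-\mathcal E^x_nb_\varepsilon)(x,\omega,s)-(b_\varepsilon-\mathcal E^x_nb_\varepsilon)(y,\omega,s)|\le\varepsilon\,\frac{C_l(d(x,y))}{(1+n)^l}$$ for all $\varepsilon>0,x,y,n,\omega,s$. **Theorem.** Let $a\in S$ and $b=b_\varepsilon\in S_{sc}$, and suppose that for every $l$ the function $C_l$ in (ii) can be taken to be a polynomial. Then $\mathrm{Op}(a)$, $\mathrm{Op}(b_\varepsilon)$ and $\mathrm{Op}(ab_\varepsilon)$ extend to bounded operators on $L^2(\mathfrak X)$, and there is a constant $C$ such that for all $\varepsilon>0$ $$\|\mathrm{Op}(a)\mathrm{Op}(b_\varepsilon)-\mathrm{Op}(ab_\varepsilon)\|_{L^2\to L^2}\le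 C\varepsilon .$$ Moreover let $$a\#b_\varepsilon(x,\omega,s)=\sum_z q^{(\frac12-is)(h_\omega(z)-h_\omega(x))}K(x,z),\qquad K(x,z)=\sum_y k_a(x,y)k_{b_\varepsilon}(y,z)$$ (these series converge absolutely) and $r_\varepsilon=a\#b_\varepsilon-ab_\varepsilon$. Then $\mathrm{Op}(a)\mathrm{Op}(b_\varepsilon)-\mathrm{Op}(ab_\varepsilon)$ is the bounded extension of $\mathrm{Op}(r_\varepsilon)$, $r_\varepsilon\in S$ for every $\varepsilon>0$, and its seminorms are $O(\varepsilon)$: for all $k,l\in\mathbb N$ there are constants $C'_k,C''_l$ such that for all $\varepsilon>0$ $$\|\partial_s^kr_\varepsilon\|_\infty\le C'_k\varepsilon,\qquad \sup_{n,x,\omega,s}(1+n)^l\,|(r_\varepsilon-\mathcal E^x_nr_\varepsilon)(x,\omega,s)|\le C''_l\varepsilon .$$ -/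

import Mathlib

open Filter MeasureTheory
open scoped ENNReal

namespace TreeCalculus

/-- `ξ` is a half geodesic of `G`. -/
def IsGeodesicRay {X : Type*} (G : SimpleGraph X) (ξ : ℕ → X) : Prop :=
  ∀ m n : ℕ, G.dist (ξ m) (ξ (m + n)) = n

/-- Two half geodesics meet at infinity. -/
def TailEquiv {X : Type*} (ξ η : ℕ → X) : Prop :=
  ∃ i j : ℕ, ∀ n : ℕ, ξ (n + i) = η (n + j)

/-- The boundary of the tree: half geodesics starting at the reference point `o`. -/
structure Boundary {X : Type*} (G : SimpleGraph X) (o : X) where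
  ray : ℕ → X
  ray_zero : ray 0 = o
  isGeodesicRay : IsGeodesicRay G ray

/-- The cylinder `Ω(x, y)`: those `ω` such that the half geodesic `[x, ω)` passes through `y`. -/
def cylinder {X : Type*} (G : SimpleGraph X) (o x y : X) : Set (Boundary G o) :=
  {ω | ∃ ξ : ℕ → X, ξ 0 = x ∧ IsGeodesicRay G ξ ∧ TailEquiv ξ ω.ray ∧ ξ (G.dist x y) = y}

instance {X : Type*} (G : SimpleGraph X) (o : X) : TopologicalSpace (Boundary G o) :=
  TopologicalSpace.generateFrom {s | ∃ x y : X, s = cylinder G o x y}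

instance {X : Type*} (G : SimpleGraph X) (o : X) : MeasurableSpace (Boundary G o) :=
  borel (Boundary G o)

instance {X : Type*} (G : SimpleGraph X) (o : X) : BorelSpace (Boundary G o) := ⟨rfl⟩

/-- `μ` is the measure `ν_x` on the boundary: the Borel probability measure which gives the same
mass to each of the `(q + 1) q ^ n` cylinders `Ω(x, y)` with `d(x, y) = n + 1`. -/
structure IsBoundaryMeasure {X : Type*} (G : SimpleGraph X) (q : ℕ) (o x : X)
    (μ : Measure (Boundary G o)) : Prop where
  prob : IsProbabilityMeasure μ
  cyl : ∀ (n : ℕ) (y : X), G.dist x y = n + 1 →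
    μ (cylinder G o x y) = (((q : ℝ≥0∞) + 1) * (q : ℝ≥0∞) ^ n)⁻¹

/-! ### Existence of the measure `ν_x`, as the law of the end of a random half geodesic -/

theorem TailEquiv.symm {X : Type*} {ξ η : ℕ → X} (h : TailEquiv ξ η) : TailEquiv η ξ := by
  obtain ⟨i, j, h⟩ := h
  exact ⟨j, i, fun n => (h n).symm⟩

theorem TailEquiv.trans {X : Type*} {ξ η ζ : ℕ → X} (h : TailEquiv ξ η) (h' : TailEquiv η ζ) :
    TailEquiv ξ ζ := by
  obtain ⟨i, j, h⟩ := h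
  obtain ⟨k, l, h'⟩ := h'
  refine ⟨k + i, j + l, fun n => ?_⟩
  have h1 := h (n + k)
  have h2 := h' (n + j)
  rw [show n + (k + i) = n + k + i by ring, h1, show n + k + j = n + j + k by ring, h2]
  congr 1; ring

/-- A sequence of neighbours which escapes at unit speed from its origin is a half geodesic. -/
theorem isGeodesicRay_of_dist {X : Type*} {G : SimpleGraph X} (hG : G.Connected) {ξ : ℕ → X}
    (hstep : ∀ n, G.dist (ξ n) (ξ (n + 1)) ≤ 1)
    (hesc : ∀ N, ∃ n ≥ N, n ≤ G.dist (ξ 0) (ξ n)) : IsGeodesicRay G ξ := by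
  have hle : ∀ m n, G.dist (ξ m) (ξ (m + n)) ≤ n := by
    intro m n
    induction n with
    | zero => simp
    | succ n ih =>
      have := hG.dist_triangle (u := ξ m) (v := ξ (m + n)) (w := ξ (m + (n + 1)))
      have h2 := hstep (m + n)
      rw [add_assoc] at h2
      omega
  intro m n
  obtain ⟨k, hk, hk'⟩ := hesc (m + n)
  obtain ⟨r, rfl⟩ := Nat.exists_eq_add_of_le hk
  have h1 := hG.dist_triangle (u := ξ 0) (v := ξ m) (w := ξ (m + n + r))
  have h2 := hG.dist_triangle (u := ξ m) (v := ξ (m + n)) (w := ξ (m + n + r))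
  have h3 := hle 0 m
  have h4 := hle m n
  have h5 := hle (m + n) r
  rw [zero_add] at h3
  omega

/-- Prolong a shortest path from `x` to `ζ N` by the half geodesic `ζ`. -/
theorem exists_ray_of_eventually {X : Type*} {G : SimpleGraph X} (hG : G.Connected) {ζ : ℕ → X}
    (hζ : IsGeodesicRay G ζ) {x y : X}
    (h : ∀ᶠ n in atTop, G.dist x (ζ n) = G.dist x y + G.dist y (ζ n)) :
    ∃ ξ : ℕ → X, ξ 0 = x ∧ IsGeodesicRay G ξ ∧ TailEquiv ξ ζ ∧ ξ (G.dist x y) = y := by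
  -- the distance gained from `x` along `ζ` is eventually `1` at each step
  obtain ⟨N₀, hN₀⟩ := eventually_atTop.1 h
  have hmono : ∀ m n, G.dist x (ζ (m + n)) ≤ G.dist x (ζ m) + n := by
    intro m n
    have := hG.dist_triangle (u := x) (v := ζ m) (w := ζ (m + n))
    rw [hζ m n] at this
    exact this
  have hlow : ∀ n, n ≤ G.dist x (ζ 0) + G.dist x (ζ n) := by
    intro n
    have := hG.dist_triangle (u := ζ 0) (v := x) (w := ζ n)
    have h2 := hζ 0 n
    rw [zero_add] at h2
    rw [h2, G.dist_comm (u := ζ 0)] at this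
    exact this
  have hev : ∃ N ≥ N₀, ∀ n, G.dist x (ζ (N + n)) = G.dist x (ζ N) + n := by
    let f : ℕ → ℕ := fun n => G.dist x (ζ 0) + G.dist x (ζ (N₀ + n)) - n
    obtain ⟨k, hk⟩ : ∃ k, ∀ j, f k ≤ f j := ⟨_, fun j => Function.argmin_le f j⟩
    refine ⟨N₀ + k, by omega, fun n => ?_⟩
    have h1 := hk (k + n)
    have h2 := hmono (N₀ + k) n
    have h3 := hlow (N₀ + (k + n))
    have h4 := hlow (N₀ + k)
    simp only [f] at h1
    rw [show N₀ + (k + n) = N₀ + k + n by ring] at h1 h3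
    omega
  obtain ⟨N, hN, hNn⟩ := hev
  obtain ⟨p, hp⟩ := hG.exists_walk_length_eq_dist x y
  obtain ⟨r, hr⟩ := hG.exists_walk_length_eq_dist y (ζ N)
  let w := p.append r
  have hwl : w.length = G.dist x (ζ N) := by
    simp only [w, SimpleGraph.Walk.length_append, hp, hr]
    exact (hN₀ N hN).symm
  let ξ : ℕ → X := fun n => if n ≤ w.length then w.getVert n else ζ (N + (n - w.length))
  have hξ1 : ∀ n, n ≤ w.length → ξ n = w.getVert n := fun n hn => if_pos hn
  have hξ2 : ∀ n, ξ (w.length + n) = ζ (N + n) := by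
    intro n
    rcases Nat.eq_zero_or_pos n with rfl | hn
    · simp [ξ]
    · simp only [ξ]
      rw [if_neg (by omega)]
      congr 2; omega
  have hξ0 : ξ 0 = x := by rw [hξ1 0 (Nat.zero_le _)]; simp
  refine ⟨ξ, hξ0, ?_, ⟨w.length, N, fun n => ?_⟩, ?_⟩
  · refine isGeodesicRay_of_dist hG (fun n => ?_) (fun M => ⟨w.length + M, by omega, ?_⟩)
    · rcases lt_or_ge n w.length with hn | hn
      · rw [hξ1 n hn.le, hξ1 (n + 1) hn]
        exact (SimpleGraph.dist_eq_one_iff_adj.2 (w.adj_getVert_succ hn)).le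
      · obtain ⟨k, rfl⟩ := Nat.exists_eq_add_of_le hn
        rw [add_assoc, hξ2, hξ2, ← add_assoc, hζ]
    · rw [hξ0, hξ2, hNn, hwl]
  · rw [add_comm, hξ2, add_comm]
  · rw [hξ1 _ (by rw [← hp]; simp [w]), ← hp]
    simp [w, SimpleGraph.Walk.getVert_append]

theorem mem_ray_iff_eventually {X : Type*} {G : SimpleGraph X} (hG : G.Connected) {ζ : ℕ → X}
    (hζ : IsGeodesicRay G ζ) {x y : X} :
    (∃ ξ : ℕ → X, ξ 0 = x ∧ IsGeodesicRay G ξ ∧ TailEquiv ξ ζ ∧ ξ (G.dist x y) = y) ↔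
      ∀ᶠ n in atTop, G.dist x (ζ n) = G.dist x y + G.dist y (ζ n) := by
  refine ⟨?_, exists_ray_of_eventually hG hζ⟩
  rintro ⟨ξ, rfl, hξ, ⟨i, j, hij⟩, hy⟩
  refine eventually_atTop.2 ⟨j + G.dist (ξ 0) y, fun n hn => ?_⟩
  obtain ⟨m, rfl⟩ := Nat.exists_eq_add_of_le hn
  have h1 : ζ (j + G.dist (ξ 0) y + m) = ξ (0 + (G.dist (ξ 0) y + (m + i))) := by
    have := hij (G.dist (ξ 0) y + m)
    rw [show 0 + (G.dist (ξ 0) y + (m + i)) = G.dist (ξ 0) y + m + i by ring, this]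
    congr 1; ring
  rw [h1, hξ]
  have h2 := hξ (G.dist (ξ 0) y) (m + i)
  rw [hy] at h2
  rw [zero_add, h2]

theorem mem_cylinder_iff {X : Type*} {G : SimpleGraph X} (hG : G.Connected) {o x y : X}
    {ω : Boundary G o} :
    ω ∈ cylinder G o x y ↔
      ∀ᶠ n in atTop, G.dist x (ω.ray n) = G.dist x y + G.dist y (ω.ray n) :=
  mem_ray_iff_eventually hG ω.isGeodesicRay

theorem countable_of_locallyFinite {X : Type*} {G : SimpleGraph X} [G.LocallyFinite]
    (hG : G.Connected) (x : X) : Countable X := by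
  have hfin : ∀ n : ℕ, {y | G.dist x y ≤ n}.Finite := by
    intro n
    induction n with
    | zero =>
      refine (Set.finite_singleton x).subset fun y hy => ?_
      simp only [Set.mem_ofPred_eq, Nat.le_zero, hG.dist_eq_zero_iff] at hy
      exact hy.symm
    | succ n ih =>
      refine (ih.union (ih.biUnion fun v _ => (G.neighborFinset v).finite_toSet)).subset
        fun y hy => ?_
      by_cases hxy : G.dist x y ≤ n
      · exact Or.inl hxy
      · right
        obtain ⟨p, hp⟩ := hG.exists_walk_length_eq_dist y x
        cases p with
        | nil => simp at hxy
        | cons h p =>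
          rename_i v
          have h1 := G.dist_le p
          rw [SimpleGraph.Walk.length_cons, G.dist_comm] at hp
          have hy' : G.dist x y ≤ n + 1 := hy
          refine Set.mem_biUnion (x := v) ?_ (by simpa using h.symm)
          rw [G.dist_comm] at h1
          simp only [Set.mem_ofPred_eq]
          omega
  have : (Set.univ : Set X) = ⋃ n : ℕ, {y | G.dist x y ≤ n} := by
    ext y; simp only [Set.mem_univ, Set.mem_iUnion, Set.mem_ofPred_eq, true_iff]
    exact ⟨_, le_rfl⟩
  rw [← Set.countable_univ_iff, this]
  exact Set.countable_iUnion fun n => (hfin n).countable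

theorem eq_of_adj_of_dist {X : Type*} {G : SimpleGraph X} (hG : G.IsTree) {x v v' z : X}
    (hv : G.Adj v z) (hv' : G.Adj v' z) (h : G.dist x z = G.dist x v + 1)
    (h' : G.dist x z = G.dist x v' + 1) : v = v' := by
  obtain ⟨p, hp⟩ := hG.connected.exists_walk_length_eq_dist x v
  obtain ⟨p', hp'⟩ := hG.connected.exists_walk_length_eq_dist x v'
  have h1 : (p.concat hv).IsPath := SimpleGraph.Walk.isPath_of_length_eq_dist _ (by simp [hp, h])
  have h2 : (p'.concat hv').IsPath :=
    SimpleGraph.Walk.isPath_of_length_eq_dist _ (by simp [hp', h'])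
  exact (SimpleGraph.Walk.concat_inj
    ((hG.existsUnique_path x z).unique h1 h2)).1

theorem exists_adj_of_dist {X : Type*} {G : SimpleGraph X} (hG : G.Connected) {x z : X} {n : ℕ}
    (h : G.dist x z = n + 1) : ∃ v, G.Adj v z ∧ G.dist x v = n := by
  obtain ⟨p, hp⟩ := hG.exists_walk_length_eq_dist z x
  rw [G.dist_comm, h] at hp
  cases p with
  | nil => simp at hp
  | cons hadj p =>
    rename_i v
    have h1 := G.dist_le p
    rw [SimpleGraph.Walk.length_cons] at hp
    have h2 := hG.dist_triangle (u := x) (v := v) (w := z)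
    rw [SimpleGraph.dist_eq_one_iff_adj.2 hadj.symm, h] at h2
    rw [G.dist_comm] at h1
    exact ⟨v, hadj.symm, by omega⟩

/-- In a tree the vertex at a given position between `x` and `z` is unique. -/
theorem eq_of_between {X : Type*} {G : SimpleGraph X} (hG : G.IsTree) {x z u u' : X}
    (hu : G.dist x z = G.dist x u + G.dist u z) (hu' : G.dist x z = G.dist x u' + G.dist u' z)
    (h : G.dist x u = G.dist x u') : u = u' := by
  obtain ⟨p, hp⟩ := hG.connected.exists_walk_length_eq_dist x u
  obtain ⟨r, hr⟩ := hG.connected.exists_walk_length_eq_dist u z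
  obtain ⟨p', hp'⟩ := hG.connected.exists_walk_length_eq_dist x u'
  obtain ⟨r', hr'⟩ := hG.connected.exists_walk_length_eq_dist u' z
  have h1 : (p.append r).IsPath := SimpleGraph.Walk.isPath_of_length_eq_dist _ (by simp [*])
  have h2 : (p'.append r').IsPath :=
    SimpleGraph.Walk.isPath_of_length_eq_dist _ (by simp [hp', hr', hu'])
  have h3 := (hG.existsUnique_path x z).unique h1 h2
  have h4 : (p.append r).getVert p.length = u := by simp [SimpleGraph.Walk.getVert_append]
  have h5 : (p'.append r').getVert p'.length = u' := by simp [SimpleGraph.Walk.getVert_append]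
  rw [← h4, ← h5, h3, hp, hp', h]

/-- The neighbours of `v` which are further away from `x`. -/
structure Forward {X : Type*} (G : SimpleGraph X) (x v : X) where
  val : X
  adj : G.Adj v val
  dist_eq : G.dist x val = G.dist x v + 1

theorem Forward.ext_iff' {X : Type*} {G : SimpleGraph X} {x v : X} {a b : Forward G x v} :
    a = b ↔ a.val = b.val := by
  cases a; cases b; simp

instance {X : Type*} (G : SimpleGraph X) (x v : X) : MeasurableSpace (Forward G x v) := ⊤

instance {X : Type*} (G : SimpleGraph X) (x v : X) : DiscreteMeasurableSpace (Forward G x v) :=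
  ⟨fun _ => trivial⟩

instance {X : Type*} (G : SimpleGraph X) [G.LocallyFinite] (x v : X) :
    Finite (Forward G x v) :=
  Finite.of_injective (β := G.neighborSet v) (fun w => ⟨w.val, w.adj⟩) fun a b h => by
    exact Forward.ext_iff'.2 (congrArg Subtype.val h)

theorem card_forward {X : Type*} {G : SimpleGraph X} [G.LocallyFinite] (hG : G.IsTree) {q : ℕ}
    (hreg : G.IsRegularOfDegree (q + 1)) (x v : X) :
    (v = x → Nat.card (Forward G x v) = q + 1) ∧ (v ≠ x → Nat.card (Forward G x v) = q) := by
  classical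
  have key : Nat.card (Forward G x v) =
      ((G.neighborFinset v).filter fun w => G.dist x w = G.dist x v + 1).card :=
    (Nat.card_congr (⟨fun w => ⟨w.1, w.2, w.3⟩, fun w => ⟨w.1, w.2.1, w.2.2⟩, fun _ => rfl,
      fun _ => rfl⟩ : Forward G x v ≃ {w // G.Adj v w ∧ G.dist x w = G.dist x v + 1})).trans
      (Nat.subtype_card _ (by simp))
  have hdeg : (G.neighborFinset v).card = q + 1 := hreg v
  constructor
  · rintro rfl
    rw [key, Finset.filter_true_of_mem, hdeg]
    intro w hw
    rw [SimpleGraph.mem_neighborFinset] at hw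
    simp [SimpleGraph.dist_eq_one_iff_adj.2 hw]
  · intro hv
    have hpos := hG.connected.pos_dist_of_ne (Ne.symm hv)
    obtain ⟨n, hn⟩ := Nat.exists_eq_add_of_lt hpos
    rw [zero_add] at hn
    obtain ⟨u, hu, hun⟩ := exists_adj_of_dist hG.connected hn
    have : (G.neighborFinset v).filter (fun w => G.dist x w = G.dist x v + 1) =
        (G.neighborFinset v).erase u := by
      ext w
      simp only [Finset.mem_filter, SimpleGraph.mem_neighborFinset, Finset.mem_erase]
      constructor
      · rintro ⟨h1, h2⟩
        refine ⟨?_, h1⟩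
        rintro rfl
        omega
      · rintro ⟨h1, h2⟩
        refine ⟨h2, ?_⟩
        rcases hG.dist_eq_dist_add_one_of_adj x h2 with h | h
        · exact absurd (eq_of_adj_of_dist hG h2.symm hu h (by omega)) h1
        · exact h
    rw [key, this, Finset.card_erase_of_mem (by simpa using hu.symm), hdeg]
    rfl

/-- The walk from `x` which at the vertex `v` steps to the forward neighbour `U v`. -/
def walkOf {X : Type*} (G : SimpleGraph X) (x : X) (U : ∀ v, Forward G x v) : ℕ → X
  | 0 => x
  | n + 1 => (U (walkOf G x U n)).1

theorem dist_walkOf {X : Type*} {G : SimpleGraph X} {x : X} (U : ∀ v, Forward G x v) (n : ℕ) :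
    G.dist x (walkOf G x U n) = n := by
  induction n with
  | zero => simp [walkOf]
  | succ n ih => rw [walkOf, (U _).dist_eq, ih]

theorem isGeodesicRay_walkOf {X : Type*} {G : SimpleGraph X} (hG : G.Connected) {x : X}
    (U : ∀ v, Forward G x v) : IsGeodesicRay G (walkOf G x U) :=
  isGeodesicRay_of_dist hG
    (fun n => (SimpleGraph.dist_eq_one_iff_adj.2 (U (walkOf G x U n)).adj).le)
    fun N => ⟨N, le_rfl, (dist_walkOf U N).ge⟩

theorem walkOf_succ_eq_iff {X : Type*} {G : SimpleGraph X} (hG : G.IsTree) {x y v : X} {n : ℕ}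
    (hv : G.Adj v y) (hn : G.dist x v = n) (hy : G.dist x y = n + 1) (U : ∀ v, Forward G x v) :
    walkOf G x U (n + 1) = y ↔ walkOf G x U n = v ∧ (U v).1 = y := by
  constructor
  · intro h
    have h0 : (U (walkOf G x U n)).1 = y := h
    have h1 : walkOf G x U n = v := by
      have h2 := (U (walkOf G x U n)).adj
      have h3 := (U (walkOf G x U n)).dist_eq
      rw [h0] at h2 h3
      exact eq_of_adj_of_dist hG h2 hv h3 (by omega)
    rw [h1] at h0
    exact ⟨h1, h0⟩
  · rintro ⟨h1, h2⟩
    rw [walkOf, h1, h2]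

theorem walkOf_eq_box {X : Type*} {G : SimpleGraph X} [G.LocallyFinite] (hG : G.IsTree) {q : ℕ}
    (hq : 1 ≤ q) (hreg : G.IsRegularOfDegree (q + 1)) (x : X) (n : ℕ) : ∀ y : X, G.dist x y = n + 1 →
    ∃ (s : Finset X) (t : ∀ v, Set (Forward G x v)), (∀ v ∈ s, G.dist x v ≤ n) ∧
      {U | walkOf G x U (n + 1) = y} = Set.pi (s : Set X) t ∧
      ∏ v ∈ s, (ProbabilityTheory.uniformOn Set.univ : Measure (Forward G x v)) (t v) =
        (((q : ℝ≥0∞) + 1) * (q : ℝ≥0∞) ^ n)⁻¹ := by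
  classical
  have hone : ∀ v (a : Forward G x v),
      (ProbabilityTheory.uniformOn Set.univ : Measure (Forward G x v)) {a} =
        (Nat.card (Forward G x v) : ℝ≥0∞)⁻¹ := by
    intro v a
    have := Fintype.ofFinite (Forward G x v)
    rw [ProbabilityTheory.uniformOn_univ, Nat.card_eq_fintype_card]
    simp
  induction n with
  | zero =>
    intro y hy
    have hadj : G.Adj x y := SimpleGraph.dist_eq_one_iff_adj.1 (by simpa using hy)
    refine ⟨{x}, Function.update (fun _ => Set.univ) x {⟨y, hadj, by simpa using hy⟩}, by simp,
      ?_, ?_⟩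
    · ext U
      rw [Set.mem_ofPred_eq, walkOf_succ_eq_iff hG hadj (by simp) hy]
      simp [walkOf, Forward.ext_iff']
    · simp [hone, (card_forward hG hreg x x).1 rfl]
  | succ n ih =>
    intro y hy
    obtain ⟨v, hv, hvn⟩ := exists_adj_of_dist hG.connected hy
    obtain ⟨s, t, h1, h2, h3⟩ := ih v hvn
    have hvs : v ∉ s := fun h => by have := h1 v h; omega
    have hvx : v ≠ x := by rintro rfl; simp at hvn
    refine ⟨insert v s, Function.update t v {⟨y, hv, by omega⟩}, ?_, ?_, ?_⟩
    · intro u hu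
      rcases Finset.mem_insert.1 hu with rfl | hu
      · omega
      · have := h1 u hu; omega
    · ext U
      have h4 : walkOf G x U (n + 1) = v ↔ U ∈ Set.pi (s : Set X) t := by rw [← h2]; rfl
      rw [Set.mem_ofPred_eq, walkOf_succ_eq_iff hG hv hvn hy, h4]
      simp only [Set.mem_pi, Finset.mem_coe, Finset.mem_insert, forall_eq_or_imp,
        Function.update_self]
      rw [and_comm]
      refine and_congr (by simp [Forward.ext_iff']) (forall₂_congr fun u hu => ?_)
      rw [Function.update_of_ne (by rintro rfl; exact hvs hu)]
    · rw [Finset.prod_insert hvs, Function.update_self, hone, (card_forward hG hreg x v).2 hvx]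
      rw [Finset.prod_congr rfl fun u hu => by
        rw [Function.update_of_ne (by rintro rfl; exact hvs hu)], h3]
      rw [← ENNReal.mul_inv (Or.inl (by simp; omega)) (Or.inl (by simp))]
      congr 1
      ring

theorem measurable_walkOf {X : Type*} {G : SimpleGraph X} [Countable X] (x : X) (n : ℕ) (y : X) :
    MeasurableSet {U : ∀ v, Forward G x v | walkOf G x U n = y} := by
  induction n generalizing y with
  | zero => simp [walkOf]
  | succ n ih =>
    have : {U : ∀ v, Forward G x v | walkOf G x U (n + 1) = y} =
        ⋃ v, {U | walkOf G x U n = v} ∩ (fun U => U v) ⁻¹' {a | a.1 = y} := by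
      ext U
      simp [walkOf]
    rw [this]
    exact MeasurableSet.iUnion fun v => (ih v).inter
      (measurable_pi_apply v (DiscreteMeasurableSpace.forall_measurableSet _))

/-- The measures `ν_x` exist. -/
theorem exists_isBoundaryMeasure {X : Type*} {G : SimpleGraph X} [G.LocallyFinite]
    (hG : G.IsTree) {q : ℕ} (hq : 1 ≤ q) (hreg : G.IsRegularOfDegree (q + 1)) (o x : X) :
    ∃ μ : Measure (Boundary G o), IsBoundaryMeasure G q o x μ := by
  classical
  have hcount : Countable X := countable_of_locallyFinite hG.connected x
  have hne : ∀ v, Nonempty (Forward G x v) := fun v => by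
    have := card_forward hG hreg x v
    refine (Nat.card_pos_iff.1 ?_).1
    by_cases h : v = x
    · rw [this.1 h]; omega
    · rw [this.2 h]; omega
  let P : Measure (∀ v, Forward G x v) :=
    Measure.infinitePi fun v => ProbabilityTheory.uniformOn Set.univ
  -- the end of the walk, seen from `o`
  have hend : ∀ U : ∀ v, Forward G x v, ∃ ω : Boundary G o, TailEquiv ω.ray (walkOf G x U) := by
    intro U
    obtain ⟨ξ, h0, hξ, h1, -⟩ := exists_ray_of_eventually hG.connected
      (isGeodesicRay_walkOf hG.connected U) (x := o) (y := o) (by simp)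
    exact ⟨⟨ξ, h0, hξ⟩, h1⟩
  choose Φ hΦ using hend
  have hmem : ∀ U (x' y' : X), Φ U ∈ cylinder G o x' y' ↔ ∀ᶠ n in atTop,
      G.dist x' (walkOf G x U n) = G.dist x' y' + G.dist y' (walkOf G x U n) := by
    intro U x' y'
    rw [← mem_ray_iff_eventually hG.connected (isGeodesicRay_walkOf hG.connected U)]
    constructor
    · rintro ⟨ξ, h1, h2, h3, h4⟩
      exact ⟨ξ, h1, h2, h3.trans (hΦ U), h4⟩
    · rintro ⟨ξ, h1, h2, h3, h4⟩
      exact ⟨ξ, h1, h2, h3.trans (hΦ U).symm, h4⟩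
  have hmeas' : ∀ x' y', MeasurableSet (Φ ⁻¹' cylinder G o x' y') := by
    intro x' y'
    have : Φ ⁻¹' cylinder G o x' y' = ⋃ N : ℕ, ⋂ n : ℕ, ⋂ _ : N ≤ n,
        ⋃ z : X, ⋃ _ : G.dist x' z = G.dist x' y' + G.dist y' z,
          {U | walkOf G x U n = z} := by
      ext U
      rw [Set.mem_preimage, hmem, eventually_atTop]
      simp
    rw [this]
    exact .iUnion fun N => .iInter fun n => .iInter fun _ => .iUnion fun z => .iUnion fun _ =>
      measurable_walkOf x n z
  have hC : {s : Set (Boundary G o) | ∃ x y : X, s = cylinder G o x y}.Countable := by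
    have : {s : Set (Boundary G o) | ∃ x y : X, s = cylinder G o x y} =
        Set.range fun p : X × X => cylinder G o p.1 p.2 := by
      ext s; simp [eq_comm]
    rw [this]
    exact Set.countable_range _
  have hsec : SecondCountableTopology (Boundary G o) := ⟨_, hC, rfl⟩
  have hmeas : Measurable Φ := by
    have hb := borel_eq_generateFrom_of_subbasis (α := Boundary G o)
      (s := {s | ∃ x y : X, s = cylinder G o x y}) rfl
    rw [← BorelSpace.measurable_eq (α := Boundary G o)] at hb
    rw [hb]
    refine measurable_generateFrom ?_
    rintro s ⟨x', y', rfl⟩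
    exact hmeas' x' y'
  have hcyl : ∀ x' y', MeasurableSet (cylinder G o x' y') := fun x' y' =>
    IsOpen.measurableSet (TopologicalSpace.GenerateOpen.basic _ ⟨x', y', rfl⟩)
  refine ⟨P.map Φ, ⟨Measure.isProbabilityMeasure_map hmeas.aemeasurable, fun n y hy => ?_⟩⟩
  rw [Measure.map_apply hmeas (hcyl x y)]
  obtain ⟨s, t, -, h2, h3⟩ := walkOf_eq_box hG hq hreg x n y hy
  have : Φ ⁻¹' cylinder G o x y = {U | walkOf G x U (n + 1) = y} := by
    ext U
    rw [Set.mem_preimage, hmem, Set.mem_ofPred_eq]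
    constructor
    · intro h
      obtain ⟨m, hm, hm'⟩ := (h.and (eventually_ge_atTop (n + 1))).exists
      obtain ⟨r, rfl⟩ := Nat.exists_eq_add_of_le hm'
      have h5 := isGeodesicRay_walkOf hG.connected U (n + 1) r
      have h6 := dist_walkOf U (n + 1)
      have h7 := dist_walkOf U (n + 1 + r)
      exact eq_of_between hG (by omega) hm (by omega)
    · intro h
      filter_upwards [eventually_ge_atTop (n + 1)] with m hm
      obtain ⟨r, rfl⟩ := Nat.exists_eq_add_of_le hm
      have := isGeodesicRay_walkOf hG.connected U (n + 1) r
      rw [dist_walkOf, hy, ← h, this]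
  rw [this, h2, Measure.infinitePi_pi _ fun v _ => DiscreteMeasurableSpace.forall_measurableSet _, h3]

/-! ### Harmonic analysis -/

open Classical in
/-- The measure `ν_x` on the boundary. It exists by `exists_isBoundaryMeasure` (and it is determined
by its values on the cylinders), so the value `0` is never used on a `(q + 1)`-regular tree. -/
noncomputable def boundaryMeasure {X : Type*} (G : SimpleGraph X) (q : ℕ) (o x : X) :
    Measure (Boundary G o) :=
  if h : ∃ μ : Measure (Boundary G o), IsBoundaryMeasure G q o x μ then h.choose else 0

/-- The height function `h_ω(x) = lim_m (m - d(x, ω_m))`; the sequence is eventually constant. -/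
noncomputable def height {X : Type*} {G : SimpleGraph X} {o : X} (ω : Boundary G o) (x : X) : ℤ :=
  limUnder atTop fun m : ℕ => (m : ℤ) - (G.dist x (ω.ray m) : ℤ)

/-- `Ω_n(x, ω)`, the cylinder `Ω(x, x_n)` where `x_n` is the `n`-th vertex of `[x, ω)`. -/
def cylinderAround {X : Type*} {G : SimpleGraph X} {o : X} (x : X) (n : ℕ) (ω : Boundary G o) :
    Set (Boundary G o) :=
  {ω' | ∃ y : X, G.dist x y = n ∧ ω ∈ cylinder G o x y ∧ ω' ∈ cylinder G o x y}

/-- The averaging operator `𝓔_n^x`. -/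
noncomputable def cylAverage {X : Type*} {G : SimpleGraph X} {o : X} (q : ℕ) (x : X) (n : ℕ)
    (η : Boundary G o → ℂ) (ω : Boundary G o) : ℂ :=
  ⨍ ω' in cylinderAround x n ω, η ω' ∂(boundaryMeasure G q o x)

/-- `τ = π / log q`. -/
noncomputable def tau (q : ℕ) : ℝ := Real.pi / Real.log q

/-- The density on `[0, τ]` of the Plancherel measure, `2 c_P |c(s)|⁻²` with
`c_P = q log q / (4 π (q + 1))` and
`|c(s)|⁻² = ((q + 1)² / q) * 4 sin² (s log q) / (q + q⁻¹ - 2 cos (2 s log q))`.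
The factor `2` makes it a probability density on `[0, τ]`, so that Fourier inversion holds there
and the symbol `1` gives the identity. -/
noncomputable def plancherelDensity (q : ℕ) (s : ℝ) : ℝ :=
  2 * ((q : ℝ) * Real.log q / (4 * Real.pi * ((q : ℝ) + 1))) *
    ((((q : ℝ) + 1) ^ 2 / q) * (4 * Real.sin (s * Real.log q) ^ 2 /
      ((q : ℝ) + (q : ℝ)⁻¹ - 2 * Real.cos (2 * s * Real.log q))))

/-- The wave `q ^ ((1/2 + i s) (h_ω(y) - h_ω(x)))`. -/
noncomputable def wave {X : Type*} {G : SimpleGraph X} {o : X} (q : ℕ) (x y : X)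
    (ω : Boundary G o) (s : ℝ) : ℂ :=
  (q : ℂ) ^ ((1 / 2 + Complex.I * (s : ℂ)) * ((height ω y : ℂ) - (height ω x : ℂ)))

/-! ### Symbols -/

/-- Functions `a(x, ω, s)`; only the values with `s ∈ [0, τ]` matter. -/
abbrev SymbolFun {X : Type*} (G : SimpleGraph X) (o : X) : Type _ :=
  X → Boundary G o → ℝ → ℂ

/-- The derivative `∂_s^k a(x, ω, s)` on the interval `[0, τ]` (one-sided at its ends). -/
noncomputable def dS {X : Type*} {G : SimpleGraph X} {o : X} (q k : ℕ) (a : SymbolFun G o)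
    (x : X) (ω : Boundary G o) (s : ℝ) : ℂ :=
  iteratedDerivWithin k (a x ω) (Set.Icc 0 (tau q)) s

/-- `(a - 𝓔_n^x a)(y, ω, s)`: the average is centred at `x` and acts on the variable `ω` of
`a(y, ω, s)`. -/
noncomputable def cylDefect {X : Type*} {G : SimpleGraph X} {o : X} (q : ℕ) (x : X) (n : ℕ)
    (a : SymbolFun G o) (y : X) (ω : Boundary G o) (s : ℝ) : ℂ :=
  a y ω s - cylAverage q x n (fun ω' => a y ω' s) ω

/-- The class `S` of symbols `a(x, ω, s)`. -/
structure IsSymbol {X : Type*} {G : SimpleGraph X} {o : X} (q : ℕ) (a : SymbolFun G o) : Prop where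
  smooth : ∀ x ω, ContDiffOn ℝ (⊤ : ℕ∞) (a x ω) (Set.Icc 0 (tau q))
  continuousOn : ∀ (k : ℕ) (x : X),
    ContinuousOn (fun p : Boundary G o × ℝ => dS q k a x p.1 p.2) (Set.univ ×ˢ Set.Icc 0 (tau q))
  bounded : ∀ k : ℕ, ∃ C : ℝ, ∀ x ω, ∀ s ∈ Set.Icc 0 (tau q), ‖dS q k a x ω s‖ ≤ C
  regular : ∀ l : ℕ, ∃ C : ℝ, ∀ (n : ℕ) (x : X) (ω : Boundary G o), ∀ s ∈ Set.Icc 0 (tau q),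
    ‖cylDefect q x n a x ω s‖ ≤ C / (1 + (n : ℝ)) ^ l
  boundary : ∀ (k : ℕ) (x : X) (ω : Boundary G o), dS q k a x ω 0 = 0 ∧ dS q k a x ω (tau q) = 0

/-- The class `S_sc` of semiclassical symbols `b = b_ε`, `ε > 0`. The constants that control the
variation in `x` do not depend on `ε`. -/
structure IsSemiclassical {X : Type*} {G : SimpleGraph X} {o : X} (q : ℕ)
    (b : ℝ → SymbolFun G o) : Prop where
  isSymbol : ∀ ε > 0, IsSymbol q (b ε)
  lipschitz : ∀ k : ℕ, ∃ C : ℝ, ∀ ε > 0, ∀ (x y : X) (ω : Boundary G o),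
    ∀ s ∈ Set.Icc 0 (tau q), ‖dS q k (b ε) x ω s - dS q k (b ε) y ω s‖ ≤ C * ε * G.dist x y
  cross : ∀ l : ℕ, ∃ C : ℕ → ℝ, ∀ ε > 0, ∀ (x y : X) (n : ℕ) (ω : Boundary G o),
    ∀ s ∈ Set.Icc 0 (tau q),
      ‖cylDefect q x n (b ε) x ω s - cylDefect q x n (b ε) y ω s‖ ≤
        ε * (C (G.dist x y) / (1 + (n : ℝ)) ^ l)

/-- The functions `C_l(t)` in the cross-derivative condition of `b` can be taken polynomial. -/
def HasPolynomialCross {X : Type*} {G : SimpleGraph X} {o : X} (q : ℕ)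
    (b : ℝ → SymbolFun G o) : Prop :=
  ∀ l : ℕ, ∃ C : Polynomial ℝ, ∀ ε > 0, ∀ (x y : X) (n : ℕ) (ω : Boundary G o),
    ∀ s ∈ Set.Icc 0 (tau q),
      ‖cylDefect q x n (b ε) x ω s - cylDefect q x n (b ε) y ω s‖ ≤
        ε * (C.eval (G.dist x y : ℝ) / (1 + (n : ℝ)) ^ l)

/-! ### Operators -/

/-- The kernel of `Op(a)`. -/
noncomputable def kernel {X : Type*} {G : SimpleGraph X} {o : X} (q : ℕ) (a : SymbolFun G o)
    (x y : X) : ℂ :=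
  ∫ ω, (∫ s in (0 : ℝ)..tau q, wave q x y ω s * a x ω s * (plancherelDensity q s : ℂ))
    ∂(boundaryMeasure G q o x)

/-- The operator `Op(a)` on finitely supported functions. -/
noncomputable def Op {X : Type*} {G : SimpleGraph X} {o : X} (q : ℕ) (a : SymbolFun G o)
    (u : X →₀ ℂ) (x : X) : ℂ :=
  ∑ y ∈ u.support, kernel q a x y * u y

/-- `L²(𝔛)`. -/
abbrev L2 (X : Type*) : Type _ := lp (fun _ : X => ℂ) 2

/-- The bounded operator `T` on `L²` is the (unique) extension of `Op(a)`. -/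
def IsExtension {X : Type*} {G : SimpleGraph X} {o : X} (q : ℕ) (T : L2 X →L[ℂ] L2 X)
    (a : SymbolFun G o) : Prop :=
  ∀ (f : L2 X) (u : X →₀ ℂ), (∀ x, f x = u x) → ∀ x, T f x = Op q a u x

/-- The kernel of `Op(a) Op(b)`. -/
noncomputable def compKernel {X : Type*} {G : SimpleGraph X} {o : X} (q : ℕ) (a b : SymbolFun G o)
    (x z : X) : ℂ :=
  ∑' y, kernel q a x y * kernel q b y z

/-- The symbol `a # b`, obtained from the kernel of `Op(a) Op(b)`. -/
noncomputable def sharp {X : Type*} {G : SimpleGraph X} {o : X} (q : ℕ) (a b : SymbolFun G o) :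
    SymbolFun G o :=
  fun x ω s => ∑' z, wave q x z ω (-s) * compKernel q a b x z

end TreeCalculus

open TreeCalculus

/-! The kernel of a symbol is its Fourier transform on the tree, and a symbol is recovered from it:
b(x, ω, s) = ∑_z k_b(x, z) q^{(1/2 - is)(h_ω(z) - h_ω(x))} (`IsSymbol.hasSum_kernel_mul_wave`). In
the double series for a # b the waves split at the middle vertex y, so inversion for b at y gives a
# b = ∑_y k_a(x, y) q^{(1/2 - is)(h_ω(y) - h_ω(x))} b(y, ω, s) (`sharp_eq_tsum`). Subtracting
inversion for a, multiplied by b(x, ω, s), leaves the same series with b(y, ω, s) - b(x, ω, s) in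
place of b(y, ω, s) (`remainderSymbol_eq`). Each difference is O(ε d(x, y)), and everything else is
a matter of summing against k_a.

The analytic core is the decay |k_a(x, y)| ≤ C_N q^{-d/2} (1 + d)^{-N}, d = d(x, y)
(`exists_kernel_decay_aux`). Along the geodesic from x to y the wave is a constant plus multiples of
indicators of cylinders. For the constant and the cylinders near x the phases oscillate fast in s,
and flatness of the symbol at 0 and τ allows repeated integration by parts. On the cylinders near y
the symbol is almost constant in ω; once it is frozen, the zero of the Plancherel density makes the
sum telescope (`phase_telescope`), and only two rapidly oscillating ends remain.

Inversion follows from two facts. The symbol 1 has the identity as its kernel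
(`integral_wave_density_eq`), by the mean value property of a holomorphic function on the disc; the
change of base point dν_z/dν_x = q^{h_ω(z) - h_ω(x)} carries this over to the kernel of the
inversion series. The transform is injective (`eq_zero_of_integral_wave_eq_zero`): the adjacency
operator produces all moments in cos(s log q), which isolates each s, and differences of waves then
isolate cylinders.

Sums over spheres of q^{(h_ω(y) - h_ω(x))/2} are O(n q^{n/2}) (`sum_sphere_le`). Together with the
decay of k_a this bounds the remainder and its s-derivatives. For its regularity in ω
(`exists_norm_cylDefect_le`), the waves to vertices within distance n of x are constant on Ω_n(x,
ω), so the averaging defect falls on the differences of b; polynomial growth in d(x, y) is absorbed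
by the decay of k_a. The same sphere bound, in Schur's test with weight q^{h_ω(x)/2} for one fixed
ω, bounds an operator by finitely many seminorms of its symbol. Applied to the remainder this is the
L² estimate. -/

namespace TreeCalculus

/-! ### Heights, cylinders and geodesics -/

section Geometry

variable {X : Type*} {G : SimpleGraph X} {o : X}

/-- A step along the ray changes the distance to `x` by at most one, so the sequence is
nondecreasing; it is bounded by `d(o, x)` and integer valued. Statements on heights are then proved
at one large `m`, as integer identities between distances. -/
theorem height_spec (hG : G.IsTree) (ω : Boundary G o) (x : X) :
    ∀ᶠ m : ℕ in atTop, (m : ℤ) - (G.dist x (ω.ray m) : ℤ) = height ω x := by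
  have hmono : Monotone fun m : ℕ => (m : ℤ) - (G.dist x (ω.ray m) : ℤ) := by
    refine monotone_nat_of_le_succ fun m => ?_
    have := hG.connected.dist_triangle (u := x) (v := ω.ray m) (w := ω.ray (m + 1))
    rw [ω.isGeodesicRay m 1] at this
    push_cast
    omega
  have hbdd : ∀ m : ℕ, (m : ℤ) - (G.dist x (ω.ray m) : ℤ) ≤ G.dist o x := by
    intro m
    have := hG.connected.dist_triangle (u := o) (v := x) (w := ω.ray m)
    have h2 := ω.isGeodesicRay 0 m
    rw [zero_add, ω.ray_zero] at h2
    omega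
  obtain ⟨c, ⟨N, hN⟩, hc⟩ := Int.exists_greatest_of_bdd
    (P := fun z => ∃ m : ℕ, (m : ℤ) - (G.dist x (ω.ray m) : ℤ) = z)
    ⟨G.dist o x, fun z ⟨m, hm⟩ => hm ▸ hbdd m⟩ ⟨_, 0, rfl⟩
  have hev : ∀ᶠ m : ℕ in atTop, (m : ℤ) - (G.dist x (ω.ray m) : ℤ) = c := by
    filter_upwards [eventually_ge_atTop N] with m hm
    exact le_antisymm (hc _ ⟨m, rfl⟩) (hN ▸ hmono hm)
  have hlim : height ω x = c :=
    (tendsto_const_nhds.congr' (hev.mono fun _ h => h.symm)).limUnder_eq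
  rw [hlim]
  exact hev

theorem height_sub_le (hG : G.IsTree) (ω : Boundary G o) (x y : X) :
    height ω y - height ω x ≤ G.dist x y := by
  obtain ⟨m, hx, hy⟩ := ((height_spec hG ω x).and (height_spec hG ω y)).exists
  have := hG.connected.dist_triangle (u := x) (v := y) (w := ω.ray m)
  omega

theorem abs_height_sub_le (hG : G.IsTree) (ω : Boundary G o) (x y : X) :
    |height ω y - height ω x| ≤ G.dist x y := by
  have h1 := height_sub_le hG ω x y
  have h2 := height_sub_le hG ω y x
  rw [G.dist_comm] at h2
  exact abs_le.2 ⟨by omega, h1⟩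

/-- Far out on the ray, the condition that `y` lies between `x` and `ω.ray m` is the difference of
the two height identities. Cylinders can thus be handled by arithmetic on heights. -/
theorem mem_cylinder_iff_height (hG : G.IsTree) {ω : Boundary G o} {x y : X} :
    ω ∈ cylinder G o x y ↔ height ω y - height ω x = G.dist x y := by
  rw [mem_cylinder_iff hG.connected]
  constructor
  · intro h
    obtain ⟨m, h, hx, hy⟩ := (h.and ((height_spec hG ω x).and (height_spec hG ω y))).exists
    omega
  · intro h
    filter_upwards [height_spec hG ω x, height_spec hG ω y] with m hx hy
    omega

theorem height_adj (hG : G.IsTree) (ω : Boundary G o) {x y : X} (h : G.Adj x y) :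
    height ω y = height ω x + 1 ∨ height ω y = height ω x - 1 := by
  obtain ⟨m, hx, hy⟩ := ((height_spec hG ω x).and (height_spec hG ω y)).exists
  have := hG.dist_eq_dist_add_one_of_adj (ω.ray m) h
  rw [G.dist_comm (u := ω.ray m), G.dist_comm (u := ω.ray m)] at this
  omega

/-- Both neighbours are one step closer than `z` to a far vertex of the ray, and in a tree only one
neighbour of `z` is. -/
theorem eq_of_adj_of_height (hG : G.IsTree) (ω : Boundary G o) {z v v' : X} (hv : G.Adj v z)
    (hv' : G.Adj v' z) (h : height ω v = height ω z + 1) (h' : height ω v' = height ω z + 1) :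
    v = v' := by
  obtain ⟨m, hx, hy, hz⟩ := ((height_spec hG ω v).and
    ((height_spec hG ω v').and (height_spec hG ω z))).exists
  refine eq_of_adj_of_dist hG (x := ω.ray m) hv hv' ?_ ?_ <;>
  · rw [G.dist_comm, G.dist_comm (u := ω.ray m)]
    omega

/-- Away from its own cylinder a vertex is one step lower than its predecessor. -/
theorem mem_cylinder_or_height (hG : G.IsTree) (ω : Boundary G o) {x y' y : X} (hadj : G.Adj y' y)
    (h : G.dist x y = G.dist x y' + 1) :
    ω ∈ cylinder G o x y ∨ height ω y = height ω y' - 1 := by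
  obtain ⟨n, hn⟩ : ∃ n, G.dist x y' = n := ⟨_, rfl⟩
  induction n generalizing y' y with
  | zero =>
    obtain rfl := hG.connected.dist_eq_zero_iff.1 hn
    rcases height_adj hG ω hadj with h1 | h1
    · left
      rw [mem_cylinder_iff_height hG]
      omega
    · exact Or.inr h1
  | succ n ih =>
    rcases height_adj hG ω hadj with h1 | h1
    · left
      obtain ⟨y'', hadj', hn'⟩ := exists_adj_of_dist hG.connected hn
      rcases ih hadj' (by omega) hn' with h2 | h2
      · rw [mem_cylinder_iff_height hG] at h2 ⊢
        omega
      -- The path has already descended from `y''` to `y'`, so `y''` is the only neighbour above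
      -- `y'`; an ascent to `y` would return to `y''`, against the distances from `x`.
      · have := eq_of_adj_of_height hG ω hadj' hadj.symm (by omega) h1
        subst this
        omega
    · exact Or.inr h1

theorem exists_mem_cylinder (hG : G.IsTree) (ω : Boundary G o) (x : X) (n : ℕ) :
    ∃ y, G.dist x y = n ∧ ω ∈ cylinder G o x y := by
  obtain ⟨ξ, h0, hξ, h1, -⟩ := exists_ray_of_eventually hG.connected ω.isGeodesicRay
    (x := x) (y := x) (by simp)
  have hn : G.dist x (ξ n) = n := by
    have := hξ 0 n
    rwa [h0, zero_add] at this
  exact ⟨ξ n, hn, ξ, h0, hξ, h1, by rw [hn]⟩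

theorem exists_adj_height (hG : G.IsTree) (ω : Boundary G o) (x : X) :
    ∃ y, G.Adj x y ∧ height ω y = height ω x + 1 := by
  obtain ⟨y, h1, h2⟩ := exists_mem_cylinder hG ω x 1
  rw [mem_cylinder_iff_height hG] at h2
  exact ⟨y, SimpleGraph.dist_eq_one_iff_adj.1 h1, by omega⟩

theorem mem_cylinder_self (hG : G.IsTree) (ω : Boundary G o) (x : X) : ω ∈ cylinder G o x x := by
  rw [mem_cylinder_iff_height hG]; simp

theorem eq_of_mem_cylinder (hG : G.IsTree) {ω : Boundary G o} {x y y' : X}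
    (hy : ω ∈ cylinder G o x y) (hy' : ω ∈ cylinder G o x y') (h : G.dist x y = G.dist x y') :
    y = y' := by
  rw [mem_cylinder_iff hG.connected] at hy hy'
  obtain ⟨m, h1, h2⟩ := (hy.and hy').exists
  exact eq_of_between hG h1 h2 h

/-- A vertex of `[x, ω)` seen from a vertex `w` which is not further away from `x`. -/
theorem mem_cylinder_of_dist_le (hG : G.IsTree) {ω : Boundary G o} {x z w : X}
    (hw : G.dist x w ≤ G.dist x z) (hz : ω ∈ cylinder G o x z) : ω ∈ cylinder G o w z := by
  obtain ⟨n, hn⟩ : ∃ n, G.dist x w = n := ⟨_, rfl⟩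
  induction n generalizing w with
  | zero => rwa [← hG.connected.dist_eq_zero_iff.1 hn]
  | succ n ih =>
    obtain ⟨w', hadj, hn'⟩ := exists_adj_of_dist hG.connected hn
    have h1 := ih (by omega) hn'
    rcases mem_cylinder_or_height hG ω (x := x) hadj (by omega) with h2 | h2
    -- Here `w` is on `[x, ω)`: the missing `k` steps from `w` towards `ω` end at distance `d(x, z)`
    -- from `x`, hence at `z`.
    · obtain ⟨k, hk⟩ := Nat.exists_eq_add_of_le hw
      obtain ⟨y, hy, hy'⟩ := exists_mem_cylinder hG ω w k
      have h3 : G.dist x y = G.dist x z := by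
        rw [mem_cylinder_iff_height hG] at h2 hy'
        have := height_sub_le hG ω x y
        have := hG.connected.dist_triangle (u := x) (v := w) (w := y)
        omega
      have h4 : ω ∈ cylinder G o x y := by
        rw [mem_cylinder_iff_height hG] at h2 hy' ⊢
        omega
      rwa [← eq_of_mem_cylinder hG h4 hz h3]
    -- Here `w` is one lower than `w'`, so the height gain from `w` to `z` is `d(w', z) + 1`, the
    -- largest value that `d(w, z)` can take.
    · rw [mem_cylinder_iff_height hG] at h1 ⊢
      have := height_sub_le hG ω w z
      have := hG.connected.dist_triangle (u := w) (v := w') (w := z)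
      rw [SimpleGraph.dist_eq_one_iff_adj.2 hadj.symm] at this
      omega

/-- Both `[x, ω)` and `[w, ω)` pass through `z`. The right side does not involve `ω`: on `Ω(x, z)`
the heights relative to `x` are constant for vertices no further from `x` than `z`. This gives
continuity in `ω` and lets waves leave the averages. -/
theorem height_sub_eq_of_mem_cylinder (hG : G.IsTree) {ω : Boundary G o} {x z w : X}
    (hw : G.dist x w ≤ G.dist x z) (hz : ω ∈ cylinder G o x z) :
    height ω w - height ω x = (G.dist x z : ℤ) - G.dist w z := by
  have := mem_cylinder_of_dist_le hG hw hz
  rw [mem_cylinder_iff_height hG] at this hz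
  omega

theorem cylinder_eq_univ (hG : G.IsTree) (x : X) : cylinder G o x x = Set.univ :=
  Set.eq_univ_of_forall fun ω => mem_cylinder_self hG ω x

theorem cylinder_subset_cylinder (hG : G.IsTree) {ω : Boundary G o} {x y z : X}
    (hy : ω ∈ cylinder G o x y) (hz : ω ∈ cylinder G o x z) (h : G.dist x y ≤ G.dist x z) :
    cylinder G o x z ⊆ cylinder G o x y := by
  intro ω' hω'
  have h1 := height_sub_eq_of_mem_cylinder hG h hz
  have h2 := height_sub_eq_of_mem_cylinder hG h hω'
  rw [mem_cylinder_iff_height hG] at hy ⊢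
  omega

theorem cylinderAround_eq (hG : G.IsTree) {ω : Boundary G o} {x y : X}
    (hy : ω ∈ cylinder G o x y) : cylinderAround x (G.dist x y) ω = cylinder G o x y := by
  ext ω'
  constructor
  · rintro ⟨y', h1, h2, h3⟩
    rwa [← eq_of_mem_cylinder hG h2 hy h1]
  · exact fun h => ⟨y, rfl, hy, h⟩

theorem isOpen_cylinder (x y : X) : IsOpen (cylinder G o x y) :=
  TopologicalSpace.GenerateOpen.basic _ ⟨x, y, rfl⟩

theorem measurableSet_cylinder (x y : X) : MeasurableSet (cylinder G o x y) :=
  (isOpen_cylinder x y).measurableSet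

/-- The cylinders seen from a fixed vertex are a neighbourhood basis. -/
theorem exists_cylinder_subset (hG : G.IsTree) (x : X) {U : Set (Boundary G o)} (hU : IsOpen U)
    {ω : Boundary G o} (hω : ω ∈ U) :
    ∃ N : ℕ, ∀ z, N ≤ G.dist x z → ω ∈ cylinder G o x z → cylinder G o x z ⊆ U := by
  induction hU with
  | basic s hs =>
    obtain ⟨x', y', rfl⟩ := hs
    refine ⟨max (G.dist x x') (G.dist x y'), fun z hz hωz ω' hω' => ?_⟩
    have h1 := height_sub_eq_of_mem_cylinder hG ((le_max_left _ _).trans hz) hωz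
    have h2 := height_sub_eq_of_mem_cylinder hG ((le_max_right _ _).trans hz) hωz
    have h3 := height_sub_eq_of_mem_cylinder hG ((le_max_left _ _).trans hz) hω'
    have h4 := height_sub_eq_of_mem_cylinder hG ((le_max_right _ _).trans hz) hω'
    rw [mem_cylinder_iff_height hG] at hω ⊢
    omega
  | univ => exact ⟨0, fun _ _ _ => Set.subset_univ _⟩
  | inter s t _ _ ihs iht =>
    obtain ⟨N, hN⟩ := ihs hω.1
    obtain ⟨M, hM⟩ := iht hω.2
    exact ⟨max N M, fun z hz hωz => Set.subset_inter (hN z ((le_max_left _ _).trans hz) hωz)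
      (hM z ((le_max_right _ _).trans hz) hωz)⟩
  | sUnion S _ ih =>
    obtain ⟨s, hs, hωs⟩ := hω
    obtain ⟨N, hN⟩ := ih s hs hωs
    exact ⟨N, fun z hz hωz => (hN z hz hωz).trans (Set.subset_sUnion_of_mem hs)⟩

theorem continuous_height_sub (hG : G.IsTree) (x y : X) :
    Continuous fun ω : Boundary G o => height ω y - height ω x := by
  refine (IsLocallyConstant.iff_exists_open _).2 (fun ω => ?_) |>.continuous
  obtain ⟨z, h1, h2⟩ := exists_mem_cylinder hG ω x (G.dist x y)
  refine ⟨_, isOpen_cylinder x z, h2, fun ω' hω' => ?_⟩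
  rw [height_sub_eq_of_mem_cylinder hG h1.ge hω', height_sub_eq_of_mem_cylinder hG h1.ge h2]

/-- Exactly one neighbour of `y` lies towards `ω`; the other `q` are one step lower. -/
theorem sum_neighborFinset_height [G.LocallyFinite] (hG : G.IsTree) {q : ℕ}
    (hreg : G.IsRegularOfDegree (q + 1)) (ω : Boundary G o) (y : X) (f : ℤ → ℂ) :
    ∑ z ∈ G.neighborFinset y, f (height ω z) = f (height ω y + 1) + q * f (height ω y - 1) := by
  classical
  obtain ⟨v, hv, hvh⟩ := exists_adj_height hG ω y
  rw [← Finset.add_sum_erase _ _ (a := v) (by simpa using hv), hvh,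
    Finset.sum_congr rfl (g := fun _ => f (height ω y - 1)), Finset.sum_const,
    Finset.card_erase_of_mem (by simpa using hv), G.card_neighborFinset_eq_degree, hreg y,
    nsmul_eq_mul]
  · rfl
  · intro z hz
    simp only [Finset.mem_erase, SimpleGraph.mem_neighborFinset] at hz
    rcases height_adj hG ω hz.2 with h | h
    · exact absurd (eq_of_adj_of_height hG ω hz.2.symm hv.symm h hvh) hz.1
    · rw [h]

end Geometry

/-! ### The boundary measures -/

section BoundaryMeasure

variable {X : Type*} {G : SimpleGraph X} {o : X} {q : ℕ}

theorem secondCountable_boundary [G.LocallyFinite] (hG : G.IsTree) :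
    SecondCountableTopology (Boundary G o) := by
  have : Countable X := countable_of_locallyFinite hG.connected o
  refine ⟨_, ?_, rfl⟩
  have : {s : Set (Boundary G o) | ∃ x y : X, s = cylinder G o x y} =
      Set.range fun p : X × X => cylinder G o p.1 p.2 := by
    ext s; simp [eq_comm]
  rw [this]
  exact Set.countable_range _

/-- The cylinders seen from the single vertex `x` are countably many and refine every open set. Two
of them are nested or disjoint, so they form a π-system, on which the masses determine `ν_x`. -/
theorem borel_eq_generateFrom_cylinder [G.LocallyFinite] (hG : G.IsTree) (x : X) :
    (inferInstance : MeasurableSpace (Boundary G o)) =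
      MeasurableSpace.generateFrom {s | ∃ z, s = cylinder G o x z} := by
  have : Countable X := countable_of_locallyFinite hG.connected o
  refine le_antisymm ?_ (MeasurableSpace.generateFrom_le ?_)
  · refine MeasurableSpace.generateFrom_le fun U (hU : IsOpen U) => ?_
    have : U = ⋃ z, ⋃ _ : cylinder G o x z ⊆ U, cylinder G o x z := by
      refine Set.Subset.antisymm (fun ω hω => ?_) (by simp)
      obtain ⟨N, hN⟩ := exists_cylinder_subset hG x hU hω
      obtain ⟨z, hz, hωz⟩ := exists_mem_cylinder hG ω x N
      simp only [Set.mem_iUnion]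
      exact ⟨z, hN z hz.ge hωz, hωz⟩
    rw [this]
    exact .iUnion fun z => .iUnion fun _ => MeasurableSpace.measurableSet_generateFrom ⟨z, rfl⟩
  · rintro s ⟨z, rfl⟩
    exact measurableSet_cylinder x z

theorem isPiSystem_cylinder (hG : G.IsTree) (x : X) :
    IsPiSystem {s : Set (Boundary G o) | ∃ z, s = cylinder G o x z} := by
  rintro _ ⟨z, rfl⟩ _ ⟨z', rfl⟩ ⟨ω, h, h'⟩
  rcases le_total (G.dist x z) (G.dist x z') with h1 | h1
  · exact ⟨z', Set.inter_eq_right.2 (cylinder_subset_cylinder hG h h' h1)⟩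
  · exact ⟨z, Set.inter_eq_left.2 (cylinder_subset_cylinder hG h' h h1)⟩

theorem IsBoundaryMeasure.unique [G.LocallyFinite] (hG : G.IsTree) {x : X}
    {μ ν : Measure (Boundary G o)} (hμ : IsBoundaryMeasure G q o x μ)
    (hν : IsBoundaryMeasure G q o x ν) : μ = ν := by
  have := hμ.prob
  have := hν.prob
  refine ext_of_generate_finite _ (borel_eq_generateFrom_cylinder hG x) (isPiSystem_cylinder hG x)
    ?_ (by simp)
  rintro _ ⟨z, rfl⟩
  rcases Nat.eq_zero_or_eq_succ_pred (G.dist x z) with h | h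
  · obtain rfl := hG.connected.dist_eq_zero_iff.1 h
    simp [cylinder_eq_univ hG]
  · rw [hμ.cyl _ _ h, hν.cyl _ _ h]

theorem isBoundaryMeasure_boundaryMeasure [G.LocallyFinite] (hG : G.IsTree) (hq : 2 ≤ q)
    (hreg : G.IsRegularOfDegree (q + 1)) (o x : X) :
    IsBoundaryMeasure G q o x (boundaryMeasure G q o x) := by
  have h := exists_isBoundaryMeasure hG (by omega : 1 ≤ q) hreg o x
  rw [boundaryMeasure, dif_pos h]
  exact h.choose_spec

theorem isProbabilityMeasure_boundaryMeasure [G.LocallyFinite] (hG : G.IsTree) (hq : 2 ≤ q)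
    (hreg : G.IsRegularOfDegree (q + 1)) (o x : X) :
    IsProbabilityMeasure (boundaryMeasure G q o x) :=
  (isBoundaryMeasure_boundaryMeasure hG hq hreg o x).prob

/-- The mass of the cylinders `Ω(x, y)` with `d(x, y) = n`. -/
noncomputable def cylMass (q : ℕ) : ℕ → ℝ
  | 0 => 1
  | n + 1 => (((q : ℝ) + 1) * (q : ℝ) ^ n)⁻¹

theorem cylMass_pos (hq : 2 ≤ q) (n : ℕ) : 0 < cylMass q n := by
  have : (0 : ℝ) < q := by positivity
  cases n <;> simp only [cylMass] <;> positivity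

theorem measureReal_cylinder [G.LocallyFinite] (hG : G.IsTree) (hq : 2 ≤ q)
    (hreg : G.IsRegularOfDegree (q + 1)) (x y : X) :
    (boundaryMeasure G q o x).real (cylinder G o x y) = cylMass q (G.dist x y) := by
  have := isProbabilityMeasure_boundaryMeasure hG hq hreg o x
  rcases Nat.eq_zero_or_eq_succ_pred (G.dist x y) with h | h
  · obtain rfl := hG.connected.dist_eq_zero_iff.1 h
    simp [cylinder_eq_univ hG, cylMass]
  · rw [measureReal_def, (isBoundaryMeasure_boundaryMeasure hG hq hreg o x).cyl _ _ h, h, cylMass]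
    simp [ENNReal.toReal_add]

/-- The boundary splits into `Ω(x, y)`, where the density is `q`, and its complement `Ω(y, x)`,
where it is `q⁻¹`. A cylinder `Ω(y, z)` with `z ≠ x` is also `Ω(x, z)`, and its masses seen from `x`
and from `y` differ by just this factor. By uniqueness the weighted measure is `ν_y`. -/
theorem isBoundaryMeasure_withDensity_of_adj [G.LocallyFinite] (hG : G.IsTree) (hq : 2 ≤ q)
    (hreg : G.IsRegularOfDegree (q + 1)) {x y : X} (hadj : G.Adj x y) :
    IsBoundaryMeasure G q o y ((boundaryMeasure G q o x).withDensity
      fun ω => (q : ℝ≥0∞) ^ (height ω y - height ω x)) := by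
  have hx := isBoundaryMeasure_boundaryMeasure hG hq hreg o x
  have := hx.prob
  have hxy := SimpleGraph.dist_eq_one_iff_adj.2 hadj
  have hyx := SimpleGraph.dist_eq_one_iff_adj.2 hadj.symm
  have hq0 : (q : ℝ≥0∞) ≠ 0 := by simp; omega
  have hqt : (q : ℝ≥0∞) ≠ ⊤ := by simp
  have hq1 : (q : ℝ≥0∞) + 1 ≠ 0 := by simp
  have hq1t : (q : ℝ≥0∞) + 1 ≠ ⊤ := by simp
  have hconst : ∀ (s : Set (Boundary G o)) (c : ℤ), MeasurableSet s →
      (∀ ω ∈ s, height ω y - height ω x = c) →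
      ((boundaryMeasure G q o x).withDensity fun ω => (q : ℝ≥0∞) ^ (height ω y - height ω x)) s =
        (q : ℝ≥0∞) ^ c * boundaryMeasure G q o x s := by
    intro s c hs h
    rw [withDensity_apply _ hs, setLIntegral_congr_fun hs (g := fun _ => (q : ℝ≥0∞) ^ c)
      fun ω hω => by simp only; rw [h ω hω], setLIntegral_const]
  have hcompl : (cylinder G o y x) = (cylinder G o x y)ᶜ := by
    ext ω
    rw [Set.mem_compl_iff, mem_cylinder_iff_height hG, mem_cylinder_iff_height hG, hxy, hyx]
    rcases height_adj hG ω hadj with h | h <;> omega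
  have hcx : ∀ ω ∈ cylinder G o y x, height ω y - height ω x = -1 := fun ω hω => by
    rw [mem_cylinder_iff_height hG] at hω; omega
  have hcy : ∀ ω ∈ cylinder G o x y, height ω y - height ω x = 1 := fun ω hω => by
    rw [mem_cylinder_iff_height hG] at hω; omega
  have hmy : boundaryMeasure G q o x (cylinder G o x y) = ((q : ℝ≥0∞) + 1)⁻¹ := by
    rw [hx.cyl 0 y (by simpa using hxy)]; simp
  have hmx : boundaryMeasure G q o x (cylinder G o y x) = q * ((q : ℝ≥0∞) + 1)⁻¹ := by
    rw [hcompl, prob_compl_eq_one_sub (measurableSet_cylinder x y), hmy]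
    refine ENNReal.sub_eq_of_eq_add (by simp) ?_
    have h := ENNReal.mul_inv_cancel hq1 hq1t
    rw [add_mul, one_mul] at h
    exact h.symm
  refine ⟨⟨?_⟩, fun n z hz => ?_⟩
  · rw [← Set.compl_union_self (cylinder G o x y), ← hcompl,
      measure_union (by rw [hcompl]; exact disjoint_compl_left) (measurableSet_cylinder x y),
      hconst _ _ (measurableSet_cylinder y x) hcx, hconst _ _ (measurableSet_cylinder x y) hcy,
      hmx, hmy, ← mul_assoc, ENNReal.zpow_neg, zpow_one, ENNReal.inv_mul_cancel hq0 hqt, one_mul]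
    have h := ENNReal.mul_inv_cancel hq1 hq1t
    rw [add_mul, one_mul, add_comm] at h
    exact h
  · rcases hG.dist_eq_dist_add_one_of_adj z hadj with h | h
    · rw [G.dist_comm (v := x), G.dist_comm (v := y)] at h
      have hcyl : cylinder G o y z = cylinder G o x z := by
        ext ω
        constructor
        · intro hω
          have h1 := height_sub_eq_of_mem_cylinder hG (w := x) (by omega) hω
          rw [mem_cylinder_iff_height hG] at hω ⊢
          omega
        · exact fun hω => mem_cylinder_of_dist_le hG (by omega) hω
      rw [hcyl, hconst _ 1 (measurableSet_cylinder x z), hx.cyl (n + 1) z (by omega), zpow_one,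
        pow_succ, ← mul_assoc, ENNReal.mul_inv (Or.inr hqt) (Or.inr hq0), mul_comm _ (q : ℝ≥0∞)⁻¹,
        ← mul_assoc, ENNReal.mul_inv_cancel hq0 hqt, one_mul]
      intro ω hω
      rw [height_sub_eq_of_mem_cylinder hG (by omega) hω]
      omega
    · rw [G.dist_comm (v := x), G.dist_comm (v := y)] at h
      -- The vertex `z = x` is exceptional: `Ω(y, x)` is not `Ω(x, x)`, and its mass is found from
      -- the complement.
      rcases Nat.eq_zero_or_eq_succ_pred n with h0 | h0
      · obtain rfl := hG.connected.dist_eq_zero_iff.1 (show G.dist x z = 0 by omega)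
        rw [hconst _ _ (measurableSet_cylinder y x) hcx, hmx, h0, ← mul_assoc, ENNReal.zpow_neg,
          zpow_one, ENNReal.inv_mul_cancel hq0 hqt, one_mul, pow_zero, mul_one]
      · have hcyl : cylinder G o y z = cylinder G o x z := by
          ext ω
          constructor
          · exact fun hω => mem_cylinder_of_dist_le hG (by omega) hω
          · intro hω
            have h1 := height_sub_eq_of_mem_cylinder hG (w := y) (by omega) hω
            rw [mem_cylinder_iff_height hG] at hω ⊢
            omega
        rw [hcyl, hconst _ (-1) (measurableSet_cylinder x z), hx.cyl n.pred z (by omega)]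
        · conv_rhs => rw [h0, pow_succ, ← mul_assoc, ENNReal.mul_inv (Or.inr hqt) (Or.inr hq0)]
          rw [ENNReal.zpow_neg, zpow_one, mul_comm]
        · intro ω hω
          rw [height_sub_eq_of_mem_cylinder hG (by omega) hω]
          omega

theorem integral_boundaryMeasure_of_adj [G.LocallyFinite] (hG : G.IsTree) (hq : 2 ≤ q)
    (hreg : G.IsRegularOfDegree (q + 1)) {x y : X} (hadj : G.Adj x y) (f : Boundary G o → ℂ) :
    ∫ ω, f ω ∂(boundaryMeasure G q o y) =
      ∫ ω, (q : ℂ) ^ (height ω y - height ω x) * f ω ∂(boundaryMeasure G q o x) := by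
  have hq0 : (q : ℝ≥0∞) ≠ 0 := by simp; omega
  rw [(isBoundaryMeasure_boundaryMeasure hG hq hreg o y).unique hG
    (isBoundaryMeasure_withDensity_of_adj hG hq hreg hadj),
    integral_withDensity_eq_integral_toReal_smul]
  · refine integral_congr_ae (ae_of_all _ fun ω => ?_)
    beta_reduce
    generalize height ω y - height ω x = n
    rcases n with n | n <;> simp
  · have : Continuous fun n : ℤ => (q : ℝ≥0∞) ^ n := continuous_of_discreteTopology
    exact (this.comp (continuous_height_sub hG x y)).measurable
  · exact ae_of_all _ fun ω => ENNReal.zpow_lt_top hq0 (by simp) _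

/-- Change of the centre of the boundary measure. -/
theorem integral_boundaryMeasure [G.LocallyFinite] (hG : G.IsTree) (hq : 2 ≤ q)
    (hreg : G.IsRegularOfDegree (q + 1)) (x y : X) (f : Boundary G o → ℂ) :
    ∫ ω, f ω ∂(boundaryMeasure G q o y) =
      ∫ ω, (q : ℂ) ^ (height ω y - height ω x) * f ω ∂(boundaryMeasure G q o x) := by
  have hq0 : (q : ℂ) ≠ 0 := by simp; omega
  obtain ⟨p⟩ := hG.connected x y
  induction p with
  | nil => simp
  | cons h p ih =>
    rw [ih, integral_boundaryMeasure_of_adj hG hq hreg h]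
    refine integral_congr_ae (ae_of_all _ fun ω => ?_)
    simp only
    rw [← mul_assoc, ← zpow_add₀ hq0]
    congr 2
    ring

/-! ### Spheres -/

/-- The cylinders over a sphere are disjoint, of equal known mass, and have total mass at most one.
The factor `2` absorbs `(q + 1) / q`. -/
theorem card_le_of_dist_eq [G.LocallyFinite] (hG : G.IsTree) (hq : 2 ≤ q)
    (hreg : G.IsRegularOfDegree (q + 1)) (o : X) (x : X) (n : ℕ) (s : Finset X)
    (hs : ∀ y ∈ s, G.dist x y = n) : (s.card : ℝ) ≤ 2 * (q : ℝ) ^ n := by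
  have := isProbabilityMeasure_boundaryMeasure hG hq hreg o x
  have h1 : ∑ y ∈ s, (boundaryMeasure G q o x).real (cylinder G o x y) ≤ 1 := by
    rw [← measureReal_biUnion_finset]
    · exact measureReal_le_one
    · intro y hy y' hy' hne
      refine Set.disjoint_left.2 fun ω hω hω' => hne ?_
      exact eq_of_mem_cylinder hG hω hω' ((hs y hy).trans (hs y' hy').symm)
    · exact fun y _ => measurableSet_cylinder x y
  rw [Finset.sum_congr rfl fun y hy => by rw [measureReal_cylinder hG hq hreg, hs y hy],
    Finset.sum_const, nsmul_eq_mul, ← le_div_iff₀ (cylMass_pos hq n)] at h1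
  refine h1.trans ?_
  have hq' : (2 : ℝ) ≤ q := by exact_mod_cast hq
  cases n with
  | zero => simp [cylMass]
  | succ n =>
    rw [cylMass, one_div, inv_inv, pow_succ]
    have : (0 : ℝ) ≤ (q : ℝ) ^ n := by positivity
    nlinarith

theorem finite_sphere [G.LocallyFinite] (hG : G.IsTree) (hq : 2 ≤ q)
    (hreg : G.IsRegularOfDegree (q + 1)) (x : X) (n : ℕ) : {y | G.dist x y = n}.Finite := by
  by_contra h
  obtain ⟨s, hs, hcard⟩ := Set.Infinite.exists_subset_card_eq h (2 * q ^ n + 1)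
  have := card_le_of_dist_eq hG hq hreg x x n s fun y hy => hs hy
  rw [hcard] at this
  push_cast at this
  linarith

/-- The growth of the wave at energy `1/2` along finite subsets of spheres. -/
theorem sum_sphere_le [G.LocallyFinite] (hG : G.IsTree) (hq : 2 ≤ q)
    (hreg : G.IsRegularOfDegree (q + 1)) (ω : Boundary G o) (n : ℕ) (x : X) (s : Finset X)
    (hs : ∀ y ∈ s, G.dist x y = n) :
    ∑ y ∈ s, √(q : ℝ) ^ (height ω y - height ω x) ≤ 2 * (n + 1) * √(q : ℝ) ^ n := by
  classical
  have hR : 0 < √(q : ℝ) := by rw [Real.sqrt_pos]; positivity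
  have hRq : √(q : ℝ) ^ 2 = q := Real.sq_sqrt (by positivity)
  induction n generalizing x s with
  | zero =>
    have hsub : s ⊆ {x} := fun y hy => by
      rw [Finset.mem_singleton]
      exact (hG.connected.dist_eq_zero_iff.1 (hs y hy)).symm
    calc _ ≤ ∑ y ∈ ({x} : Finset X), √(q : ℝ) ^ (height ω y - height ω x) :=
          Finset.sum_le_sum_of_subset_of_nonneg hsub fun y _ _ => by positivity
      _ ≤ _ := by simp
  | succ n ih =>
    -- Take the neighbour `v` of `x` towards `ω`. Vertices at distance `n` from `v` are covered by
    -- induction, with one factor `√q`. The others lie behind `x` as seen from `ω`, at height `-(n +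
    -- 1)` relative to `x`, so their number compensates their size.
    obtain ⟨v, hv, hvh⟩ := exists_adj_height hG ω x
    have hxv := SimpleGraph.dist_eq_one_iff_adj.2 hv
    rw [← Finset.sum_filter_add_sum_filter_not s (fun y => G.dist v y = n)]
    have h1 := ih v (s.filter fun y => G.dist v y = n) (fun y hy => (Finset.mem_filter.1 hy).2)
    have h2 : ∀ y ∈ s.filter (fun y => ¬ G.dist v y = n),
        √(q : ℝ) ^ (height ω y - height ω x) = (√(q : ℝ) ^ (n + 1))⁻¹ := by
      intro y hy
      obtain ⟨hy1, hy2⟩ := Finset.mem_filter.1 hy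
      have h3 := hs y hy1
      have h4 := hG.dist_eq_dist_add_one_of_adj y hv
      rw [G.dist_comm, G.dist_comm (u := y)] at h4
      have h5 : height ω y - height ω x = -((n + 1 : ℕ) : ℤ) := by
        rcases mem_cylinder_or_height hG ω (x := y) hv (by
          rw [G.dist_comm, G.dist_comm (u := y)]; omega) with h6 | h6
        · rw [mem_cylinder_iff_height hG, G.dist_comm] at h6
          omega
        · omega
      rw [h5, zpow_neg, zpow_natCast]
    have h3 : ∀ y, √(q : ℝ) ^ (height ω y - height ω x) =
        √(q : ℝ) * √(q : ℝ) ^ (height ω y - height ω v) := by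
      intro y
      rw [← zpow_one_add₀ hR.ne', hvh]
      congr 1
      ring
    have h4 := card_le_of_dist_eq hG hq hreg o x (n + 1) (s.filter fun y => ¬ G.dist v y = n)
      fun y hy => hs y (Finset.mem_filter.1 hy).1
    rw [Finset.sum_congr rfl fun y _ => h3 y, ← Finset.mul_sum, Finset.sum_congr rfl h2,
      Finset.sum_const, nsmul_eq_mul]
    have h5 : (q : ℝ) ^ (n + 1) * (√(q : ℝ) ^ (n + 1))⁻¹ = √(q : ℝ) ^ (n + 1) := by
      rw [← div_eq_mul_inv, div_eq_iff (by positivity), ← mul_pow,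
        Real.mul_self_sqrt (by positivity)]
    calc _ ≤ √(q : ℝ) * (2 * (n + 1) * √(q : ℝ) ^ n) +
          2 * (q : ℝ) ^ (n + 1) * (√(q : ℝ) ^ (n + 1))⁻¹ := by gcongr
      _ = _ := by
          rw [mul_assoc 2 ((q : ℝ) ^ (n + 1)), h5]
          push_cast
          ring

end BoundaryMeasure

/-! ### Oscillating integrals and flat functions on an interval -/

section Analysis

open Set in
/-- A smooth function on an interval which is flat at the ends extends smoothly by zero. -/
theorem iteratedDeriv_indicator_Icc {T : ℝ} (hT : 0 < T) {f : ℝ → ℂ}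
    (hf : ContDiffOn ℝ (⊤ : ℕ∞) f (Icc 0 T))
    (h0 : ∀ k, iteratedDerivWithin k f (Icc 0 T) 0 = 0)
    (hT0 : ∀ k, iteratedDerivWithin k f (Icc 0 T) T = 0) (k : ℕ) :
    iteratedDeriv k ((Icc 0 T).indicator f) =
        (Icc 0 T).indicator (iteratedDerivWithin k f (Icc 0 T)) ∧
      Differentiable ℝ ((Icc 0 T).indicator (iteratedDerivWithin k f (Icc 0 T))) := by
  have hu : UniqueDiffOn ℝ (Icc (0 : ℝ) T) := uniqueDiffOn_Icc hT
  -- At `0` and `T` the derivative from outside is `0` and the one from inside is the next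
  -- derivative of `f`, which vanishes there by flatness; the two one-sided derivatives therefore
  -- glue.
  have key : ∀ (k : ℕ) (s : ℝ), HasDerivAt ((Icc 0 T).indicator (iteratedDerivWithin k f (Icc 0 T)))
      ((Icc 0 T).indicator (iteratedDerivWithin (k + 1) f (Icc 0 T)) s) s := by
    intro k s
    have hin : ∀ s ∈ Icc 0 T, HasDerivWithinAt ((Icc 0 T).indicator
        (iteratedDerivWithin k f (Icc 0 T))) (iteratedDerivWithin (k + 1) f (Icc 0 T) s)
        (Icc 0 T) s := by
      intro s hs
      have h1 := (hf.differentiableOn_iteratedDerivWithin (m := k)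
        (by exact_mod_cast WithTop.coe_lt_top _) hu s hs).hasDerivWithinAt
      rw [← iteratedDerivWithin_succ] at h1
      exact h1.congr (fun y hy => indicator_of_mem hy _) (indicator_of_mem hs _)
    have hout : ∀ (s : ℝ) (t : Set ℝ), s ∈ t →
        (∀ y ∈ t, (Icc 0 T).indicator (iteratedDerivWithin k f (Icc 0 T)) y = 0) →
        HasDerivWithinAt ((Icc 0 T).indicator (iteratedDerivWithin k f (Icc 0 T))) 0 t s :=
      fun s t hs ht => (hasDerivWithinAt_const s t 0).congr ht (ht s hs)
    have hIic : ∀ y ∈ Iic (0 : ℝ),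
        (Icc 0 T).indicator (iteratedDerivWithin k f (Icc 0 T)) y = 0 := by
      intro y hy
      rcases eq_or_lt_of_le (show y ≤ 0 from hy) with rfl | hy
      · rw [indicator_of_mem (left_mem_Icc.2 hT.le), h0]
      · exact indicator_of_notMem (fun h => absurd h.1 (not_le.2 hy)) _
    have hIci : ∀ y ∈ Ici T,
        (Icc 0 T).indicator (iteratedDerivWithin k f (Icc 0 T)) y = 0 := by
      intro y hy
      rcases eq_or_lt_of_le (show T ≤ y from hy) with rfl | hy
      · rw [indicator_of_mem (right_mem_Icc.2 hT.le), hT0]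
      · exact indicator_of_notMem (fun h => absurd h.2 (not_le.2 hy)) _
    rcases lt_trichotomy s 0 with hs | rfl | hs
    · rw [indicator_of_notMem fun h => absurd h.1 (not_le.2 hs)]
      exact (hout s (Iic 0) hs.le hIic).hasDerivAt (Iic_mem_nhds hs)
    · rw [indicator_of_mem (left_mem_Icc.2 hT.le), h0]
      have h1 := hin 0 (left_mem_Icc.2 hT.le)
      rw [h0] at h1
      have h2 := (hout 0 (Iic 0) (mem_Iic.2 le_rfl) hIic).union h1
      refine h2.hasDerivAt (mem_of_superset (Iic_mem_nhds hT) fun y hy => ?_)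
      rcases le_total y 0 with h | h
      · exact Or.inl h
      · exact Or.inr ⟨h, hy⟩
    · rcases lt_trichotomy s T with hsT | rfl | hsT
      · rw [indicator_of_mem (show s ∈ Icc 0 T from ⟨hs.le, hsT.le⟩)]
        exact (hin s ⟨hs.le, hsT.le⟩).hasDerivAt (Icc_mem_nhds hs hsT)
      · rw [indicator_of_mem (right_mem_Icc.2 hT.le), hT0]
        have h1 := hin s (right_mem_Icc.2 hT.le)
        rw [hT0] at h1
        have h2 := (hout s (Ici s) (mem_Ici.2 le_rfl) hIci).union h1
        refine h2.hasDerivAt (mem_of_superset (Ici_mem_nhds hT) fun y hy => ?_)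
        rcases le_total y s with h | h
        · exact Or.inr ⟨hy, h⟩
        · exact Or.inl h
      · rw [indicator_of_notMem fun h => absurd h.2 (not_le.2 hsT)]
        exact (hout s (Ici T) hsT.le hIci).hasDerivAt (Ici_mem_nhds hsT)
  refine ⟨?_, fun s => (key k s).differentiableAt⟩
  induction k with
  | zero => simp
  | succ k ih =>
    rw [iteratedDeriv_succ, ih]
    exact funext fun s => (key k s).deriv

theorem contDiff_indicator_Icc {T : ℝ} (hT : 0 < T) {f : ℝ → ℂ}
    (hf : ContDiffOn ℝ (⊤ : ℕ∞) f (Set.Icc 0 T))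
    (h0 : ∀ k, iteratedDerivWithin k f (Set.Icc 0 T) 0 = 0)
    (hT0 : ∀ k, iteratedDerivWithin k f (Set.Icc 0 T) T = 0) :
    ContDiff ℝ (⊤ : ℕ∞) ((Set.Icc 0 T).indicator f) := by
  refine contDiff_of_differentiable_iteratedDeriv fun m _ => ?_
  rw [(iteratedDeriv_indicator_Icc hT hf h0 hT0 m).1]
  exact (iteratedDeriv_indicator_Icc hT hf h0 hT0 m).2

/-- The derivatives are continuous, so their vanishing passes to the closure. With `U` a half line
outside `[0, τ]`, this is flatness at an endpoint. -/
theorem iteratedDeriv_eq_zero_of_eqOn {f : ℝ → ℂ} (hf : ContDiff ℝ (⊤ : ℕ∞) f) {U : Set ℝ}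
    (hU : IsOpen U) (h : ∀ s ∈ U, f s = 0) {s : ℝ} (hs : s ∈ closure U) (k : ℕ) :
    iteratedDeriv k f s = 0 := by
  have hc : Continuous (iteratedDeriv k f) :=
    hf.continuous_iteratedDeriv k (by exact_mod_cast le_top)
  have : closure U ⊆ {s | iteratedDeriv k f s = 0} := by
    refine closure_minimal (fun t ht => ?_) (isClosed_eq hc continuous_const)
    have h1 : f =ᶠ[nhds t] fun _ => (0 : ℂ) := by
      filter_upwards [hU.mem_nhds ht] with r hr using h r hr
    have h2 := h1.iteratedDeriv_eq k
    rw [Set.mem_ofPred_eq, h2]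
    simp
  exact this hs

theorem norm_iteratedDeriv_mul_le {f g : ℝ → ℂ} (hf : ContDiff ℝ (⊤ : ℕ∞) f)
    (hg : ContDiff ℝ (⊤ : ℕ∞) g) (n : ℕ) (s : ℝ) {A B : ℝ}
    (hA : ∀ k ≤ n, ‖iteratedDeriv k f s‖ ≤ A) (hB : ∀ k ≤ n, ‖iteratedDeriv k g s‖ ≤ B) :
    ‖iteratedDeriv n (fun s => f s * g s) s‖ ≤ 2 ^ n * (A * B) := by
  have hA0 : 0 ≤ A := (norm_nonneg _).trans (hA 0 (Nat.zero_le _))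
  rw [← norm_iteratedFDeriv_eq_norm_iteratedDeriv]
  refine (norm_iteratedFDeriv_mul_le (n := n) hf hg s (by exact_mod_cast le_top)).trans ?_
  simp only [norm_iteratedFDeriv_eq_norm_iteratedDeriv]
  calc _ ≤ ∑ i ∈ Finset.range (n + 1), (n.choose i : ℝ) * (A * B) := by
        refine Finset.sum_le_sum fun i hi => ?_
        rw [mul_assoc]
        have := Finset.mem_range_succ_iff.1 hi
        gcongr
        · exact hA i this
        · exact hB _ (Nat.sub_le _ _)
    _ = _ := by
        rw [← Finset.sum_mul]
        congr 1
        exact_mod_cast Nat.sum_range_choose n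

/-- Integration by parts `N` times: flatness kills the boundary terms, and `c.re = 0` keeps the
exponential of modulus one. -/
theorem norm_integral_exp_mul_le {T : ℝ} (hT : 0 ≤ T) {g : ℝ → ℂ}
    (hg : ContDiff ℝ (⊤ : ℕ∞) g) (h0 : ∀ k, iteratedDeriv k g 0 = 0)
    (hT0 : ∀ k, iteratedDeriv k g T = 0) {c : ℂ} (hc : c.re = 0) (N : ℕ) {M : ℝ}
    (hM : ∀ s ∈ Set.Icc 0 T, ‖iteratedDeriv N g s‖ ≤ M) :
    ‖c‖ ^ N * ‖∫ s in (0 : ℝ)..T, Complex.exp (c * s) * g s‖ ≤ M * T := by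
  induction N generalizing g with
  | zero =>
    rw [pow_zero, one_mul]
    have := intervalIntegral.norm_integral_le_of_norm_le_const (a := 0) (b := T) (C := M)
      (f := fun s : ℝ => Complex.exp (c * s) * g s) (fun s hs => ?_)
    · simpa [abs_of_nonneg hT] using this
    · rw [Set.uIoc_of_le hT] at hs
      rw [norm_mul, Complex.norm_exp]
      simpa [hc] using hM s ⟨hs.1.le, hs.2⟩
  | succ N ih =>
    have hg' : ContDiff ℝ (⊤ : ℕ∞) (deriv g) :=
      (contDiff_infty_iff_deriv.1 hg).2
    have h1 := ih hg' (fun k => by rw [← iteratedDeriv_succ']; exact h0 _)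
      (fun k => by rw [← iteratedDeriv_succ']; exact hT0 _)
      (fun s hs => by rw [← iteratedDeriv_succ']; exact hM s hs)
    have h2 : ∫ s in (0 : ℝ)..T, g s * (Complex.exp (c * s) * c) =
        -∫ s in (0 : ℝ)..T, deriv g s * Complex.exp (c * s) := by
      rw [intervalIntegral.integral_mul_deriv_eq_deriv_mul (u' := deriv g)
        (v := fun s : ℝ => Complex.exp (c * s))]
      · have ha := h0 0
        have hb := hT0 0
        rw [iteratedDeriv_zero] at ha hb
        simp [ha, hb]
      · exact fun s _ => ((contDiff_infty_iff_deriv.1 hg).1 s).hasDerivAt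
      · intro s _
        have h3 : HasDerivAt (fun s : ℝ => c * (s : ℂ)) c s := by
          simpa using (Complex.ofRealCLM.hasDerivAt (x := s)).const_mul c
        exact h3.cexp
      · exact (hg'.continuous).intervalIntegrable _ _
      · exact Continuous.intervalIntegrable (by fun_prop) _ _
    have h3 : c * ∫ s in (0 : ℝ)..T, Complex.exp (c * s) * g s =
        -∫ s in (0 : ℝ)..T, Complex.exp (c * s) * deriv g s := by
      rw [← intervalIntegral.integral_const_mul]
      calc _ = ∫ s in (0 : ℝ)..T, g s * (Complex.exp (c * s) * c) := by
            congr 1; funext s; ring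
        _ = _ := by rw [h2]; congr 2; funext s; ring
    rw [pow_succ, mul_assoc, ← norm_mul, h3, norm_neg]
    exact h1

/-- Rapid decay of the Fourier coefficients of a flat function. -/
theorem one_add_pow_mul_norm_integral_exp_le {T : ℝ} (hT : 0 ≤ T) {g : ℝ → ℂ}
    (hg : ContDiff ℝ (⊤ : ℕ∞) g) (h0 : ∀ k, iteratedDeriv k g 0 = 0)
    (hT0 : ∀ k, iteratedDeriv k g T = 0) {L : ℝ} (hL : 0 < L) (m : ℤ) (N : ℕ) {M : ℝ}
    (hM : ∀ k ≤ N, ∀ s ∈ Set.Icc 0 T, ‖iteratedDeriv k g s‖ ≤ M) :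
    (1 + |(m : ℝ)|) ^ N * ‖∫ s in (0 : ℝ)..T, Complex.exp (m * L * Complex.I * s) * g s‖ ≤
      (1 + L⁻¹) ^ N * (2 ^ N * (M * T)) := by
  set J := ‖∫ s in (0 : ℝ)..T, Complex.exp (m * L * Complex.I * s) * g s‖
  -- All orders `k ≤ N` are needed, since `(1 + |m|) ^ N` is expanded by the binomial formula; each
  -- integration by parts costs `L⁻¹`.
  have h : ∀ k ≤ N, |(m : ℝ)| ^ k * J ≤ (1 + L⁻¹) ^ N * (M * T) := by
    intro k hk
    have h1 := norm_integral_exp_mul_le hT hg h0 hT0 (c := m * L * Complex.I) (by simp) k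
      (hM k hk)
    rw [norm_mul, norm_mul, Complex.norm_I, mul_one, Complex.norm_intCast, Complex.norm_real,
      Real.norm_of_nonneg hL.le] at h1
    have hMT : 0 ≤ M * T := le_trans (by positivity) h1
    have h2 : |(m : ℝ)| ^ k * J = L⁻¹ ^ k * ((|(m : ℝ)| * L) ^ k * J) := by
      rw [← mul_assoc, ← mul_pow]
      congr 2
      field_simp
    rw [h2]
    have hL0 : 0 ≤ L⁻¹ := by positivity
    calc _ ≤ (1 + L⁻¹) ^ k * (M * T) := by gcongr; linarith
      _ ≤ _ := by gcongr; linarith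
  calc (1 + |(m : ℝ)|) ^ N * J = ∑ k ∈ Finset.range (N + 1), (|(m : ℝ)| ^ k * J) * N.choose k := by
        rw [add_comm, add_pow, Finset.sum_mul]
        refine Finset.sum_congr rfl fun k _ => ?_
        ring
    _ ≤ ∑ k ∈ Finset.range (N + 1), ((1 + L⁻¹) ^ N * (M * T)) * N.choose k := by
        refine Finset.sum_le_sum fun k hk => ?_
        exact mul_le_mul_of_nonneg_right (h k (Finset.mem_range_succ_iff.1 hk)) (by positivity)
    _ = _ := by
        rw [← Finset.mul_sum]
        have : ∑ k ∈ Finset.range (N + 1), (N.choose k : ℝ) = 2 ^ N := by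
          exact_mod_cast Nat.sum_range_choose N
        rw [this]
        ring

end Analysis

/-! ### Waves -/

section Wave

variable {X : Type*} {G : SimpleGraph X} {o : X} {q : ℕ}

/-- `q ^ (i s)`. -/
noncomputable def phase (q : ℕ) (s : ℝ) : ℂ := Complex.exp (Real.log q * Complex.I * s)

/-- `q ^ (1 / 2 + i s)`. -/
noncomputable def waveBase (q : ℕ) (s : ℝ) : ℂ := (√(q : ℝ) : ℂ) * phase q s

theorem phase_ne_zero (q : ℕ) (s : ℝ) : phase q s ≠ 0 := Complex.exp_ne_zero _

theorem norm_phase (q : ℕ) (s : ℝ) : ‖phase q s‖ = 1 := by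
  rw [phase, show (Real.log q : ℂ) * Complex.I * s = ((Real.log q * s : ℝ) : ℂ) * Complex.I by
    push_cast; ring, Complex.norm_exp_ofReal_mul_I]

theorem phase_neg (q : ℕ) (s : ℝ) : phase q (-s) = (phase q s)⁻¹ := by
  rw [phase, phase, ← Complex.exp_neg]
  push_cast
  congr 1; ring

theorem phase_zpow (q : ℕ) (s : ℝ) (m : ℤ) :
    phase q s ^ m = Complex.exp (m * Real.log q * Complex.I * s) := by
  rw [phase, ← Complex.exp_int_mul]
  congr 1; ring

theorem contDiff_phase_zpow (q : ℕ) (m : ℤ) : ContDiff ℝ (⊤ : ℕ∞) fun s => phase q s ^ m := by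
  simp_rw [phase_zpow]
  exact Complex.contDiff_exp.comp (contDiff_const.mul Complex.ofRealCLM.contDiff)

theorem continuous_phase (q : ℕ) : Continuous (phase q) := by
  unfold phase; fun_prop

theorem sqrt_pos (hq : 2 ≤ q) : 0 < √(q : ℝ) := by rw [Real.sqrt_pos]; positivity

theorem sqrt_mul_self (q : ℕ) : (√(q : ℝ) : ℂ) * √(q : ℝ) = q := by
  rw [← Complex.ofReal_mul, Real.mul_self_sqrt (by positivity)]; simp

theorem sqrt_ne_zero (hq : 2 ≤ q) : (√(q : ℝ) : ℂ) ≠ 0 :=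
  Complex.ofReal_ne_zero.2 (sqrt_pos hq).ne'

theorem waveBase_ne_zero (hq : 2 ≤ q) (s : ℝ) : waveBase q s ≠ 0 :=
  mul_ne_zero (sqrt_ne_zero hq) (phase_ne_zero q s)

theorem norm_waveBase (q : ℕ) (s : ℝ) : ‖waveBase q s‖ = √(q : ℝ) := by
  rw [waveBase, norm_mul, norm_phase, mul_one, Complex.norm_real,
    Real.norm_of_nonneg (Real.sqrt_nonneg _)]

theorem waveBase_mul_neg (q : ℕ) (s : ℝ) : waveBase q s * waveBase q (-s) = q := by
  rw [waveBase, waveBase, phase_neg, mul_mul_mul_comm, sqrt_mul_self,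
    mul_inv_cancel₀ (phase_ne_zero q s), mul_one]

theorem waveBase_eq_cpow (hq : 2 ≤ q) (s : ℝ) :
    waveBase q s = (q : ℂ) ^ (1 / 2 + Complex.I * (s : ℂ)) := by
  have hq0 : (q : ℂ) ≠ 0 := by simp; omega
  rw [Complex.cpow_add _ _ hq0, waveBase, phase, Real.sqrt_eq_rpow,
    Complex.ofReal_cpow (by positivity), Complex.cpow_def_of_ne_zero hq0 (Complex.I * s),
    ← Complex.natCast_log]
  push_cast
  congr 2
  ring

theorem wave_eq_zpow (hq : 2 ≤ q) (x y : X) (ω : Boundary G o) (s : ℝ) :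
    wave q x y ω s = waveBase q s ^ (height ω y - height ω x) := by
  rw [waveBase_eq_cpow hq, ← Complex.cpow_mul_int, wave]
  push_cast
  rfl

theorem wave_eq (hq : 2 ≤ q) (x y : X) (ω : Boundary G o) (s : ℝ) :
    wave q x y ω s = (√(q : ℝ) : ℂ) ^ (height ω y - height ω x) *
      phase q s ^ (height ω y - height ω x) := by
  rw [wave_eq_zpow hq, waveBase, mul_zpow]

theorem norm_wave (hq : 2 ≤ q) (x y : X) (ω : Boundary G o) (s : ℝ) :
    ‖wave q x y ω s‖ = √(q : ℝ) ^ (height ω y - height ω x) := by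
  rw [wave_eq_zpow hq, norm_zpow, norm_waveBase]

theorem norm_wave_le [G.LocallyFinite] (hG : G.IsTree) (hq : 2 ≤ q) (x y : X) (ω : Boundary G o)
    (s : ℝ) : ‖wave q x y ω s‖ ≤ √(q : ℝ) ^ G.dist x y := by
  have h1 : (1 : ℝ) ≤ √(q : ℝ) := by
    rw [Real.one_le_sqrt]
    exact_mod_cast (by omega : 1 ≤ q)
  rw [norm_wave hq, ← zpow_natCast]
  exact zpow_le_zpow_right₀ h1 (height_sub_le hG ω x y)

theorem wave_ne_zero (hq : 2 ≤ q) (x y : X) (ω : Boundary G o) (s : ℝ) : wave q x y ω s ≠ 0 := by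
  rw [wave_eq_zpow hq]
  exact zpow_ne_zero _ (waveBase_ne_zero hq s)

theorem wave_self (hq : 2 ≤ q) (x : X) (ω : Boundary G o) (s : ℝ) : wave q x x ω s = 1 := by
  rw [wave_eq_zpow hq, sub_self, zpow_zero]

theorem wave_mul_wave (hq : 2 ≤ q) (x y z : X) (ω : Boundary G o) (s : ℝ) :
    wave q x y ω s * wave q y z ω s = wave q x z ω s := by
  rw [wave_eq_zpow hq, wave_eq_zpow hq, wave_eq_zpow hq, ← zpow_add₀ (waveBase_ne_zero hq s)]
  congr 1
  ring

/-- The phases at `s` and `-s` cancel. What remains is the density of `ν_y` with respect to `ν_x`,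
so a product of this kind moves the base point of an integral. -/
theorem wave_mul_wave_neg (hq : 2 ≤ q) (x y : X) (ω : Boundary G o) (s : ℝ) :
    wave q x y ω s * wave q x y ω (-s) = (q : ℂ) ^ (height ω y - height ω x) := by
  rw [wave_eq_zpow hq, wave_eq_zpow hq, ← mul_zpow, waveBase_mul_neg]

theorem continuous_wave (hG : G.IsTree) (hq : 2 ≤ q) (x y : X) :
    Continuous fun p : Boundary G o × ℝ => wave q x y p.1 p.2 := by
  have h1 := continuous_height_sub (o := o) hG x y
  have h2 : Continuous fun p : ℤ × ℝ => waveBase q p.2 ^ p.1 := by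
    refine continuous_iff_continuousAt.2 fun ⟨m, s⟩ => ?_
    have : (fun p : ℤ × ℝ => waveBase q p.2 ^ p.1) =ᶠ[nhds (m, s)]
        fun p => waveBase q p.2 ^ m := by
      have h3 : {p : ℤ × ℝ | p.1 = m} ∈ nhds (m, s) :=
        ((isOpen_discrete {m}).preimage continuous_fst).mem_nhds rfl
      filter_upwards [h3] with p hp
      rw [hp]
    refine ContinuousAt.congr ?_ this.symm
    refine ContinuousAt.zpow₀ ?_ _ (Or.inl (waveBase_ne_zero hq s))
    have : Continuous fun p : ℤ × ℝ => waveBase q p.2 := by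
      unfold waveBase
      exact continuous_const.mul ((continuous_phase q).comp continuous_snd)
    exact this.continuousAt
  have h3 : (fun p : Boundary G o × ℝ => wave q x y p.1 p.2) =
      (fun p : ℤ × ℝ => waveBase q p.2 ^ p.1) ∘
        fun p : Boundary G o × ℝ => (height p.1 y - height p.1 x, p.2) := by
    funext p
    exact wave_eq_zpow hq x y p.1 p.2
  rw [h3]
  exact h2.comp ((h1.comp continuous_fst).prodMk continuous_snd)

theorem continuous_wave_neg (hG : G.IsTree) (hq : 2 ≤ q) (x y : X) :
    Continuous fun p : Boundary G o × ℝ => wave q x y p.1 (-p.2) := by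
  have h : Continuous fun p : Boundary G o × ℝ => (p.1, -p.2) := by fun_prop
  exact Continuous.comp (g := fun p : Boundary G o × ℝ => wave q x y p.1 p.2)
    (f := fun p : Boundary G o × ℝ => (p.1, -p.2)) (continuous_wave hG hq x y) h

theorem contDiff_wave_neg (hq : 2 ≤ q) (x y : X) (ω : Boundary G o) :
    ContDiff ℝ (⊤ : ℕ∞) fun s => wave q x y ω (-s) := by
  simp_rw [wave_eq hq]
  exact contDiff_const.mul ((contDiff_phase_zpow q _).comp contDiff_neg)

/-- The derivatives of a wave are multiples of the wave. -/
theorem iteratedDeriv_wave_neg (hq : 2 ≤ q) (x y : X) (ω : Boundary G o) (k : ℕ) (s : ℝ) :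
    iteratedDeriv k (fun s => wave q x y ω (-s)) s =
      (-((height ω y - height ω x : ℤ) : ℂ) * Real.log q * Complex.I) ^ k * wave q x y ω (-s) := by
  induction k generalizing s with
  | zero => simp
  | succ k ih =>
    rw [iteratedDeriv_succ, funext ih]
    have h1 : (fun s : ℝ => wave q x y ω (-s)) = fun s : ℝ =>
        (√(q : ℝ) : ℂ) ^ (height ω y - height ω x) * Complex.exp
        ((-((height ω y - height ω x : ℤ) : ℂ) * Real.log q * Complex.I) * s) := by
      funext s
      rw [wave_eq hq, phase_zpow]
      push_cast
      congr 2
      ring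
    set c : ℂ := -((height ω y - height ω x : ℤ) : ℂ) * Real.log q * Complex.I
    have h2 : HasDerivAt (fun s : ℝ => wave q x y ω (-s)) (c * wave q x y ω (-s)) s := by
      rw [h1, congrFun h1 s]
      have h3 : HasDerivAt (fun s : ℝ => c * (s : ℂ)) c s := by
        simpa using (Complex.ofRealCLM.hasDerivAt (x := s)).const_mul c
      have h4 := h3.cexp.const_mul ((√(q : ℝ) : ℂ) ^ (height ω y - height ω x))
      rw [mul_left_comm, mul_comm c]
      exact h4
    rw [(h2.const_mul (c ^ k)).deriv, pow_succ]
    ring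

theorem norm_iteratedDeriv_wave_neg_le [G.LocallyFinite] (hG : G.IsTree) (hq : 2 ≤ q) (x y : X)
    (ω : Boundary G o) (k : ℕ) (s : ℝ) :
    ‖iteratedDeriv k (fun s => wave q x y ω (-s)) s‖ ≤
      (Real.log q * (1 + G.dist x y)) ^ k * √(q : ℝ) ^ (height ω y - height ω x) := by
  have hlog : 0 < Real.log q := Real.log_pos (by exact_mod_cast (by omega : 1 < q))
  have := abs_height_sub_le hG ω x y
  have h1 : |((height ω y - height ω x : ℤ) : ℝ)| ≤ 1 + G.dist x y := by
    have : |((height ω y - height ω x : ℤ) : ℝ)| ≤ G.dist x y := by exact_mod_cast this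
    linarith
  rw [iteratedDeriv_wave_neg hq, norm_mul, norm_wave hq, norm_pow, norm_mul, norm_mul, norm_neg,
    Complex.norm_I, mul_one, Complex.norm_intCast, Complex.norm_real, Real.norm_of_nonneg hlog.le,
    mul_comm (Real.log q)]
  gcongr

open Classical in
/-- One step away from `x`, the wave from `x` changes by a multiple of a cylinder function. -/
theorem wave_step (hG : G.IsTree) (hq : 2 ≤ q) {x y' y : X} (hadj : G.Adj y' y)
    (h : G.dist x y = G.dist x y' + 1) (ω : Boundary G o) (s : ℝ) :
    wave q x y ω s = (waveBase q s)⁻¹ * wave q x y' ω s +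
      (cylinder G o x y).indicator
        (fun _ => waveBase q s ^ (G.dist x y : ℤ) - waveBase q s ^ ((G.dist x y : ℤ) - 2)) ω := by
  have hQ := waveBase_ne_zero hq s
  rw [wave_eq_zpow hq, wave_eq_zpow hq, ← zpow_neg_one, ← zpow_add₀ hQ]
  -- Off the cylinder the last step goes down, which is the factor `(waveBase q s)⁻¹`. On it the
  -- step goes up, and the indicator carries the difference of the two powers.
  by_cases hω : ω ∈ cylinder G o x y
  · rw [Set.indicator_of_mem hω]
    have h1 := height_sub_eq_of_mem_cylinder hG (w := y') (by omega) hω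
    rw [mem_cylinder_iff_height hG] at hω
    rw [hω, h1, SimpleGraph.dist_eq_one_iff_adj.2 hadj,
      show -1 + ((G.dist x y : ℤ) - ((1 : ℕ) : ℤ)) = (G.dist x y : ℤ) - 2 by push_cast; ring]
    ring
  · rw [Set.indicator_of_notMem hω, add_zero]
    congr 1
    have := (mem_cylinder_or_height hG ω hadj h).resolve_left hω
    omega

/-- A geodesic from `x` to `y`. -/
theorem exists_geodesic (hG : G.IsTree) (x y : X) : ∃ g : ℕ → X, g 0 = x ∧ g (G.dist x y) = y ∧
    (∀ i ≤ G.dist x y, G.dist x (g i) = i) ∧ ∀ i < G.dist x y, G.Adj (g i) (g (i + 1)) := by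
  obtain ⟨n, hn⟩ : ∃ n, G.dist x y = n := ⟨_, rfl⟩
  induction n generalizing y with
  | zero =>
    obtain rfl := hG.connected.dist_eq_zero_iff.1 hn
    exact ⟨fun _ => x, rfl, rfl, by simp, by simp⟩
  | succ n ih =>
    obtain ⟨v, hv, hvn⟩ := exists_adj_of_dist hG.connected hn
    obtain ⟨g, h0, h1, h2, h3⟩ := ih v hvn
    rw [hvn] at h1 h2 h3
    rw [hn]
    refine ⟨fun i => if i ≤ n then g i else y, by simp [h0], by simp, fun i hi => ?_,
      fun i hi => ?_⟩
    · by_cases hin : i ≤ n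
      · simp [hin, h2 i hin]
      · simp [hin, hn]; omega
    · rcases Nat.lt_or_ge i n with hin | hin
      · simp only [hin.le, if_true, Nat.succ_le_of_lt hin]
        exact h3 i hin
      · obtain rfl : i = n := by omega
        simpa [h1] using hv

/-- The wave as a combination of the cylinders along a geodesic. -/
theorem wave_eq_sum (hG : G.IsTree) (hq : 2 ≤ q) {x : X} {g : ℕ → X} (n : ℕ) (h0 : g 0 = x)
    (h1 : ∀ i ≤ n, G.dist x (g i) = i) (h2 : ∀ i < n, G.Adj (g i) (g (i + 1)))
    (ω : Boundary G o) (s : ℝ) :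
    wave q x (g n) ω s = waveBase q s ^ (-(n : ℤ)) + ∑ i ∈ Finset.range n,
      (cylinder G o x (g (i + 1))).indicator (fun _ => waveBase q s ^ (2 * (i : ℤ) + 2 - n) -
        waveBase q s ^ (2 * (i : ℤ) - n)) ω := by
  have hQ := waveBase_ne_zero hq s
  induction n with
  | zero => simp [h0, wave_self hq]
  | succ n ih =>
    rw [wave_step hG hq (h2 n n.lt_succ_self)
      (by rw [h1 _ le_rfl, h1 n n.le_succ]), ih (fun i hi => h1 i (by omega))
      (fun i hi => h2 i (by omega)), Finset.sum_range_succ, mul_add, Finset.mul_sum, h1 _ le_rfl,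
      ← add_assoc, ← zpow_neg_one, ← zpow_add₀ hQ]
    congr 1
    · congr 1
      · congr 1
        push_cast
        ring
      · refine Finset.sum_congr rfl fun i _ => ?_
        by_cases hω : ω ∈ cylinder G o x (g (i + 1))
        · simp only [Set.indicator_of_mem hω]
          rw [mul_sub, ← zpow_add₀ hQ, ← zpow_add₀ hQ]
          congr 2 <;> (push_cast; ring)
        · simp only [Set.indicator_of_notMem hω, mul_zero]
    · by_cases hω : ω ∈ cylinder G o x (g (n + 1))
      · simp only [Set.indicator_of_mem hω]
        congr 2 <;> (push_cast; ring)
      · simp only [Set.indicator_of_notMem hω]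

/-- With `Q = waveBase q s`, the neighbour towards `ω` contributes the factor `Q` and the others
together `q Q⁻¹`, which is `waveBase q (-s)`; the eigenvalue is the sum of the two. -/
theorem sum_neighborFinset_wave [G.LocallyFinite] (hG : G.IsTree) (hq : 2 ≤ q)
    (hreg : G.IsRegularOfDegree (q + 1)) (x y : X) (ω : Boundary G o) (s : ℝ) :
    ∑ z ∈ G.neighborFinset y, wave q x z ω s =
      2 * √(q : ℝ) * Complex.cos (s * Real.log q) * wave q x y ω s := by
  have hQ := waveBase_ne_zero hq s
  simp_rw [wave_eq_zpow hq]
  rw [sum_neighborFinset_height hG hreg ω y fun m => waveBase q s ^ (m - height ω x)]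
  rw [show height ω y + 1 - height ω x = (height ω y - height ω x) + 1 by ring,
    show height ω y - 1 - height ω x = (height ω y - height ω x) - 1 by ring, zpow_add_one₀ hQ,
    zpow_sub_one₀ hQ]
  generalize waveBase q s ^ (height ω y - height ω x) = W
  have h1 : (q : ℂ) * (W * (waveBase q s)⁻¹) = W * waveBase q (-s) := by
    rw [← waveBase_mul_neg q s]
    field_simp
  have h2 : phase q s + phase q (-s) = 2 * Complex.cos (s * Real.log q) := by
    rw [Complex.two_cos, phase, phase]
    push_cast
    congr 2 <;> ring
  rw [h1, waveBase, waveBase, mul_assoc (2 : ℂ), mul_left_comm (2 : ℂ), ← h2]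
  ring

end Wave

/-! ### The Plancherel density -/

section Density

variable {q : ℕ}

theorem log_pos (hq : 2 ≤ q) : 0 < Real.log q := Real.log_pos (by exact_mod_cast (by omega : 1 < q))

theorem tau_pos (hq : 2 ≤ q) : 0 < tau q := div_pos Real.pi_pos (log_pos hq)

theorem density_denominator_pos (hq : 2 ≤ q) (t : ℝ) :
    0 < (q : ℝ) + (q : ℝ)⁻¹ - 2 * Real.cos t := by
  have h1 : (2 : ℝ) ≤ q := by exact_mod_cast hq
  have h2 : 0 < (q : ℝ)⁻¹ := by positivity
  have := Real.cos_le_one t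
  linarith

/-- The Plancherel density divided by `sin (s log q)`. -/
noncomputable def densityRoot (q : ℕ) (s : ℝ) : ℝ :=
  2 * ((q : ℝ) * Real.log q / (4 * Real.pi * ((q : ℝ) + 1))) *
    ((((q : ℝ) + 1) ^ 2 / q) * (4 * Real.sin (s * Real.log q) /
      ((q : ℝ) + (q : ℝ)⁻¹ - 2 * Real.cos (2 * s * Real.log q))))

theorem plancherelDensity_eq (q : ℕ) (s : ℝ) :
    plancherelDensity q s = densityRoot q s * Real.sin (s * Real.log q) := by
  rw [plancherelDensity, densityRoot]
  ring

theorem contDiff_densityRoot (hq : 2 ≤ q) : ContDiff ℝ (⊤ : ℕ∞) (densityRoot q) := by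
  unfold densityRoot
  refine contDiff_const.mul (contDiff_const.mul (ContDiff.div ?_ ?_ ?_))
  · fun_prop
  · fun_prop
  · exact fun s => (density_denominator_pos hq _).ne'

theorem contDiff_plancherelDensity (hq : 2 ≤ q) : ContDiff ℝ (⊤ : ℕ∞) (plancherelDensity q) := by
  rw [funext (plancherelDensity_eq q)]
  have := contDiff_densityRoot hq
  fun_prop

theorem contDiff_plancherelDensity_complex (hq : 2 ≤ q) :
    ContDiff ℝ (⊤ : ℕ∞) fun s => (plancherelDensity q s : ℂ) :=
  Complex.ofRealCLM.contDiff.comp (contDiff_plancherelDensity hq)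

theorem sin_mul_log_pos (hq : 2 ≤ q) {s : ℝ} (hs : s ∈ Set.Ioo 0 (tau q)) :
    0 < Real.sin (s * Real.log q) := by
  have := log_pos hq
  exact Real.sin_pos_of_pos_of_lt_pi (mul_pos hs.1 this) ((lt_div_iff₀ this).1 hs.2)

theorem plancherelDensity_pos (hq : 2 ≤ q) {s : ℝ} (hs : s ∈ Set.Ioo 0 (tau q)) :
    0 < plancherelDensity q s := by
  have := density_denominator_pos hq (2 * s * Real.log q)
  have := log_pos hq
  have := Real.pi_pos
  have := sin_mul_log_pos hq hs
  unfold plancherelDensity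
  positivity

/-- The weight which replaces the Plancherel density after summing waves along a geodesic. -/
noncomputable def telescopeWeight (q : ℕ) (s : ℝ) : ℂ :=
  densityRoot q s * (1 - (q : ℂ)⁻¹ * phase q s ^ (-2 : ℤ)) / (2 * Complex.I)

theorem contDiff_telescopeWeight (hq : 2 ≤ q) : ContDiff ℝ (⊤ : ℕ∞) (telescopeWeight q) := by
  unfold telescopeWeight
  have h1 : ContDiff ℝ (⊤ : ℕ∞) fun s => (densityRoot q s : ℂ) :=
    Complex.ofRealCLM.contDiff.comp (contDiff_densityRoot hq)
  exact (h1.mul (contDiff_const.sub (contDiff_const.mul (contDiff_phase_zpow q _)))).div_const _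

theorem phase_sub_phase_inv (q : ℕ) (s : ℝ) :
    phase q s - (phase q s)⁻¹ = 2 * Complex.I * Real.sin (s * Real.log q) := by
  rw [← phase_neg, phase, phase, Complex.ofReal_sin, Complex.sin, Complex.ofReal_neg,
    Complex.ofReal_mul]
  rw [show -((s : ℂ) * Real.log q) * Complex.I = Real.log q * Complex.I * -s by ring,
    show (s : ℂ) * Real.log q * Complex.I = Real.log q * Complex.I * s by ring]
  linear_combination (-(Complex.exp (Real.log q * Complex.I * -s) -
    Complex.exp (Real.log q * Complex.I * s))) * Complex.I_mul_I

/-- The density contains `sin² (s log q)`. One sine, written as a multiple of `u - u⁻¹` with `u =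
phase q s`, turns the jump of the wave into a difference of two powers whose exponents differ by
`2`, the spacing between consecutive cylinders. The other sine stays in the smooth
`telescopeWeight`. -/
theorem phase_telescope (q : ℕ) (m : ℤ) (s : ℝ) :
    (phase q s ^ (m + 2) - (q : ℂ)⁻¹ * phase q s ^ m) * plancherelDensity q s =
      (phase q s ^ (m + 3) - phase q s ^ (m + 1)) * telescopeWeight q s := by
  have hu := phase_ne_zero q s
  have h := phase_sub_phase_inv q s
  have h1 : phase q s ^ (m + 2) - (q : ℂ)⁻¹ * phase q s ^ m =
      phase q s ^ (m + 2) * (1 - (q : ℂ)⁻¹ * phase q s ^ (-2 : ℤ)) := by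
    rw [mul_sub, mul_one, mul_left_comm, ← zpow_add₀ hu]
    congr 3
    ring
  have h2 : phase q s ^ (m + 3) - phase q s ^ (m + 1) =
      phase q s ^ (m + 2) * (phase q s - (phase q s)⁻¹) := by
    rw [mul_sub, ← zpow_add_one₀ hu, ← zpow_sub_one₀ hu]
    congr 2 <;> ring
  rw [h1, h2, h, plancherelDensity_eq, telescopeWeight]
  push_cast
  field_simp [Complex.I_ne_zero]

theorem exists_bound_iteratedDeriv {f : ℝ → ℂ} (hf : ContDiff ℝ (⊤ : ℕ∞) f) (N : ℕ) (T : ℝ) :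
    ∃ W, 0 ≤ W ∧ ∀ k ≤ N, ∀ s ∈ Set.Icc 0 T, ‖iteratedDeriv k f s‖ ≤ W := by
  have h : ∀ k, ∃ W, ∀ s ∈ Set.Icc 0 T, ‖iteratedDeriv k f s‖ ≤ W := fun k =>
    isCompact_Icc.exists_bound_of_continuousOn
      (hf.continuous_iteratedDeriv k (by exact_mod_cast le_top)).continuousOn
  choose W hW using h
  refine ⟨∑ k ∈ Finset.range (N + 1), |W k|, by positivity, fun k hk s hs => ?_⟩
  refine ((hW k s hs).trans (le_abs_self _)).trans ?_
  exact Finset.single_le_sum (f := fun k => |W k|) (fun _ _ => abs_nonneg _)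
    (Finset.mem_range_succ_iff.2 hk)

/-- Rapid decay of the Fourier coefficients of flat functions, with a smooth weight. -/
theorem exists_fourier_decay (hq : 2 ≤ q) {w : ℝ → ℂ} (hw : ContDiff ℝ (⊤ : ℕ∞) w) (N : ℕ) :
    ∃ C, 0 ≤ C ∧ ∀ f : ℝ → ℂ, ContDiffOn ℝ (⊤ : ℕ∞) f (Set.Icc 0 (tau q)) →
      (∀ k, iteratedDerivWithin k f (Set.Icc 0 (tau q)) 0 = 0) →
      (∀ k, iteratedDerivWithin k f (Set.Icc 0 (tau q)) (tau q) = 0) → ∀ M,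
      (∀ k ≤ N, ∀ s ∈ Set.Icc 0 (tau q), ‖iteratedDerivWithin k f (Set.Icc 0 (tau q)) s‖ ≤ M) →
      ∀ m : ℤ, ‖∫ s in (0 : ℝ)..tau q, phase q s ^ m * (f s * w s)‖ ≤
        C * M / (1 + |(m : ℝ)|) ^ N := by
  obtain ⟨W, hW0, hW⟩ := exists_bound_iteratedDeriv hw N (tau q)
  have hT := tau_pos hq
  have hL := log_pos hq
  refine ⟨(1 + (Real.log q)⁻¹) ^ N * (2 ^ N * (2 ^ N * W * tau q)), by positivity, ?_⟩
  intro f hf h0 hT0 M hM m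
  -- The extension by zero is smooth on the line, so the product with `w` can be differentiated
  -- there; it is flat at both ends because it vanishes outside the interval.
  set g := (Set.Icc 0 (tau q)).indicator f with hg
  have hgd : ContDiff ℝ (⊤ : ℕ∞) g := contDiff_indicator_Icc hT hf h0 hT0
  have hprod : ContDiff ℝ (⊤ : ℕ∞) fun s => g s * w s := hgd.mul hw
  have hgM : ∀ k ≤ N, ∀ s ∈ Set.Icc 0 (tau q), ‖iteratedDeriv k g s‖ ≤ M := by
    intro k hk s hs
    rw [hg, (iteratedDeriv_indicator_Icc hT hf h0 hT0 k).1, Set.indicator_of_mem hs]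
    exact hM k hk s hs
  have hclos0 : (0 : ℝ) ∈ closure (Set.Iio 0) := by simp
  have hclosT : tau q ∈ closure (Set.Ioi (tau q)) := by simp
  have h1 := one_add_pow_mul_norm_integral_exp_le hT.le hprod
    (fun k => iteratedDeriv_eq_zero_of_eqOn hprod isOpen_Iio (fun s (hs : s < 0) => by
      simp only [hg]
      rw [Set.indicator_of_notMem fun h => absurd h.1 (not_le.2 hs), zero_mul]) hclos0 k)
    (fun k => iteratedDeriv_eq_zero_of_eqOn hprod isOpen_Ioi (fun s (hs : tau q < s) => by
      simp only [hg]
      rw [Set.indicator_of_notMem fun h => absurd h.2 (not_le.2 hs), zero_mul]) hclosT k)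
    hL m N (M := 2 ^ N * (M * W)) (fun k hk s hs => by
      have hMW : 0 ≤ M * W := mul_nonneg ((norm_nonneg _).trans (hgM 0 (Nat.zero_le _) s hs)) hW0
      refine (norm_iteratedDeriv_mul_le hgd hw k s (A := M) (B := W)
        (fun j hj => hgM j (hj.trans hk) s hs) (fun j hj => hW j (hj.trans hk) s hs)).trans ?_
      gcongr
      norm_num)
  have h2 : ∫ s in (0 : ℝ)..tau q, phase q s ^ m * (f s * w s) =
      ∫ s in (0 : ℝ)..tau q, Complex.exp (m * Real.log q * Complex.I * s) * (g s * w s) := by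
    refine intervalIntegral.integral_congr fun s hs => ?_
    rw [Set.uIcc_of_le hT.le] at hs
    simp only [hg]
    rw [Set.indicator_of_mem hs, phase_zpow]
  rw [h2, le_div_iff₀ (by positivity), mul_comm]
  refine h1.trans (le_of_eq ?_)
  ring

end Density

/-! ### Rapid decay of the kernel of a symbol -/

section Decay

variable {X : Type*} {G : SimpleGraph X} {o : X} {q : ℕ}

/-- The seminorms of order at most `N` of the symbol `a` are bounded by `M`. -/
structure SymbolBound (q N : ℕ) (M : ℝ) (a : SymbolFun G o) : Prop where
  deriv_le : ∀ k ≤ N, ∀ x ω, ∀ s ∈ Set.Icc 0 (tau q), ‖dS q k a x ω s‖ ≤ M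
  defect_le : ∀ (n : ℕ) x ω, ∀ s ∈ Set.Icc 0 (tau q),
    ‖cylDefect q x n a x ω s‖ ≤ M / (1 + (n : ℝ)) ^ N

theorem dS_zero (a : SymbolFun G o) : dS q 0 a = a := by
  funext x ω s
  simp [dS]

theorem IsSymbol.continuousOn_zero {a : SymbolFun G o} (ha : IsSymbol q a) (x : X) :
    ContinuousOn (fun p : Boundary G o × ℝ => a x p.1 p.2) (Set.univ ×ˢ Set.Icc 0 (tau q)) := by
  have := ha.continuousOn 0 x
  rwa [dS_zero] at this

theorem IsSymbol.exists_symbolBound {a : SymbolFun G o} (ha : IsSymbol q a) (N : ℕ) :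
    ∃ M, 0 ≤ M ∧ SymbolBound q N M a := by
  choose C hC using ha.bounded
  obtain ⟨D, hD⟩ := ha.regular N
  refine ⟨∑ k ∈ Finset.range (N + 1), |C k| + |D|, by positivity, fun k hk x ω s hs => ?_,
    fun n x ω s hs => ?_⟩
  · have := Finset.single_le_sum (f := fun k => |C k|) (fun _ _ => abs_nonneg _)
      (Finset.mem_range_succ_iff.2 hk)
    have h1 := hC k x ω s hs
    have h2 := le_abs_self (C k)
    have h3 := abs_nonneg D
    linarith
  · refine (hD n x ω s hs).trans ?_
    have h2 := le_abs_self D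
    have h3 : 0 ≤ ∑ k ∈ Finset.range (N + 1), |C k| := by positivity
    gcongr
    linarith

theorem SymbolBound.norm_le {N : ℕ} {M : ℝ} {a : SymbolFun G o} (h : SymbolBound q N M a) (x : X)
    (ω : Boundary G o) {s : ℝ} (hs : s ∈ Set.Icc 0 (tau q)) : ‖a x ω s‖ ≤ M := by
  have := h.deriv_le 0 (Nat.zero_le _) x ω s hs
  rwa [dS_zero] at this

/-- A regular symbol varies little on small cylinders. -/
theorem SymbolBound.norm_sub_le {N : ℕ} {M : ℝ} {a : SymbolFun G o} (h : SymbolBound q N M a)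
    (hG : G.IsTree) {x z : X} {ω ω' : Boundary G o} (hω : ω ∈ cylinder G o x z)
    (hω' : ω' ∈ cylinder G o x z) {s : ℝ} (hs : s ∈ Set.Icc 0 (tau q)) :
    ‖a x ω s - a x ω' s‖ ≤ 2 * (M / (1 + (G.dist x z : ℝ)) ^ N) := by
  have h1 := h.defect_le (G.dist x z) x ω s hs
  have h2 := h.defect_le (G.dist x z) x ω' s hs
  rw [cylDefect, cylAverage, cylinderAround_eq hG hω] at h1
  rw [cylDefect, cylAverage, cylinderAround_eq hG hω'] at h2
  -- Both points have the same cylinder average, through which they are compared.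
  calc _ ≤ _ := norm_le_norm_sub_add (a x ω s - a x ω' s)
        (a x ω s - ⨍ ω' in cylinder G o x z, a x ω' s ∂(boundaryMeasure G q o x))
    _ ≤ _ := by
      rw [two_mul, add_comm]
      refine add_le_add h1 ?_
      rw [sub_sub_sub_cancel_left, norm_sub_rev]
      exact h2

theorem continuous_integral_of_bounded [G.LocallyFinite] (hG : G.IsTree)
    {T : ℝ} (hT : 0 ≤ T) {F : Boundary G o → ℝ → ℂ}
    (hF : ContinuousOn (fun p : Boundary G o × ℝ => F p.1 p.2) (Set.univ ×ˢ Set.Icc 0 T)) {C : ℝ}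
    (hC : ∀ ω, ∀ s ∈ Set.Icc 0 T, ‖F ω s‖ ≤ C) :
    Continuous fun ω => ∫ s in (0 : ℝ)..T, F ω s := by
  have := secondCountable_boundary (o := o) hG
  have hsec : ∀ ω, ContinuousOn (F ω) (Set.Icc 0 T) := fun ω =>
    hF.comp (f := fun s : ℝ => (ω, s)) (by fun_prop) fun s hs => ⟨trivial, hs⟩
  refine intervalIntegral.continuous_of_dominated_interval (bound := fun _ => C) (fun ω => ?_)
    (fun ω => ae_of_all _ fun s hs => ?_) (by simp) (ae_of_all _ fun s hs => ?_)
  · rw [Set.uIoc_of_le hT]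
    exact ((hsec ω).mono Set.Ioc_subset_Icc_self).aestronglyMeasurable measurableSet_Ioc
  · rw [Set.uIoc_of_le hT] at hs
    exact hC ω s (Set.Ioc_subset_Icc_self hs)
  · rw [Set.uIoc_of_le hT] at hs
    rw [← continuousOn_univ]
    exact hF.comp (f := fun ω => (ω, s)) (by fun_prop)
      fun ω _ => ⟨trivial, Set.Ioc_subset_Icc_self hs⟩

theorem integrable_of_continuous_of_bounded [G.LocallyFinite] (hG : G.IsTree) (hq : 2 ≤ q)
    (hreg : G.IsRegularOfDegree (q + 1)) (x : X) {f : Boundary G o → ℂ} (hf : Continuous f) {C : ℝ}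
    (hC : ∀ ω, ‖f ω‖ ≤ C) : Integrable f (boundaryMeasure G q o x) := by
  have := isProbabilityMeasure_boundaryMeasure hG hq hreg o x
  have := secondCountable_boundary (o := o) hG
  exact Integrable.of_bound hf.aestronglyMeasurable C (ae_of_all _ hC)

/-- The Fourier coefficients of a symbol, with a weight. -/
noncomputable def fourierSymbol (q : ℕ) (w : ℝ → ℂ) (a : SymbolFun G o) (x : X) (m : ℤ)
    (ω : Boundary G o) : ℂ :=
  ∫ s in (0 : ℝ)..tau q, phase q s ^ m * (a x ω s * w s)

theorem IsSymbol.continuousOn_snd {a : SymbolFun G o} (ha : IsSymbol q a) (x : X)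
    (ω : Boundary G o) : ContinuousOn (a x ω) (Set.Icc 0 (tau q)) :=
  (ha.smooth x ω).continuousOn

theorem continuous_phase_zpow (q : ℕ) (m : ℤ) : Continuous fun s => phase q s ^ m :=
  (contDiff_phase_zpow q m).continuous

theorem IsSymbol.intervalIntegrable {a : SymbolFun G o} (ha : IsSymbol q a) (hq : 2 ≤ q) (x : X)
    (ω : Boundary G o) {w : ℝ → ℂ} (hw : Continuous w) (m : ℤ) :
    IntervalIntegrable (fun s => phase q s ^ m * (a x ω s * w s)) volume 0 (tau q) := by
  refine ContinuousOn.intervalIntegrable ?_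
  rw [Set.uIcc_of_le (tau_pos hq).le]
  exact (continuous_phase_zpow q m).continuousOn.mul
    ((ha.continuousOn_snd x ω).mul hw.continuousOn)

theorem continuous_fourierSymbol [G.LocallyFinite] (hG : G.IsTree) (hq : 2 ≤ q)
    {a : SymbolFun G o} (ha : IsSymbol q a) {w : ℝ → ℂ} (hw : Continuous w) (x : X) (m : ℤ) :
    Continuous (fourierSymbol q w a x m) := by
  obtain ⟨C, hC⟩ := ha.bounded 0
  obtain ⟨W, hW⟩ := isCompact_Icc.exists_bound_of_continuousOn (s := Set.Icc 0 (tau q))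
    hw.continuousOn
  rw [dS_zero] at hC
  refine continuous_integral_of_bounded hG (tau_pos hq).le (C := C * W) ?_ fun ω s hs => ?_
  · exact ((continuous_phase_zpow q m).comp continuous_snd).continuousOn.mul
      ((ha.continuousOn_zero x).mul (hw.comp continuous_snd).continuousOn)
  · rw [norm_mul, norm_mul, norm_zpow, norm_phase, one_zpow, one_mul]
    exact mul_le_mul (hC x ω s hs) (hW s hs) (norm_nonneg _)
      ((norm_nonneg _).trans (hC x ω s hs))

/-- Fourier coefficients of symbols decay rapidly, uniformly in the symbol. -/
theorem exists_fourierSymbol_decay (G : SimpleGraph X) (o : X) (hq : 2 ≤ q) {w : ℝ → ℂ}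
    (hw : ContDiff ℝ (⊤ : ℕ∞) w) (N : ℕ) :
    ∃ C, 0 ≤ C ∧ ∀ (a : SymbolFun G o), IsSymbol q a → ∀ M, SymbolBound q N M a →
      ∀ x (m : ℤ) ω, ‖fourierSymbol q w a x m ω‖ ≤ C * M / (1 + |(m : ℝ)|) ^ N := by
  obtain ⟨C, hC0, hC⟩ := exists_fourier_decay hq hw N
  exact ⟨C, hC0, fun a ha M hM x m ω => hC (a x ω) (ha.smooth x ω)
    (fun k => (ha.boundary k x ω).1) (fun k => (ha.boundary k x ω).2) M
    (fun k hk s hs => hM.deriv_le k hk x ω s hs) m⟩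

theorem norm_fourierSymbol_sub_le (hG : G.IsTree) (hq : 2 ≤ q) {a : SymbolFun G o}
    (ha : IsSymbol q a) {N : ℕ} {M : ℝ} (hM : SymbolBound q N M a) {w : ℝ → ℂ} (hw : Continuous w)
    {W : ℝ} (hW : ∀ s ∈ Set.Icc 0 (tau q), ‖w s‖ ≤ W) {x z : X} (m : ℤ) {ω ω' : Boundary G o}
    (hω : ω ∈ cylinder G o x z) (hω' : ω' ∈ cylinder G o x z) :
    ‖fourierSymbol q w a x m ω - fourierSymbol q w a x m ω'‖ ≤
      2 * W * tau q * M / (1 + (G.dist x z : ℝ)) ^ N := by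
  rw [fourierSymbol, fourierSymbol, ← intervalIntegral.integral_sub
    (ha.intervalIntegrable hq x ω hw m) (ha.intervalIntegrable hq x ω' hw m)]
  refine (intervalIntegral.norm_integral_le_of_norm_le_const
    (C := 2 * (M / (1 + (G.dist x z : ℝ)) ^ N) * W) fun s hs => ?_).trans (le_of_eq ?_)
  · rw [Set.uIoc_of_le (tau_pos hq).le] at hs
    have hs' := Set.Ioc_subset_Icc_self hs
    rw [← mul_sub, ← sub_mul, norm_mul, norm_mul, norm_zpow, norm_phase, one_zpow, one_mul]
    have := hM.norm_sub_le hG hω hω' hs'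
    exact mul_le_mul this (hW s hs') (norm_nonneg _) ((norm_nonneg _).trans this)
  · rw [sub_zero, abs_of_pos (tau_pos hq)]
    ring

/-- The growth of the wave and the mass of the cylinder balance, so the product does not depend on
`i`. All cylinders along the geodesic count equally, at the scale `q ^ (-d / 2)`; further decay must
come from cancellation. -/
theorem sqrt_pow_mul_cylMass (hq : 2 ≤ q) (i : ℕ) (d : ℕ) :
    √(q : ℝ) ^ (2 * (i : ℤ) + 2 - d) * cylMass q (i + 1) =
      (q : ℝ) / (q + 1) * (√(q : ℝ) ^ d)⁻¹ := by
  have hR := (sqrt_pos hq).ne'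
  have hq0 : (0 : ℝ) < q := by positivity
  rw [zpow_sub₀ hR, zpow_natCast, show 2 * (i : ℤ) + 2 = ((2 * (i + 1) : ℕ) : ℤ) by push_cast; ring,
    zpow_natCast, pow_mul, Real.sq_sqrt (by positivity), cylMass, pow_succ]
  field_simp

/-- The contribution of a cylinder on the geodesic from `x` to `y` to the kernel. -/
noncomputable def kernelPiece (q : ℕ) (a : SymbolFun G o) (x : X) (d i : ℕ)
    (ω : Boundary G o) : ℂ :=
  (√(q : ℝ) : ℂ) ^ (2 * (i : ℤ) + 2 - d) *
    (fourierSymbol q (fun s => (plancherelDensity q s : ℂ)) a x (2 * i - d + 2) ω -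
      (q : ℂ)⁻¹ * fourierSymbol q (fun s => (plancherelDensity q s : ℂ)) a x (2 * i - d) ω)

theorem continuous_density (hq : 2 ≤ q) : Continuous fun s => (plancherelDensity q s : ℂ) :=
  (contDiff_plancherelDensity_complex hq).continuous

theorem integral_wave_eq (hG : G.IsTree) (hq : 2 ≤ q) {a : SymbolFun G o} (ha : IsSymbol q a)
    {x : X} {g : ℕ → X} (d : ℕ) (h0 : g 0 = x) (h1 : ∀ i ≤ d, G.dist x (g i) = i)
    (h2 : ∀ i < d, G.Adj (g i) (g (i + 1))) (ω : Boundary G o) :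
    ∫ s in (0 : ℝ)..tau q, wave q x (g d) ω s * a x ω s * (plancherelDensity q s : ℂ) =
      (√(q : ℝ) : ℂ) ^ (-(d : ℤ)) *
        fourierSymbol q (fun s => (plancherelDensity q s : ℂ)) a x (-d) ω +
      ∑ i ∈ Finset.range d,
        (cylinder G o x (g (i + 1))).indicator (kernelPiece q a x d i) ω := by
  have hR := sqrt_ne_zero hq
  have hint := ha.intervalIntegrable hq x ω (continuous_density hq)
  have hpiece : ∀ i, kernelPiece q a x d i ω = ∫ s in (0 : ℝ)..tau q,
      (waveBase q s ^ (2 * (i : ℤ) + 2 - d) - waveBase q s ^ (2 * (i : ℤ) - d)) *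
        (a x ω s * (plancherelDensity q s : ℂ)) := by
    intro i
    rw [kernelPiece, fourierSymbol, fourierSymbol, ← intervalIntegral.integral_const_mul,
      ← intervalIntegral.integral_sub (hint _) ((hint _).const_mul _),
      ← intervalIntegral.integral_const_mul]
    congr 1
    funext s
    have h3 : (√(q : ℝ) : ℂ) ^ (2 * (i : ℤ) + 2 - d) =
        q * (√(q : ℝ) : ℂ) ^ (2 * (i : ℤ) - d) := by
      rw [show 2 * (i : ℤ) + 2 - d = (2 * (i : ℤ) - d) + 1 + 1 by ring, zpow_add_one₀ hR,
        zpow_add_one₀ hR, mul_assoc, sqrt_mul_self, mul_comm]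
    have hq0 : (q : ℂ) ≠ 0 := by simp; omega
    rw [waveBase, mul_zpow, mul_zpow, show 2 * (i : ℤ) - d + 2 = 2 * (i : ℤ) + 2 - d by ring, h3]
    field_simp
  have hind : ∀ i, IntervalIntegrable (fun s => (cylinder G o x (g (i + 1))).indicator
      (fun _ => waveBase q s ^ (2 * (i : ℤ) + 2 - d) - waveBase q s ^ (2 * (i : ℤ) - d)) ω *
        (a x ω s * (plancherelDensity q s : ℂ))) volume 0 (tau q) := by
    intro i
    by_cases hω : ω ∈ cylinder G o x (g (i + 1))
    · simp only [Set.indicator_of_mem hω, waveBase, mul_zpow]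
      convert ((hint (2 * (i : ℤ) + 2 - d)).const_mul
        ((√(q : ℝ) : ℂ) ^ (2 * (i : ℤ) + 2 - d))).sub
        ((hint (2 * (i : ℤ) - d)).const_mul ((√(q : ℝ) : ℂ) ^ (2 * (i : ℤ) - d))) using 2
      ring
    · simp [Set.indicator_of_notMem hω]
  have hfirst : IntervalIntegrable (fun s => waveBase q s ^ (-(d : ℤ)) *
      (a x ω s * (plancherelDensity q s : ℂ))) volume 0 (tau q) := by
    simp only [waveBase, mul_zpow, mul_assoc]
    exact (hint _).const_mul _
  calc _ = ∫ s in (0 : ℝ)..tau q, (waveBase q s ^ (-(d : ℤ)) *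
        (a x ω s * (plancherelDensity q s : ℂ)) + ∑ i ∈ Finset.range d,
          (cylinder G o x (g (i + 1))).indicator (fun _ => waveBase q s ^ (2 * (i : ℤ) + 2 - d) -
            waveBase q s ^ (2 * (i : ℤ) - d)) ω * (a x ω s * (plancherelDensity q s : ℂ))) := by
        congr 1
        funext s
        rw [wave_eq_sum hG hq d h0 h1 h2, mul_assoc, add_mul, Finset.sum_mul]
    _ = _ := by
        have hsum := IntervalIntegrable.sum (Finset.range d) fun i _ => hind i
        rw [Finset.sum_fn] at hsum
        rw [intervalIntegral.integral_add hfirst hsum,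
          intervalIntegral.integral_finsetSum fun i _ => hind i]
        congr 1
        · rw [fourierSymbol, ← intervalIntegral.integral_const_mul]
          congr 1
          funext s
          rw [waveBase, mul_zpow, mul_assoc]
        · refine Finset.sum_congr rfl fun i _ => ?_
          by_cases hω : ω ∈ cylinder G o x (g (i + 1))
          · simp only [Set.indicator_of_mem hω]
            exact (hpiece i).symm
          · simp [Set.indicator_of_notMem hω]

/-- Summing the kernel pieces telescopes. -/
theorem sum_kernelPiece (hq : 2 ≤ q) {a : SymbolFun G o} (ha : IsSymbol q a) (x : X) {n d : ℕ}
    (hnd : n ≤ d) (ω : Boundary G o) :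
    ∑ i ∈ Finset.Ico n d, (cylMass q (i + 1) : ℂ) * kernelPiece q a x d i ω =
      (q : ℂ) / (q + 1) * ((√(q : ℝ) : ℂ) ^ d)⁻¹ *
        (fourierSymbol q (telescopeWeight q) a x (d + 1) ω -
          fourierSymbol q (telescopeWeight q) a x (2 * n - d + 1) ω) := by
  have hw := (contDiff_telescopeWeight hq).continuous
  have hd := continuous_density hq
  -- The amplitude is independent of `i` by `sqrt_pow_mul_cylMass`, and `phase_telescope` under the
  -- integral turns each term into a consecutive difference.
  have key : ∀ i : ℕ, (cylMass q (i + 1) : ℂ) * kernelPiece q a x d i ω =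
      (q : ℂ) / (q + 1) * ((√(q : ℝ) : ℂ) ^ d)⁻¹ *
        (fourierSymbol q (telescopeWeight q) a x (2 * ((i + 1 : ℕ) : ℤ) - d + 1) ω -
          fourierSymbol q (telescopeWeight q) a x (2 * (i : ℤ) - d + 1) ω) := by
    intro i
    have h1 : (√(q : ℝ) : ℂ) ^ (2 * (i : ℤ) + 2 - d) * (cylMass q (i + 1) : ℂ) =
        (q : ℂ) / (q + 1) * ((√(q : ℝ) : ℂ) ^ d)⁻¹ := by
      rw [← Complex.ofReal_zpow, ← Complex.ofReal_mul, sqrt_pow_mul_cylMass hq i d]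
      push_cast
      rfl
    rw [kernelPiece, ← mul_assoc, mul_comm (cylMass q (i + 1) : ℂ), h1]
    congr 1
    simp only [fourierSymbol]
    rw [← intervalIntegral.integral_const_mul,
      ← intervalIntegral.integral_sub (ha.intervalIntegrable hq x ω hd _)
        ((ha.intervalIntegrable hq x ω hd _).const_mul _),
      ← intervalIntegral.integral_sub (ha.intervalIntegrable hq x ω hw _)
        (ha.intervalIntegrable hq x ω hw _)]
    congr 1
    funext s
    have := phase_telescope q (2 * (i : ℤ) - d) s
    rw [show 2 * ((i + 1 : ℕ) : ℤ) - d + 1 = 2 * (i : ℤ) - d + 3 by push_cast; ring]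
    linear_combination (a x ω s) * this
  rw [Finset.sum_congr rfl fun i _ => key i, ← Finset.mul_sum,
    Finset.sum_Ico_eq_sum_range]
  congr 1
  have h2 := Finset.sum_range_sub
    (fun j : ℕ => fourierSymbol q (telescopeWeight q) a x (2 * ((n + j : ℕ) : ℤ) - d + 1) ω) (d - n)
  simp only [add_zero, ← add_assoc] at h2
  rw [h2, show n + (d - n) = d by omega]
  congr 2
  ring

end Decay

/-! ### Decay of the kernel after integration over the boundary -/

section Decay

variable {X : Type*} {G : SimpleGraph X} {o : X} {q : ℕ}

theorem IsSymbol.norm_fourierSymbol_le (hq : 2 ≤ q) {a : SymbolFun G o} {N : ℕ} {M : ℝ}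
    (hM : SymbolBound q N M a) {w : ℝ → ℂ} {W : ℝ} (hW : ∀ s ∈ Set.Icc 0 (tau q), ‖w s‖ ≤ W)
    (x : X) (m : ℤ) (ω : Boundary G o) : ‖fourierSymbol q w a x m ω‖ ≤ M * W * tau q := by
  refine (intervalIntegral.norm_integral_le_of_norm_le_const (C := M * W) fun s hs => ?_).trans
    (le_of_eq ?_)
  · rw [Set.uIoc_of_le (tau_pos hq).le] at hs
    have hs' := Set.Ioc_subset_Icc_self hs
    rw [norm_mul, norm_mul, norm_zpow, norm_phase, one_zpow, one_mul]
    exact mul_le_mul (hM.norm_le x ω hs') (hW s hs') (norm_nonneg _)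
      ((norm_nonneg _).trans (hM.norm_le x ω hs'))
  · rw [sub_zero, abs_of_pos (tau_pos hq)]

theorem integrable_fourierSymbol [G.LocallyFinite] (hG : G.IsTree) (hq : 2 ≤ q)
    (hreg : G.IsRegularOfDegree (q + 1)) {a : SymbolFun G o} (ha : IsSymbol q a) {w : ℝ → ℂ}
    (hw : Continuous w) (x y : X) (m : ℤ) :
    Integrable (fourierSymbol q w a x m) (boundaryMeasure G q o y) := by
  obtain ⟨M, -, hM⟩ := ha.exists_symbolBound 0
  obtain ⟨W, hW⟩ := isCompact_Icc.exists_bound_of_continuousOn (s := Set.Icc 0 (tau q))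
    hw.continuousOn
  exact integrable_of_continuous_of_bounded hG hq hreg y (continuous_fourierSymbol hG hq ha hw x m)
    fun ω => IsSymbol.norm_fourierSymbol_le hq hM hW x m ω

theorem integrable_kernelPiece [G.LocallyFinite] (hG : G.IsTree) (hq : 2 ≤ q)
    (hreg : G.IsRegularOfDegree (q + 1)) {a : SymbolFun G o} (ha : IsSymbol q a) (x y : X)
    (d i : ℕ) : Integrable (kernelPiece q a x d i) (boundaryMeasure G q o y) := by
  have h := fun m => integrable_fourierSymbol hG hq hreg ha (continuous_density hq) x y m
  unfold kernelPiece
  exact ((h _).sub ((h _).const_mul _)).const_mul _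

theorem kernel_eq_sum [G.LocallyFinite] (hG : G.IsTree) (hq : 2 ≤ q)
    (hreg : G.IsRegularOfDegree (q + 1)) {a : SymbolFun G o} (ha : IsSymbol q a)
    {x : X} {g : ℕ → X} (d : ℕ) (h0 : g 0 = x) (h1 : ∀ i ≤ d, G.dist x (g i) = i)
    (h2 : ∀ i < d, G.Adj (g i) (g (i + 1))) :
    kernel q a x (g d) = (∫ ω, (√(q : ℝ) : ℂ) ^ (-(d : ℤ)) *
        fourierSymbol q (fun s => (plancherelDensity q s : ℂ)) a x (-d) ω
          ∂(boundaryMeasure G q o x)) +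
      ∑ i ∈ Finset.range d, ∫ ω in cylinder G o x (g (i + 1)), kernelPiece q a x d i ω
        ∂(boundaryMeasure G q o x) := by
  have h := integrable_fourierSymbol hG hq hreg ha (continuous_density hq) x x (-(d : ℤ))
  have hi := fun i => (integrable_kernelPiece hG hq hreg ha x x d i).indicator
    (measurableSet_cylinder x (g (i + 1)))
  rw [kernel, integral_congr_ae (ae_of_all _ fun ω => integral_wave_eq hG hq ha d h0 h1 h2 ω),
    integral_add (h.const_mul _) (integrable_finsetSum _ fun i _ => hi i),
    integral_finsetSum _ fun i _ => hi i]
  congr 1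
  exact Finset.sum_congr rfl fun i _ => integral_indicator (measurableSet_cylinder _ _)

theorem dist_le_of_adj (hG : G.IsTree) {g : ℕ → X} {d : ℕ} (h : ∀ i < d, G.Adj (g i) (g (i + 1)))
    {i j : ℕ} (hij : i ≤ j) (hj : j ≤ d) : G.dist (g i) (g j) ≤ j - i := by
  induction j, hij using Nat.le_induction with
  | base => simp
  | succ j hij ih =>
    have h1 := hG.connected.dist_triangle (u := g i) (v := g j) (w := g (j + 1))
    rw [SimpleGraph.dist_eq_one_iff_adj.2 (h j (by omega))] at h1
    have := ih (by omega)
    omega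

/-- The kernel of a symbol decays rapidly, uniformly in the symbol. -/
theorem exists_kernel_decay_aux [G.LocallyFinite] (hG : G.IsTree) (hq : 2 ≤ q)
    (hreg : G.IsRegularOfDegree (q + 1)) (o : X) (N : ℕ) :
    ∃ C, 0 ≤ C ∧ ∀ (a : SymbolFun G o), IsSymbol q a → ∀ M, SymbolBound q N M a →
      ∀ x y, ‖kernel q a x y‖ ≤
        C * M * (√(q : ℝ) ^ G.dist x y)⁻¹ * (1 + G.dist x y) / (1 + (G.dist x y : ℝ)) ^ N := by
  obtain ⟨C₁, hC₁0, hC₁⟩ := exists_fourierSymbol_decay G o hq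
    (contDiff_plancherelDensity_complex hq) N
  obtain ⟨C₂, hC₂0, hC₂⟩ := exists_fourierSymbol_decay G o hq (contDiff_telescopeWeight hq) N
  obtain ⟨W, hW⟩ := isCompact_Icc.exists_bound_of_continuousOn (s := Set.Icc 0 (tau q))
    (continuous_density hq).continuousOn
  have hτ := tau_pos hq
  have hW0 : 0 ≤ W := (norm_nonneg _).trans (hW 0 ⟨le_rfl, hτ.le⟩)
  -- `3 * C₁` collects the constant term and the cylinders near `x`, `4 * W * tau q` the error of
  -- freezing `ω` near `y`, and `2 * C₂` the two ends of the telescoped sum. The factor `4 ^ N` is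
  -- the price of cutting the geodesic at a quarter of its length.
  refine ⟨4 ^ N * (3 * C₁ + 4 * W * tau q + 2 * C₂), by positivity, fun a ha M hM x y => ?_⟩
  obtain ⟨g, h0, hd, h1, h2⟩ := exists_geodesic hG x y
  set d := G.dist x y with hddef
  have := isProbabilityMeasure_boundaryMeasure hG hq hreg o x
  set ν := boundaryMeasure G q o x
  set w : ℝ → ℂ := fun s => (plancherelDensity q s : ℂ) with hw
  have hR := sqrt_pos hq
  have hqR : (2 : ℝ) ≤ q := by exact_mod_cast hq
  have hqle : (q : ℝ) / (q + 1) ≤ 1 := by rw [div_le_one (by positivity)]; linarith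
  have hqinv : ‖(q : ℂ)⁻¹‖ ≤ 1 := by
    rw [norm_inv, Complex.norm_natCast]
    exact inv_le_one_of_one_le₀ (by linarith)
  have hnν : ∀ i ≤ d, ν.real (cylinder G o x (g i)) = cylMass q i := fun i hi => by
    rw [measureReal_cylinder hG hq hreg, h1 i hi]
  -- This point, at which the symbol will be frozen, lies in every cylinder along the geodesic; it
  -- exists because `Ω(x, y)` has positive mass.
  obtain ⟨ω₀, hω₀⟩ : (cylinder G o x y).Nonempty := by
    rw [Set.nonempty_iff_ne_empty]
    intro h
    have h3 := measureReal_cylinder (o := o) hG hq hreg x y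
    rw [h] at h3
    simp only [measureReal_empty] at h3
    exact (cylMass_pos hq _).ne h3
  have hM0 : 0 ≤ M := (norm_nonneg _).trans (hM.norm_le x ω₀ ⟨le_rfl, hτ.le⟩)
  -- the size of one term
  set E : ℝ := 4 ^ N * M * (√(q : ℝ) ^ d)⁻¹ / (1 + (d : ℝ)) ^ N with hE
  have hE0 : 0 ≤ E := by positivity
  have hfour : ∀ t : ℝ, (1 + (d : ℝ)) / 4 ≤ t → ∀ c : ℝ, 0 ≤ c →
      c * M / t ^ N ≤ c * (4 ^ N * M / (1 + (d : ℝ)) ^ N) := by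
    intro t ht c hc
    have h3 : 0 < (1 + (d : ℝ)) / 4 := by positivity
    calc c * M / t ^ N ≤ c * M / ((1 + (d : ℝ)) / 4) ^ N := by gcongr
      _ = _ := by rw [div_pow]; field_simp
  -- For `i < n` the frequencies `2 i - d` and `2 i - d + 2` are at most `-d / 2`. For `i ≥ n` the
  -- cylinders have depth greater than `d / 4`, where regularity in `ω` is effective. The telescoped
  -- ends have the frequencies `d + 1` and `2 n - d + 1`, of size at least about `d / 2`.
  set n := d / 4 with hn
  have hnd : n ≤ d := Nat.div_le_self _ _
  have hn1 : (1 + (d : ℝ)) / 4 ≤ 1 + n := by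
    have : 1 + d ≤ 4 * (1 + n) := by omega
    have : 1 + (d : ℝ) ≤ 4 * (1 + n) := by exact_mod_cast this
    linarith
  have hfar : ∀ m : ℤ, (d : ℤ) ≤ 4 * (|m| + 1) - 1 → (1 + (d : ℝ)) / 4 ≤ 1 + |(m : ℝ)| := by
    intro m hm
    have : (d : ℝ) ≤ 4 * (|(m : ℝ)| + 1) - 1 := by exact_mod_cast hm
    linarith
  have hF : ∀ (m : ℤ) ω, (d : ℤ) ≤ 4 * (|m| + 1) - 1 → ‖fourierSymbol q w a x m ω‖ ≤
      C₁ * (4 ^ N * M / (1 + (d : ℝ)) ^ N) := fun m ω hm =>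
    (hC₁ a ha M hM x m ω).trans (hfour _ (hfar m hm) _ hC₁0)
  have hF' : ∀ (m : ℤ) ω, (d : ℤ) ≤ 4 * (|m| + 1) - 1 →
      ‖fourierSymbol q (telescopeWeight q) a x m ω‖ ≤
      C₂ * (4 ^ N * M / (1 + (d : ℝ)) ^ N) := fun m ω hm =>
    (hC₂ a ha M hM x m ω).trans (hfour _ (hfar m hm) _ hC₂0)
  have hmass : ∀ i : ℕ, ∀ b : ℝ, 0 ≤ b → √(q : ℝ) ^ (2 * (i : ℤ) + 2 - d) *
      (b * (4 ^ N * M / (1 + (d : ℝ)) ^ N)) * cylMass q (i + 1) ≤ b * E := by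
    intro i b hb
    rw [mul_right_comm, sqrt_pow_mul_cylMass hq]
    calc _ ≤ 1 * (√(q : ℝ) ^ d)⁻¹ * (b * (4 ^ N * M / (1 + (d : ℝ)) ^ N)) := by gcongr
      _ = b * E := by rw [hE]; ring
  have hnormR : ∀ m : ℤ, ‖(√(q : ℝ) : ℂ) ^ m‖ = √(q : ℝ) ^ m := fun m => by
    rw [norm_zpow, Complex.norm_real, Real.norm_of_nonneg hR.le]
  -- the constant term
  have hT0 : ‖∫ ω, (√(q : ℝ) : ℂ) ^ (-(d : ℤ)) * fourierSymbol q w a x (-d) ω ∂ν‖ ≤ C₁ * E := by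
    refine (norm_integral_le_of_norm_le_const (C := C₁ * E) (ae_of_all _ fun ω => ?_)).trans
      (le_of_eq (by simp))
    rw [norm_mul, hnormR, zpow_neg, zpow_natCast]
    have := hF (-d) ω (by rw [abs_neg]; simp; omega)
    calc _ ≤ (√(q : ℝ) ^ d)⁻¹ * (C₁ * (4 ^ N * M / (1 + (d : ℝ)) ^ N)) := by gcongr
      _ = _ := by rw [hE]; ring
  -- the terms near `x`
  have hT1 : ∀ i < n, ‖∫ ω in cylinder G o x (g (i + 1)), kernelPiece q a x d i ω ∂ν‖ ≤
      2 * C₁ * E := by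
    intro i hi
    have h3 : ∀ ω ∈ cylinder G o x (g (i + 1)), ‖kernelPiece q a x d i ω‖ ≤
        √(q : ℝ) ^ (2 * (i : ℤ) + 2 - d) * (2 * C₁ * (4 ^ N * M / (1 + (d : ℝ)) ^ N)) := by
      intro ω _
      rw [kernelPiece, norm_mul, hnormR]
      gcongr
      refine (norm_sub_le _ _).trans ?_
      rw [norm_mul]
      have h4 := hF (2 * i - d + 2) ω (by rw [abs_of_nonpos (by omega)]; omega)
      have h5 := hF (2 * i - d) ω (by rw [abs_of_nonpos (by omega)]; omega)
      have h6 := mul_le_of_le_one_left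
        (norm_nonneg (fourierSymbol q w a x (2 * i - d) ω)) hqinv
      linarith
    refine (norm_setIntegral_le_of_norm_le_const (measure_lt_top _ _) h3).trans ?_
    rw [hnν _ (by omega)]
    exact hmass i _ (by positivity)
  -- the terms near `y`, up to a small error
  have hT2 : ∀ i, n ≤ i → i < d → ‖(∫ ω in cylinder G o x (g (i + 1)), kernelPiece q a x d i ω ∂ν) -
      (cylMass q (i + 1) : ℂ) * kernelPiece q a x d i ω₀‖ ≤ 4 * W * tau q * E := by
    intro i hi hid
    have hmem : ω₀ ∈ cylinder G o x (g (i + 1)) := by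
      have h3 := dist_le_of_adj (i := i + 1) hG h2 hid le_rfl
      have h4 := h1 (i + 1) hid
      have h5 := height_sub_le hG ω₀ x (g (i + 1))
      have h6 := height_sub_le hG ω₀ (g (i + 1)) y
      rw [hd] at h3
      rw [mem_cylinder_iff_height hG] at hω₀ ⊢
      omega
    have h3 : ∀ ω ∈ cylinder G o x (g (i + 1)),
        ‖kernelPiece q a x d i ω - kernelPiece q a x d i ω₀‖ ≤
        √(q : ℝ) ^ (2 * (i : ℤ) + 2 - d) *
          (4 * W * tau q * (4 ^ N * M / (1 + (d : ℝ)) ^ N)) := by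
      intro ω hω
      rw [kernelPiece, kernelPiece, ← mul_sub, norm_mul, hnormR]
      gcongr
      have h4 : ∀ m : ℤ, ‖fourierSymbol q w a x m ω - fourierSymbol q w a x m ω₀‖ ≤
          2 * W * tau q * (4 ^ N * M / (1 + (d : ℝ)) ^ N) := fun m => by
        refine (norm_fourierSymbol_sub_le hG hq ha hM (continuous_density hq) hW m hω hmem).trans
          (hfour _ ?_ _ (by positivity))
        rw [h1 _ hid]
        have : (n : ℝ) ≤ i := by exact_mod_cast hi
        push_cast
        linarith
      have h5 := h4 (2 * i - d + 2)
      have h6 := h4 (2 * i - d)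
      have h7 := mul_le_of_le_one_left (norm_nonneg (fourierSymbol q w a x (2 * i - d) ω -
        fourierSymbol q w a x (2 * i - d) ω₀)) hqinv
      rw [← norm_mul] at h7
      calc _ = ‖(fourierSymbol q w a x (2 * i - d + 2) ω -
            fourierSymbol q w a x (2 * i - d + 2) ω₀) - (q : ℂ)⁻¹ *
            (fourierSymbol q w a x (2 * i - d) ω - fourierSymbol q w a x (2 * i - d) ω₀)‖ := by
            congr 1; ring
        _ ≤ _ := (norm_sub_le _ _).trans (by linarith)
    have h8 : (∫ ω in cylinder G o x (g (i + 1)), kernelPiece q a x d i ω ∂ν) -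
        (cylMass q (i + 1) : ℂ) * kernelPiece q a x d i ω₀ =
        ∫ ω in cylinder G o x (g (i + 1)),
          (kernelPiece q a x d i ω - kernelPiece q a x d i ω₀) ∂ν := by
      rw [integral_sub (integrable_kernelPiece hG hq hreg ha x x d i).integrableOn
        (integrable_const _), setIntegral_const, hnν _ hid]
      rfl
    rw [h8]
    refine (norm_setIntegral_le_of_norm_le_const (measure_lt_top _ _) h3).trans ?_
    rw [hnν _ (by omega)]
    exact hmass i _ (by positivity)
  -- the main part of the terms near `y`
  have hT3 : ‖∑ i ∈ Finset.Ico n d, (cylMass q (i + 1) : ℂ) * kernelPiece q a x d i ω₀‖ ≤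
      2 * C₂ * E := by
    rw [sum_kernelPiece hq ha x hnd, norm_mul]
    have h3 : ‖(q : ℂ) / (q + 1) * ((√(q : ℝ) : ℂ) ^ d)⁻¹‖ ≤ (√(q : ℝ) ^ d)⁻¹ := by
      rw [norm_mul, norm_inv, norm_pow, Complex.norm_real, Real.norm_of_nonneg hR.le]
      refine mul_le_of_le_one_left (by positivity) ?_
      have : (q : ℂ) / (q + 1) = ((q / (q + 1) : ℝ) : ℂ) := by push_cast; rfl
      rw [this, Complex.norm_real, Real.norm_of_nonneg (by positivity)]
      exact hqle
    have h4 := hF' (d + 1) ω₀ (by rw [abs_of_nonneg (by omega)]; omega)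
    have h5 := hF' (2 * n - d + 1) ω₀ (by
      rcases abs_cases (2 * (n : ℤ) - d + 1) with h | h <;> omega)
    calc _ ≤ (√(q : ℝ) ^ d)⁻¹ * (2 * C₂ * (4 ^ N * M / (1 + (d : ℝ)) ^ N)) := by
          gcongr
          refine (norm_sub_le _ _).trans ?_
          linarith
      _ = _ := by rw [hE]; ring
  have hk := kernel_eq_sum hG hq hreg ha d h0 h1 h2
  rw [hd] at hk
  have hsplit : kernel q a x y = (∫ ω, (√(q : ℝ) : ℂ) ^ (-(d : ℤ)) *
      fourierSymbol q w a x (-d) ω ∂ν) +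
      ∑ i ∈ Finset.range n, (∫ ω in cylinder G o x (g (i + 1)), kernelPiece q a x d i ω ∂ν) +
      ∑ i ∈ Finset.Ico n d, ((∫ ω in cylinder G o x (g (i + 1)), kernelPiece q a x d i ω ∂ν) -
        (cylMass q (i + 1) : ℂ) * kernelPiece q a x d i ω₀) +
      ∑ i ∈ Finset.Ico n d, (cylMass q (i + 1) : ℂ) * kernelPiece q a x d i ω₀ := by
    rw [hk, ← Finset.sum_range_add_sum_Ico _ hnd, Finset.sum_sub_distrib]
    ring
  have hs1 : ‖∑ i ∈ Finset.range n, ∫ ω in cylinder G o x (g (i + 1)),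
      kernelPiece q a x d i ω ∂ν‖ ≤ n * (2 * C₁ * E) := by
    refine (norm_sum_le_of_le _ fun i hi => hT1 i (Finset.mem_range.1 hi)).trans (le_of_eq ?_)
    simp
  have hs2 : ‖∑ i ∈ Finset.Ico n d, ((∫ ω in cylinder G o x (g (i + 1)),
      kernelPiece q a x d i ω ∂ν) - (cylMass q (i + 1) : ℂ) * kernelPiece q a x d i ω₀)‖ ≤
      (d - n : ℕ) * (4 * W * tau q * E) := by
    refine (norm_sum_le_of_le _ fun i hi => hT2 i (Finset.mem_Ico.1 hi).1
      (Finset.mem_Ico.1 hi).2).trans (le_of_eq ?_)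
    simp
  have hnR : (n : ℝ) ≤ 1 + d := by
    have : (n : ℝ) ≤ d := by exact_mod_cast hnd
    linarith
  have hdnR : ((d - n : ℕ) : ℝ) ≤ 1 + d := by
    have : ((d - n : ℕ) : ℝ) ≤ d := by exact_mod_cast Nat.sub_le _ _
    linarith
  have hd1 : (1 : ℝ) ≤ 1 + d := by linarith [Nat.cast_nonneg (α := ℝ) d]
  rw [hsplit]
  calc _ ≤ C₁ * E + n * (2 * C₁ * E) + (d - n : ℕ) * (4 * W * tau q * E) + 2 * C₂ * E :=
        norm_add_le_of_le (norm_add_le_of_le (norm_add_le_of_le hT0 hs1) hs2) hT3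
    _ ≤ (1 + d) * (C₁ * E) + (1 + d) * (2 * C₁ * E) + (1 + d) * (4 * W * tau q * E) +
        (1 + d) * (2 * C₂ * E) := by
        refine add_le_add (add_le_add (add_le_add ?_ ?_) ?_) ?_
        · exact le_mul_of_one_le_left (by positivity) hd1
        · exact mul_le_mul_of_nonneg_right hnR (by positivity)
        · exact mul_le_mul_of_nonneg_right hdnR (by positivity)
        · exact le_mul_of_one_le_left (by positivity) hd1
    _ = _ := by rw [hE]; ring

/-- One order of the seminorms pays for the number of cylinders along the geodesic. -/
theorem exists_kernel_decay [G.LocallyFinite] (hG : G.IsTree) (hq : 2 ≤ q)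
    (hreg : G.IsRegularOfDegree (q + 1)) (o : X) (N : ℕ) :
    ∃ C, 0 ≤ C ∧ ∀ (a : SymbolFun G o), IsSymbol q a → ∀ M, SymbolBound q (N + 1) M a →
      ∀ x y, ‖kernel q a x y‖ ≤ C * M * ((√(q : ℝ) ^ G.dist x y)⁻¹ *
        ((1 + (G.dist x y : ℝ)) ^ N)⁻¹) := by
  obtain ⟨C, hC0, hC⟩ := exists_kernel_decay_aux hG hq hreg o (N + 1)
  refine ⟨C, hC0, fun a ha M hM x y => (hC a ha M hM x y).trans (le_of_eq ?_)⟩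
  have : (1 + (G.dist x y : ℝ)) ≠ 0 := by positivity
  rw [pow_succ]
  field_simp

end Decay

/-! ### Integration over the boundary and the spectrum -/

section Admissible

variable {X : Type*} {G : SimpleGraph X} {o : X} {q : ℕ}

/-- Bounded functions of `(ω, s)` which are continuous for `s ∈ [0, τ]`. -/
structure IsAdmissible (q : ℕ) (F : Boundary G o → ℝ → ℂ) : Prop where
  continuousOn : ContinuousOn (fun p : Boundary G o × ℝ => F p.1 p.2) (Set.univ ×ˢ Set.Icc 0 (tau q))
  bounded : ∃ C : ℝ, ∀ ω, ∀ s ∈ Set.Icc 0 (tau q), ‖F ω s‖ ≤ C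

theorem IsSymbol.isAdmissible {a : SymbolFun G o} (ha : IsSymbol q a) (x : X) :
    IsAdmissible q (a x) := by
  obtain ⟨C, hC⟩ := ha.bounded 0
  rw [dS_zero] at hC
  exact ⟨ha.continuousOn_zero x, C, hC x⟩

theorem IsAdmissible.mul {F F' : Boundary G o → ℝ → ℂ} (h : IsAdmissible q F)
    (h' : IsAdmissible q F') : IsAdmissible q fun ω s => F ω s * F' ω s := by
  obtain ⟨C, hC⟩ := h.bounded
  obtain ⟨C', hC'⟩ := h'.bounded
  refine ⟨h.continuousOn.mul h'.continuousOn, C * C', fun ω s hs => ?_⟩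
  rw [norm_mul]
  exact mul_le_mul (hC ω s hs) (hC' ω s hs) (norm_nonneg _) ((norm_nonneg _).trans (hC ω s hs))

theorem IsAdmissible.sub {F F' : Boundary G o → ℝ → ℂ} (h : IsAdmissible q F)
    (h' : IsAdmissible q F') : IsAdmissible q fun ω s => F ω s - F' ω s := by
  obtain ⟨C, hC⟩ := h.bounded
  obtain ⟨C', hC'⟩ := h'.bounded
  exact ⟨h.continuousOn.sub h'.continuousOn, C + C', fun ω s hs =>
    (norm_sub_le _ _).trans (add_le_add (hC ω s hs) (hC' ω s hs))⟩

theorem IsAdmissible.of_continuous {f : ℝ → ℂ} (hf : Continuous f) :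
    IsAdmissible (G := G) (o := o) q fun _ s => f s := by
  obtain ⟨C, hC⟩ := isCompact_Icc.exists_bound_of_continuousOn (s := Set.Icc 0 (tau q))
    hf.continuousOn
  exact ⟨(hf.comp continuous_snd).continuousOn, C, fun _ s hs => hC s hs⟩

theorem isAdmissible_wave [G.LocallyFinite] (hG : G.IsTree) (hq : 2 ≤ q) (x y : X) :
    IsAdmissible (G := G) (o := o) q (wave q x y) :=
  ⟨(continuous_wave hG hq x y).continuousOn, _, fun ω s _ => norm_wave_le hG hq x y ω s⟩

theorem isAdmissible_wave_neg [G.LocallyFinite] (hG : G.IsTree) (hq : 2 ≤ q) (x y : X) :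
    IsAdmissible (G := G) (o := o) q fun ω s => wave q x y ω (-s) :=
  ⟨(continuous_wave_neg hG hq x y).continuousOn, _, fun ω s _ => norm_wave_le hG hq x y ω (-s)⟩

theorem isAdmissible_density (hq : 2 ≤ q) :
    IsAdmissible (G := G) (o := o) q fun _ s => (plancherelDensity q s : ℂ) :=
  .of_continuous (continuous_density hq)

theorem IsAdmissible.integrable_prod [G.LocallyFinite] (hG : G.IsTree) (hq : 2 ≤ q)
    (hreg : G.IsRegularOfDegree (q + 1)) (x : X) {F : Boundary G o → ℝ → ℂ}
    (h : IsAdmissible q F) : Integrable (Function.uncurry F)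
      ((boundaryMeasure G q o x).prod (volume.restrict (Set.Ioc 0 (tau q)))) := by
  have := isProbabilityMeasure_boundaryMeasure hG hq hreg o x
  have := secondCountable_boundary (o := o) hG
  obtain ⟨C, hC⟩ := h.bounded
  have hprod : (boundaryMeasure G q o x).prod (volume.restrict (Set.Ioc 0 (tau q))) =
      ((boundaryMeasure G q o x).prod volume).restrict (Set.univ ×ˢ Set.Ioc 0 (tau q)) := by
    rw [← Measure.prod_restrict, Measure.restrict_univ]
  have hmeas : MeasurableSet (Set.univ ×ˢ Set.Ioc 0 (tau q) : Set (Boundary G o × ℝ)) :=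
    MeasurableSet.univ.prod measurableSet_Ioc
  refine Integrable.of_bound ?_ C ?_
  · rw [hprod]
    exact (h.continuousOn.mono
      (Set.prod_mono subset_rfl Set.Ioc_subset_Icc_self)).aestronglyMeasurable hmeas
  · rw [hprod]
    filter_upwards [ae_restrict_mem hmeas] with p hp
    exact hC p.1 p.2 (Set.Ioc_subset_Icc_self hp.2)

theorem IsAdmissible.integral_prod [G.LocallyFinite] (hG : G.IsTree) (hq : 2 ≤ q)
    (hreg : G.IsRegularOfDegree (q + 1)) (x : X) {F : Boundary G o → ℝ → ℂ}
    (h : IsAdmissible q F) :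
    ∫ p, Function.uncurry F p
      ∂((boundaryMeasure G q o x).prod (volume.restrict (Set.Ioc 0 (tau q)))) =
    ∫ ω, (∫ s in (0 : ℝ)..tau q, F ω s) ∂(boundaryMeasure G q o x) := by
  have := isProbabilityMeasure_boundaryMeasure hG hq hreg o x
  rw [MeasureTheory.integral_prod _ (h.integrable_prod hG hq hreg x)]
  simp_rw [intervalIntegral.integral_of_le (tau_pos hq).le]
  rfl

theorem IsAdmissible.integral_swap [G.LocallyFinite] (hG : G.IsTree) (hq : 2 ≤ q)
    (hreg : G.IsRegularOfDegree (q + 1)) (x : X) {F : Boundary G o → ℝ → ℂ}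
    (h : IsAdmissible q F) :
    ∫ ω, (∫ s in (0 : ℝ)..tau q, F ω s) ∂(boundaryMeasure G q o x) =
      ∫ s in (0 : ℝ)..tau q, ∫ ω, F ω s ∂(boundaryMeasure G q o x) := by
  have := isProbabilityMeasure_boundaryMeasure hG hq hreg o x
  simp_rw [intervalIntegral.integral_of_le (tau_pos hq).le]
  exact integral_integral_swap (h.integrable_prod hG hq hreg x)

theorem IsAdmissible.intervalIntegrable (hq : 2 ≤ q) {F : Boundary G o → ℝ → ℂ}
    (h : IsAdmissible q F) (ω : Boundary G o) :
    IntervalIntegrable (F ω) volume 0 (tau q) := by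
  refine ContinuousOn.intervalIntegrable ?_
  rw [Set.uIcc_of_le (tau_pos hq).le]
  exact h.continuousOn.comp (f := fun s : ℝ => (ω, s)) (by fun_prop) fun s hs => ⟨trivial, hs⟩

theorem IsAdmissible.integrable [G.LocallyFinite] (hG : G.IsTree) (hq : 2 ≤ q)
    (hreg : G.IsRegularOfDegree (q + 1)) (x : X) {F : Boundary G o → ℝ → ℂ}
    (h : IsAdmissible q F) :
    Integrable (fun ω => ∫ s in (0 : ℝ)..tau q, F ω s) (boundaryMeasure G q o x) := by
  obtain ⟨C, hC⟩ := h.bounded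
  refine integrable_of_continuous_of_bounded hG hq hreg x
    (continuous_integral_of_bounded hG (tau_pos hq).le h.continuousOn hC) (C := C * |tau q - 0|)
    fun ω => ?_
  refine intervalIntegral.norm_integral_le_of_norm_le_const fun s hs => ?_
  rw [Set.uIoc_of_le (tau_pos hq).le] at hs
  exact hC ω s (Set.Ioc_subset_Icc_self hs)

theorem IsAdmissible.continuous_left {F : Boundary G o → ℝ → ℂ} (h : IsAdmissible q F) {s : ℝ}
    (hs : s ∈ Set.Icc 0 (tau q)) : Continuous fun ω => F ω s := by
  rw [← continuousOn_univ]
  exact h.continuousOn.comp (f := fun ω => (ω, s)) (by fun_prop) fun ω _ => ⟨trivial, hs⟩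

theorem IsAdmissible.integrable_left [G.LocallyFinite] (hG : G.IsTree) (hq : 2 ≤ q)
    (hreg : G.IsRegularOfDegree (q + 1)) (x : X) {F : Boundary G o → ℝ → ℂ}
    (h : IsAdmissible q F) {s : ℝ} (hs : s ∈ Set.Icc 0 (tau q)) :
    Integrable (fun ω => F ω s) (boundaryMeasure G q o x) := by
  obtain ⟨C, hC⟩ := h.bounded
  exact integrable_of_continuous_of_bounded hG hq hreg x (h.continuous_left hs)
    fun ω => hC ω s hs

/-- Dominated convergence for series of admissible functions. -/
theorem hasSum_integral_of_isAdmissible [G.LocallyFinite] (hG : G.IsTree) (hq : 2 ≤ q)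
    (hreg : G.IsRegularOfDegree (q + 1)) (x : X) {ι : Type*} [Countable ι]
    {F : ι → Boundary G o → ℝ → ℂ} {F₀ : Boundary G o → ℝ → ℂ} (h : ∀ i, IsAdmissible q (F i))
    (h₀ : IsAdmissible q F₀) {C : ℝ}
    (hC : ∀ (t : Finset ι) ω, ∀ s ∈ Set.Icc 0 (tau q), ∑ i ∈ t, ‖F i ω s‖ ≤ C)
    (hsum : ∀ ω, ∀ s ∈ Set.Icc 0 (tau q), HasSum (fun i => F i ω s) (F₀ ω s)) :
    HasSum (fun i => ∫ ω, (∫ s in (0 : ℝ)..tau q, F i ω s) ∂(boundaryMeasure G q o x))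
      (∫ ω, (∫ s in (0 : ℝ)..tau q, F₀ ω s) ∂(boundaryMeasure G q o x)) := by
  have := isProbabilityMeasure_boundaryMeasure hG hq hreg o x
  set P := (boundaryMeasure G q o x).prod (volume.restrict (Set.Ioc 0 (tau q))) with hP
  have hae : ∀ᵐ p ∂P, p.2 ∈ Set.Ioc 0 (tau q) := by
    have h1 : ∀ᵐ s ∂(volume.restrict (Set.Ioc 0 (tau q))), s ∈ Set.Ioc 0 (tau q) :=
      ae_restrict_mem measurableSet_Ioc
    exact Measure.quasiMeasurePreserving_snd.ae h1
  -- The bound on finite sums is pointwise and uniform, so it can be integrated; no termwise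
  -- summable bound is required.
  have hsummable : Summable fun i => ∫ p, ‖Function.uncurry (F i) p‖ ∂P := by
    refine summable_of_sum_le (c := ∫ _, C ∂P) (fun i => by positivity) fun t => ?_
    rw [← integral_finsetSum _ fun i _ => ((h i).integrable_prod hG hq hreg x).norm]
    refine integral_mono_ae (integrable_finsetSum _ fun i _ =>
      ((h i).integrable_prod hG hq hreg x).norm) (integrable_const _) ?_
    filter_upwards [hae] with p hp
    exact hC t p.1 p.2 (Set.Ioc_subset_Icc_self hp)
  have h1 := hasSum_integral_of_summable_integral_norm
    (fun i => (h i).integrable_prod hG hq hreg x) hsummable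
  have h2 : ∫ p, ∑' i, Function.uncurry (F i) p ∂P = ∫ p, Function.uncurry F₀ p ∂P := by
    refine integral_congr_ae ?_
    filter_upwards [hae] with p hp
    exact (hsum p.1 p.2 (Set.Ioc_subset_Icc_self hp)).tsum_eq
  rw [h2] at h1
  rw [hP, h₀.integral_prod hG hq hreg x] at h1
  simp_rw [fun i => (h i).integral_prod hG hq hreg x] at h1
  exact h1

end Admissible

/-! ### The Plancherel formula -/

section Plancherel

variable {X : Type*} {G : SimpleGraph X} {o : X} {q : ℕ}

/-- The function on the disc whose boundary values give the spherical functions. -/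
noncomputable def sphericalDisc (q d : ℕ) (z : ℂ) : ℂ :=
  (z ^ 2 - 1) * z ^ d / (1 - z ^ 2 / q)

theorem one_sub_sq_div_ne_zero (hq : 2 ≤ q) {z : ℂ} (hz : ‖z‖ ≤ 1) : 1 - z ^ 2 / q ≠ 0 := by
  have hqR : (2 : ℝ) ≤ q := by exact_mod_cast hq
  intro h
  have h1 : ‖z ^ 2 / (q : ℂ)‖ = 1 := by
    rw [← sub_eq_zero.1 h, norm_one]
  rw [norm_div, norm_pow, Complex.norm_natCast, div_eq_one_iff_eq (by positivity)] at h1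
  have : ‖z‖ ^ 2 ≤ 1 := pow_le_one₀ (norm_nonneg _) hz
  linarith

/-- The denominator does not vanish on the closed disc, since `|z² / q| < 1` there. By the mean
value property the average is the value at `0`. -/
theorem circleAverage_sphericalDisc (hq : 2 ≤ q) (d : ℕ) :
    Real.circleAverage (sphericalDisc q d) 0 1 = if d = 0 then -1 else 0 := by
  have h : DiffContOnCl ℂ (sphericalDisc q d) (Metric.ball 0 |1|) := by
    refine DifferentiableOn.diffContOnCl fun z hz => ?_
    rw [abs_one, closure_ball _ one_ne_zero, mem_closedBall_zero_iff] at hz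
    refine DifferentiableAt.differentiableWithinAt ?_
    unfold sphericalDisc
    exact DifferentiableAt.div (by fun_prop) (by fun_prop) (one_sub_sq_div_ne_zero hq hz)
  rw [h.circleAverage, sphericalDisc]
  cases d <;> simp

/-- The two terms together integrate over `[-τ, τ]`, on which `phase q` runs once around the unit
circle. -/
theorem integral_sphericalDisc_phase (hq : 2 ≤ q) (d : ℕ) :
    ∫ s in (0 : ℝ)..tau q, (sphericalDisc q d (phase q s) + sphericalDisc q d (phase q (-s))) =
      2 * tau q * if d = 0 then -1 else 0 := by
  have hL := log_pos hq
  have hcont : Continuous fun s : ℝ => sphericalDisc q d (phase q s) := by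
    unfold sphericalDisc
    have := continuous_phase q
    exact Continuous.div (by fun_prop) (by fun_prop)
      fun s => one_sub_sq_div_ne_zero hq (norm_phase q s).le
  have hcont' : Continuous fun s : ℝ => sphericalDisc q d (phase q (-s)) :=
    hcont.comp continuous_neg
  have hper : Function.Periodic (fun θ : ℝ => sphericalDisc q d (circleMap 0 1 θ)) (2 * Real.pi) :=
    fun θ => by simp only [periodic_circleMap 0 1 θ]
  rw [← circleAverage_sphericalDisc hq d, Real.circleAverage_def,
    intervalIntegral.integral_add (hcont.intervalIntegrable _ _) (hcont'.intervalIntegrable _ _),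
    intervalIntegral.integral_comp_neg fun s => sphericalDisc q d (phase q s), neg_zero, add_comm,
    intervalIntegral.integral_add_adjacent_intervals (hcont.intervalIntegrable _ _)
      (hcont.intervalIntegrable _ _)]
  have h1 : ∀ s : ℝ, sphericalDisc q d (phase q s) =
      sphericalDisc q d (circleMap 0 1 (Real.log q * s)) := by
    intro s
    rw [circleMap_zero, phase]
    push_cast
    rw [one_mul]
    congr 2
    ring
  simp_rw [h1]
  rw [intervalIntegral.integral_comp_mul_left
    (fun θ => sphericalDisc q d (circleMap 0 1 θ)) hL.ne']
  have h2 : Real.log q * tau q = Real.pi := by rw [tau]; field_simp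
  have h3 := hper.intervalIntegral_add_eq (-Real.pi) 0
  rw [mul_neg, h2]
  rw [show -Real.pi + 2 * Real.pi = Real.pi by ring, zero_add] at h3
  rw [h3, Complex.real_smul, Complex.real_smul, tau]
  push_cast
  have := Real.pi_ne_zero
  have hπ : (Real.pi : ℂ) ≠ 0 := Complex.ofReal_ne_zero.2 this
  field_simp

theorem integral_wave [G.LocallyFinite] (hG : G.IsTree) (hq : 2 ≤ q)
    (hreg : G.IsRegularOfDegree (q + 1)) (o x y : X) (s : ℝ) :
    ∫ ω, wave q x y ω s ∂(boundaryMeasure G q o x) =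
      waveBase q s ^ (-(G.dist x y : ℤ)) + ∑ i ∈ Finset.range (G.dist x y),
        (cylMass q (i + 1) : ℂ) * (waveBase q s ^ (2 * (i : ℤ) + 2 - G.dist x y) -
          waveBase q s ^ (2 * (i : ℤ) - G.dist x y)) := by
  have := isProbabilityMeasure_boundaryMeasure hG hq hreg o x
  obtain ⟨g, h0, hd, h1, h2⟩ := exists_geodesic hG x y
  have h3 : ∀ ω : Boundary G o, wave q x y ω s = _ := fun ω => by
    rw [← hd, wave_eq_sum hG hq (G.dist x y) h0 h1 h2 ω s]
  have hi : ∀ i, Integrable ((cylinder G o x (g (i + 1))).indicator fun _ =>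
      waveBase q s ^ (2 * (i : ℤ) + 2 - G.dist x y) - waveBase q s ^ (2 * (i : ℤ) - G.dist x y))
      (boundaryMeasure G q o x) := fun i =>
    (integrable_const _).indicator (measurableSet_cylinder _ _)
  rw [integral_congr_ae (ae_of_all _ h3), integral_add (integrable_const _)
    (integrable_finsetSum _ fun i _ => hi i), integral_finsetSum _ fun i _ => hi i]
  congr 1
  · simp
  · refine Finset.sum_congr rfl fun i hid => ?_
    rw [integral_indicator (measurableSet_cylinder _ _), setIntegral_const,
      measureReal_cylinder hG hq hreg, h1 _ (Finset.mem_range.1 hid)]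
    rfl

theorem density_denominator_eq (hq : 2 ≤ q) (s : ℝ) :
    (((q : ℝ) + (q : ℝ)⁻¹ - 2 * Real.cos (2 * s * Real.log q) : ℝ) : ℂ) =
      q * ((1 - phase q s ^ 2 / q) * (1 - (phase q s)⁻¹ ^ 2 / q)) := by
  have hq0 : (q : ℂ) ≠ 0 := by simp; omega
  have hu := phase_ne_zero q s
  have h : ((2 * Real.cos (2 * s * Real.log q) : ℝ) : ℂ) = phase q s ^ 2 + (phase q s)⁻¹ ^ 2 := by
    rw [← phase_neg, Complex.ofReal_mul, Complex.ofReal_cos, Complex.ofReal_ofNat, Complex.two_cos,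
      phase, phase, ← Complex.exp_nat_mul, ← Complex.exp_nat_mul, Complex.ofReal_neg,
      Complex.ofReal_mul, Complex.ofReal_mul]
    congr 2 <;> (push_cast; ring)
  rw [Complex.ofReal_sub, h]
  push_cast
  field_simp
  ring

/-- The integral over `ω` is the spherical function. Multiplied by the density it telescopes as the
kernels do. With `u = phase q s` the denominator of the density factors as `q (1 - u² / q) (1 - u⁻²
/ q)`, and the result is a sum of boundary values at `u` and `u⁻¹` of a function holomorphic in the
disc. -/
theorem integral_wave_mul_density [G.LocallyFinite] (hG : G.IsTree) (hq : 2 ≤ q)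
    (hreg : G.IsRegularOfDegree (q + 1)) (o x y : X) (s : ℝ) :
    (∫ ω, wave q x y ω s ∂(boundaryMeasure G q o x)) * plancherelDensity q s =
      -((2 * tau q : ℝ) : ℂ)⁻¹ * ((√(q : ℝ) : ℂ) ^ G.dist x y)⁻¹ *
        (sphericalDisc q (G.dist x y) (phase q s) + sphericalDisc q (G.dist x y) (phase q (-s))) := by
  have hR := sqrt_ne_zero hq
  have hu := phase_ne_zero q s
  have hq0 : (q : ℂ) ≠ 0 := by simp; omega
  set d := G.dist x y
  have key : ∀ i : ℕ, (cylMass q (i + 1) : ℂ) * (waveBase q s ^ (2 * (i : ℤ) + 2 - d) -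
      waveBase q s ^ (2 * (i : ℤ) - d)) * plancherelDensity q s =
      (q : ℂ) / (q + 1) * ((√(q : ℝ) : ℂ) ^ d)⁻¹ * telescopeWeight q s *
        (phase q s ^ (2 * ((i + 1 : ℕ) : ℤ) - d + 1) - phase q s ^ (2 * (i : ℤ) - d + 1)) := by
    intro i
    have h1 : (√(q : ℝ) : ℂ) ^ (2 * (i : ℤ) + 2 - d) * (cylMass q (i + 1) : ℂ) =
        (q : ℂ) / (q + 1) * ((√(q : ℝ) : ℂ) ^ d)⁻¹ := by
      rw [← Complex.ofReal_zpow, ← Complex.ofReal_mul, sqrt_pow_mul_cylMass hq i d]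
      push_cast
      rfl
    have h2 : (√(q : ℝ) : ℂ) ^ (2 * (i : ℤ) - d) =
        (q : ℂ)⁻¹ * (√(q : ℝ) : ℂ) ^ (2 * (i : ℤ) + 2 - d) := by
      rw [show 2 * (i : ℤ) + 2 - d = (2 * (i : ℤ) - d) + 1 + 1 by ring, zpow_add_one₀ hR,
        zpow_add_one₀ hR, mul_assoc, sqrt_mul_self]
      field_simp
    have h3 := phase_telescope q (2 * (i : ℤ) - d) s
    rw [show 2 * ((i + 1 : ℕ) : ℤ) - d + 1 = 2 * (i : ℤ) - d + 3 by push_cast; ring, ← h1,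
      waveBase, mul_zpow, mul_zpow, h2, show 2 * (i : ℤ) + 2 - d = 2 * (i : ℤ) - d + 2 by ring]
    linear_combination ((√(q : ℝ) : ℂ) ^ (2 * (i : ℤ) - d + 2) * (cylMass q (i + 1) : ℂ)) * h3
  have htel := Finset.sum_range_sub (fun i : ℕ => phase q s ^ (2 * (i : ℤ) - d + 1)) d
  rw [integral_wave hG hq hreg, add_mul, Finset.sum_mul, Finset.sum_congr rfl fun i _ => key i,
    ← Finset.mul_sum, htel]
  have hden := density_denominator_eq hq s
  have hn1 := one_sub_sq_div_ne_zero hq (norm_phase q s).le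
  have hn2 := one_sub_sq_div_ne_zero hq (norm_phase q (-s)).le
  have hsin := phase_sub_phase_inv q s
  have hq1 : (q : ℂ) + 1 ≠ 0 := by exact_mod_cast Nat.succ_ne_zero q
  have hπ : (Real.pi : ℂ) ≠ 0 := Complex.ofReal_ne_zero.2 Real.pi_ne_zero
  have hL : (Real.log q : ℂ) ≠ 0 := Complex.ofReal_ne_zero.2 (log_pos hq).ne'
  have hroot : (densityRoot q s : ℂ) = 2 * Real.log q * (q + 1) / Real.pi *
      Real.sin (s * Real.log q) /
        (q * ((1 - phase q s ^ 2 / q) * (1 - (phase q s)⁻¹ ^ 2 / q))) := by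
    rw [← hden, densityRoot]
    simp only [Complex.ofReal_mul, Complex.ofReal_div, Complex.ofReal_pow, Complex.ofReal_add,
      Complex.ofReal_natCast, Complex.ofReal_ofNat, Complex.ofReal_one]
    field_simp
  rw [waveBase, mul_zpow, zpow_neg, zpow_natCast, tau, plancherelDensity_eq, telescopeWeight,
    Complex.ofReal_mul (densityRoot q s), hroot, sphericalDisc, sphericalDisc,
    show (Real.sin (s * Real.log q) : ℂ) = (phase q s - (phase q s)⁻¹) / (2 * Complex.I) by
      rw [hsin]; field_simp [Complex.I_ne_zero]]
  rw [phase_neg] at hn2 ⊢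
  rw [show 2 * (d : ℤ) - d + 1 = (d : ℤ) + 1 by ring,
    show 2 * ((0 : ℕ) : ℤ) - d + 1 = -(d : ℤ) + 1 by push_cast; ring, zpow_add_one₀ hu,
    zpow_add_one₀ hu, zpow_neg, zpow_natCast, zpow_neg,
    show phase q s ^ (2 : ℤ) = phase q s ^ 2 from zpow_natCast _ 2, inv_pow _ d]
  -- What is left is an identity of rational functions in `u`, `U = u ^ d`, `q` and the constants,
  -- given `I ^ 2 = -1`.
  generalize phase q s = u at *
  generalize ((√(q : ℝ) : ℂ) ^ d)⁻¹ = r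
  have hU : u ^ d ≠ 0 := pow_ne_zero _ hu
  generalize u ^ d = U at *
  have e1 : 1 - u ^ 2 / (q : ℂ) = (q - u ^ 2) / q := by field_simp
  have e2 : 1 - u⁻¹ ^ 2 / (q : ℂ) = (q * u ^ 2 - 1) / (q * u ^ 2) := by field_simp
  have e3 : 1 - (q : ℂ)⁻¹ * (u ^ 2)⁻¹ = (q * u ^ 2 - 1) / (q * u ^ 2) := by field_simp
  rw [e1] at hn1
  rw [e2] at hn2
  have hm1 : (q : ℂ) - u ^ 2 ≠ 0 := fun h => hn1 (by rw [h, zero_div])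
  have hm2 : (q : ℂ) * u ^ 2 - 1 ≠ 0 := fun h => hn2 (by rw [h, zero_div])
  rw [e1, e2, e3]
  push_cast
  generalize (Real.log q : ℂ) = L at *
  have hI := Complex.I_ne_zero
  have hI2 := Complex.I_sq
  generalize Complex.I = I at *
  field_simp
  rw [hI2]
  ring

end Plancherel

/-! ### The identity kernel and injectivity of the Fourier transform -/

section Plancherel

variable {X : Type*} {G : SimpleGraph X} {o : X} {q : ℕ}

open Classical in
/-- The symbol `1` gives the identity. -/
theorem integral_wave_density_eq [G.LocallyFinite] (hG : G.IsTree) (hq : 2 ≤ q)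
    (hreg : G.IsRegularOfDegree (q + 1)) (o x y : X) :
    ∫ ω, (∫ s in (0 : ℝ)..tau q, wave q x y ω s * (plancherelDensity q s : ℂ))
      ∂(boundaryMeasure G q o x) = if x = y then 1 else 0 := by
  rw [((isAdmissible_wave hG hq x y).mul (isAdmissible_density hq)).integral_swap hG hq hreg x]
  simp_rw [integral_mul_const, integral_wave_mul_density hG hq hreg o x y]
  rw [intervalIntegral.integral_const_mul, integral_sphericalDisc_phase hq]
  have hτ : (tau q : ℂ) ≠ 0 := Complex.ofReal_ne_zero.2 (tau_pos hq).ne'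
  by_cases h : x = y
  · subst h
    simp only [SimpleGraph.dist_self, pow_zero, if_true]
    push_cast
    field_simp
  · have := hG.connected.pos_dist_of_ne h
    rw [if_neg h, if_neg this.ne']
    simp

/-- A continuous function on `[0, τ]` with vanishing cosine moments is zero. -/
theorem eq_zero_of_integral_cos_pow (hq : 2 ≤ q) {m : ℝ → ℂ}
    (hm : ContinuousOn m (Set.Icc 0 (tau q)))
    (h : ∀ n : ℕ, ∫ s in (0 : ℝ)..tau q, (Real.cos (s * Real.log q) : ℂ) ^ n * m s = 0) :
    ∀ s ∈ Set.Icc 0 (tau q), m s = 0 := by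
  have hτ := tau_pos hq
  have hL := log_pos hq
  have hmi : ∀ g : ℝ → ℂ, ContinuousOn g (Set.Icc 0 (tau q)) →
      IntervalIntegrable (fun s => g s * m s) volume 0 (tau q) := fun g hg =>
    ContinuousOn.intervalIntegrable (by rw [Set.uIcc_of_le hτ.le]; exact hg.mul hm)
  obtain ⟨W, hW⟩ := isCompact_Icc.exists_bound_of_continuousOn (s := Set.Icc 0 (tau q)) hm
  have hpoly : ∀ p : Polynomial ℝ,
      ∫ s in (0 : ℝ)..tau q, ((p.eval (Real.cos (s * Real.log q)) : ℝ) : ℂ) * m s = 0 := by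
    intro p
    have h1 : ∀ s, ((p.eval (Real.cos (s * Real.log q)) : ℝ) : ℂ) * m s =
        ∑ i ∈ Finset.range (p.natDegree + 1),
          (p.coeff i : ℂ) * ((Real.cos (s * Real.log q) : ℂ) ^ i * m s) := by
      intro s
      rw [Polynomial.eval_eq_sum_range, Complex.ofReal_sum, Finset.sum_mul]
      refine Finset.sum_congr rfl fun i _ => ?_
      push_cast
      ring
    simp_rw [h1]
    rw [intervalIntegral.integral_finsetSum fun i _ => (hmi _ ?_).const_mul _]
    · simp only [intervalIntegral.integral_const_mul, h, mul_zero, Finset.sum_const_zero]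
    · fun_prop
  -- The map `s ↦ cos (s log q)` is a homeomorphism of `[0, τ]` onto `[-1, 1]`, so by Weierstrass
  -- polynomials in it approximate every continuous `g` uniformly.
  have hreal : ∀ g : ℝ → ℝ, ContinuousOn g (Set.Icc 0 (tau q)) →
      ∫ s in (0 : ℝ)..tau q, (g s : ℂ) * m s = 0 := by
    intro g hg
    rw [← norm_le_zero_iff]
    refine le_of_forall_pos_le_add fun δ hδ => ?_
    have hW0 : 0 ≤ W := (norm_nonneg _).trans (hW 0 ⟨le_rfl, hτ.le⟩)
    have hmaps : ∀ x ∈ Set.Icc (-1 : ℝ) 1, Real.arccos x / Real.log q ∈ Set.Icc 0 (tau q) :=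
      fun x _ => ⟨div_nonneg (Real.arccos_nonneg x) hL.le, by
        rw [tau]; gcongr; exact Real.arccos_le_pi x⟩
    obtain ⟨p, hp⟩ := exists_polynomial_near_of_continuousOn (-1) 1
      (fun x => g (Real.arccos x / Real.log q))
      (hg.comp (Real.continuous_arccos.div_const _).continuousOn hmaps) (δ / ((W + 1) * tau q))
      (by positivity)
    have h2 : ∫ s in (0 : ℝ)..tau q, (g s : ℂ) * m s = ∫ s in (0 : ℝ)..tau q,
        ((g s - p.eval (Real.cos (s * Real.log q)) : ℝ) : ℂ) * m s := by
      have := intervalIntegral.integral_sub (hmi (fun s => (g s : ℂ)) (by fun_prop))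
        (hmi (fun s => ((p.eval (Real.cos (s * Real.log q)) : ℝ) : ℂ)) (by fun_prop))
      rw [hpoly, sub_zero] at this
      rw [← this]
      congr 1
      funext s
      push_cast
      ring
    rw [h2, zero_add]
    refine (intervalIntegral.norm_integral_le_of_norm_le_const
      (C := δ / ((W + 1) * tau q) * (W + 1)) fun s hs => ?_).trans (le_of_eq ?_)
    · rw [Set.uIoc_of_le hτ.le] at hs
      have hs' := Set.Ioc_subset_Icc_self hs
      have h3 := hp (Real.cos (s * Real.log q)) ⟨Real.neg_one_le_cos _, Real.cos_le_one _⟩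
      rw [Real.arccos_cos (mul_nonneg hs'.1 hL.le) ((le_div_iff₀ hL).1 hs'.2),
        mul_div_cancel_right₀ _ hL.ne', abs_sub_comm] at h3
      rw [norm_mul, Complex.norm_real, Real.norm_eq_abs]
      have := hW s hs'
      gcongr
      linarith
    · rw [sub_zero, abs_of_pos hτ]
      field_simp
  have hre : ContinuousOn (fun s => (m s).re) (Set.Icc 0 (tau q)) :=
    Complex.continuous_re.comp_continuousOn hm
  have him : ContinuousOn (fun s => (m s).im) (Set.Icc 0 (tau q)) :=
    Complex.continuous_im.comp_continuousOn hm
  -- Testing `m` against its own real and imaginary parts gives its L² norm.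
  have hnorm : ∫ s in (0 : ℝ)..tau q, ‖m s‖ ^ 2 = 0 := by
    have h1 : ∫ s in (0 : ℝ)..tau q, ((‖m s‖ ^ 2 : ℝ) : ℂ) = 0 := by
      have h2 : ∀ s, ((‖m s‖ ^ 2 : ℝ) : ℂ) =
          ((m s).re : ℂ) * m s - Complex.I * (((m s).im : ℂ) * m s) := by
        intro s
        rw [Complex.ofReal_pow, ← Complex.conj_mul', ← mul_assoc, ← sub_mul]
        congr 1
        apply Complex.ext <;> simp
      simp_rw [h2]
      rw [intervalIntegral.integral_sub (hmi _ (by fun_prop)) ((hmi _ (by fun_prop)).const_mul _),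
        intervalIntegral.integral_const_mul, hreal _ hre, hreal _ him]
      simp
    rw [intervalIntegral.integral_ofReal] at h1
    exact_mod_cast h1
  intro s hs
  by_contra hne
  have := intervalIntegral.integral_pos hτ (f := fun s => ‖m s‖ ^ 2) (by fun_prop)
    (fun s _ => by positivity) ⟨s, hs, by positivity⟩
  linarith

/-- The Fourier transform on the tree is injective on symbols. -/
theorem eq_zero_of_integral_wave_eq_zero [G.LocallyFinite] (hG : G.IsTree) (hq : 2 ≤ q)
    (hreg : G.IsRegularOfDegree (q + 1)) (x : X) {F : Boundary G o → ℝ → ℂ}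
    (hF : IsAdmissible q F)
    (h : ∀ y, ∫ ω, (∫ s in (0 : ℝ)..tau q, wave q x y ω s * F ω s * (plancherelDensity q s : ℂ))
      ∂(boundaryMeasure G q o x) = 0) :
    ∀ ω, ∀ s ∈ Set.Icc 0 (tau q), F ω s = 0 := by
  classical
  have := isProbabilityMeasure_boundaryMeasure hG hq hreg o x
  have hτ := tau_pos hq
  set ν := boundaryMeasure G q o x
  have hcos : ∀ n : ℕ, IsAdmissible (G := G) (o := o) q
      fun _ s => (Real.cos (s * Real.log q) : ℂ) ^ n := fun n =>
    .of_continuous (by fun_prop)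
  have hw : ∀ y, IsAdmissible q fun ω s => wave q x y ω s * F ω s := fun y =>
    (isAdmissible_wave hG hq x y).mul hF
  have hwd : ∀ y, IsAdmissible q fun ω s =>
      wave q x y ω s * F ω s * (plancherelDensity q s : ℂ) := fun y =>
    (hw y).mul (isAdmissible_density hq)
  -- Summing the hypothesis over the neighbours of `y` inserts the eigenvalue `2 √q cos (s log q)`,
  -- so all cosine moments vanish.
  have hmom : ∀ (n : ℕ) y, ∫ ω, (∫ s in (0 : ℝ)..tau q, (Real.cos (s * Real.log q) : ℂ) ^ n *
      (wave q x y ω s * F ω s * (plancherelDensity q s : ℂ))) ∂ν = 0 := by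
    intro n
    induction n with
    | zero => simpa using h
    | succ n ih =>
      intro y
      have hadm := fun z => (hcos n).mul (hwd z)
      have h1 : ∑ z ∈ G.neighborFinset y, ∫ ω, (∫ s in (0 : ℝ)..tau q,
          (Real.cos (s * Real.log q) : ℂ) ^ n *
            (wave q x z ω s * F ω s * (plancherelDensity q s : ℂ))) ∂ν = 0 :=
        Finset.sum_eq_zero fun z _ => ih z
      rw [← integral_finsetSum _ fun z _ => (hadm z).integrable hG hq hreg x] at h1
      have h2 : ∀ ω, ∑ z ∈ G.neighborFinset y, ∫ s in (0 : ℝ)..tau q,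
          (Real.cos (s * Real.log q) : ℂ) ^ n *
            (wave q x z ω s * F ω s * (plancherelDensity q s : ℂ)) =
          (2 * √(q : ℝ) : ℂ) * ∫ s in (0 : ℝ)..tau q, (Real.cos (s * Real.log q) : ℂ) ^ (n + 1) *
            (wave q x y ω s * F ω s * (plancherelDensity q s : ℂ)) := by
        intro ω
        rw [← intervalIntegral.integral_finsetSum fun z _ => (hadm z).intervalIntegrable hq ω,
          ← intervalIntegral.integral_const_mul]
        congr 1
        funext s
        rw [← Finset.mul_sum, ← Finset.sum_mul, ← Finset.sum_mul,
          sum_neighborFinset_wave hG hq hreg]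
        push_cast
        ring
      simp_rw [h2, integral_const_mul] at h1
      refine (mul_eq_zero.1 h1).resolve_left (mul_ne_zero two_ne_zero (sqrt_ne_zero hq))
  -- the integral over the boundary vanishes for each `s`
  have hpt : ∀ y, ∀ s ∈ Set.Ioo 0 (tau q), ∫ ω, wave q x y ω s * F ω s ∂ν = 0 := by
    intro y s hs
    obtain ⟨C, hC⟩ := (hw y).bounded
    have hcont : ContinuousOn (fun s => ∫ ω, wave q x y ω s * F ω s ∂ν) (Set.Icc 0 (tau q)) := by
      refine continuousOn_of_dominated (bound := fun _ => C)
        (fun s hs => ((hw y).integrable_left hG hq hreg x hs).aestronglyMeasurable)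
        (fun s hs => ae_of_all _ fun ω => hC ω s hs) (integrable_const _) (ae_of_all _ fun ω => ?_)
      exact (hw y).continuousOn.comp (f := fun s : ℝ => (ω, s)) (by fun_prop)
        fun s hs => ⟨trivial, hs⟩
    have h1 := eq_zero_of_integral_cos_pow hq
      (hcont.mul (continuous_density hq).continuousOn) (fun n => by
        rw [← hmom n y, ((hcos n).mul (hwd y)).integral_swap hG hq hreg x]
        congr 1
        funext s
        rw [integral_const_mul, integral_mul_const]
        rfl) s (Set.Ioo_subset_Icc_self hs)
    refine (mul_eq_zero.1 h1).resolve_right ?_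
    exact Complex.ofReal_ne_zero.2 (plancherelDensity_pos hq hs).ne'
  -- hence so do the integrals over cylinders
  have hcyl : ∀ y, 0 < G.dist x y → ∀ s ∈ Set.Ioo 0 (tau q),
      ∫ ω in cylinder G o x y, F ω s ∂ν = 0 := by
    intro y hy s hs
    have hs' := Set.Ioo_subset_Icc_self hs
    obtain ⟨n, hn⟩ := Nat.exists_eq_add_of_lt hy
    rw [zero_add] at hn
    obtain ⟨v, hv, hvn⟩ := exists_adj_of_dist hG.connected hn
    have hQ := waveBase_ne_zero hq s
    set c : ℂ := waveBase q s ^ (G.dist x y : ℤ) - waveBase q s ^ ((G.dist x y : ℤ) - 2) with hc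
    have h1 : ∀ ω, wave q x y ω s * F ω s = (waveBase q s)⁻¹ * (wave q x v ω s * F ω s) +
        (cylinder G o x y).indicator (fun ω => c * F ω s) ω := by
      intro ω
      rw [wave_step hG hq hv (by omega), add_mul, mul_assoc]
      congr 1
      by_cases hω : ω ∈ cylinder G o x y
      · simp only [Set.indicator_of_mem hω]
        rw [hc]
      · simp only [Set.indicator_of_notMem hω, zero_mul]
    have h2 := hpt y s hs
    rw [integral_congr_ae (ae_of_all _ h1), integral_add
      (((hw v).integrable_left hG hq hreg x hs').const_mul _)
      (((hF.integrable_left hG hq hreg x hs').const_mul c).indicator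
        (measurableSet_cylinder x y)), integral_const_mul, hpt v s hs, mul_zero, zero_add,
      integral_indicator (measurableSet_cylinder x y), integral_const_mul] at h2
    refine (mul_eq_zero.1 h2).resolve_left ?_
    -- The jump `c` is nonzero because this norm is `q`.
    have h3 : ‖waveBase q s ^ (2 : ℤ)‖ ≠ 1 := by
      rw [norm_zpow, norm_waveBase, zpow_ofNat, Real.sq_sqrt (by positivity)]
      exact_mod_cast (by omega : q ≠ 1)
    have h4 : c = waveBase q s ^ ((G.dist x y : ℤ) - 2) * (waveBase q s ^ (2 : ℤ) - 1) := by
      rw [mul_sub, ← zpow_add₀ hQ, sub_add_cancel, mul_one]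
    rw [h4]
    refine mul_ne_zero (zpow_ne_zero _ hQ) fun h5 => h3 ?_
    rw [sub_eq_zero.1 h5, norm_one]
  -- Near a nonzero value `F` stays within half of it on a small cylinder, where its integral could
  -- not vanish. The endpoints, at which the density gives no information, follow by continuity in
  -- `s`.
  have hint : ∀ ω, ∀ s ∈ Set.Ioo 0 (tau q), F ω s = 0 := by
    intro ω s hs
    have hs' := Set.Ioo_subset_Icc_self hs
    by_contra hne
    have hpos : 0 < ‖F ω s‖ / 2 := by positivity
    have hopen : IsOpen {ω' | ‖F ω s - F ω' s‖ < ‖F ω s‖ / 2} :=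
      isOpen_lt (continuous_const.sub (hF.continuous_left hs')).norm continuous_const
    obtain ⟨N, hN⟩ := exists_cylinder_subset hG x hopen (ω := ω) (by simpa using hpos)
    obtain ⟨z, hz, hωz⟩ := exists_mem_cylinder hG ω x (N + 1)
    have h1 := hcyl z (by omega) s hs
    have h2 : ‖∫ ω' in cylinder G o x z, (F ω s - F ω' s) ∂ν‖ ≤
        ‖F ω s‖ / 2 * ν.real (cylinder G o x z) :=
      norm_setIntegral_le_of_norm_le_const (measure_lt_top _ _)
        fun ω' hω' => (hN z (by omega) hωz hω').le
    rw [integral_sub (integrable_const _) (hF.integrable_left hG hq hreg x hs').integrableOn, h1,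
      sub_zero, setIntegral_const, norm_smul, Real.norm_of_nonneg measureReal_nonneg,
      measureReal_cylinder hG hq hreg] at h2
    have := cylMass_pos hq (G.dist x z)
    nlinarith
  intro ω
  have hFω : ContinuousOn (F ω) (Set.Icc 0 (tau q)) :=
    hF.continuousOn.comp (f := fun s : ℝ => (ω, s)) (by fun_prop) fun s hs => ⟨trivial, hs⟩
  have := Set.EqOn.of_subset_closure (f := F ω) (g := fun _ => 0) (fun s hs => hint ω s hs)
    hFω continuousOn_const Set.Ioo_subset_Icc_self (by rw [closure_Ioo hτ.ne])
  exact fun s hs => this hs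

end Plancherel

/-! ### Series over the tree -/

section Series

variable {X : Type*} {G : SimpleGraph X} {o : X} {q : ℕ}

/-- A weight in `y` which is summable uniformly in `ω`. -/
noncomputable def decayWeight (q : ℕ) (x y : X) (ω : Boundary G o) : ℝ :=
  (√(q : ℝ) ^ G.dist x y)⁻¹ * ((1 + (G.dist x y : ℝ)) ^ 3)⁻¹ *
    √(q : ℝ) ^ (height ω y - height ω x)

/-- A bound for the sums of `decayWeight`. -/
noncomputable def decayConst : ℝ := ∑' n : ℕ, 2 * ((n : ℝ) + 1) * ((1 + (n : ℝ)) ^ 3)⁻¹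

/-- The cube beats the linear factor of `sum_sphere_le` and leaves an inverse square. -/
theorem summable_decayConst : Summable fun n : ℕ => 2 * ((n : ℝ) + 1) * ((1 + (n : ℝ)) ^ 3)⁻¹ := by
  have h1 : Summable fun n : ℕ => 2 * (((n + 1 : ℕ) : ℝ) ^ 2)⁻¹ :=
    ((summable_nat_add_iff 1).2 (Real.summable_nat_pow_inv.2 one_lt_two)).mul_left 2
  refine h1.congr fun n => ?_
  push_cast
  rw [add_comm (1 : ℝ)]
  have : (n : ℝ) + 1 ≠ 0 := by positivity
  field_simp

theorem decayConst_nonneg : 0 ≤ decayConst := tsum_nonneg fun _ => by positivity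

theorem decayWeight_nonneg (x y : X) (ω : Boundary G o) : 0 ≤ decayWeight q x y ω := by
  unfold decayWeight
  positivity

theorem sum_decayWeight_sphere_le [G.LocallyFinite] (hG : G.IsTree) (hq : 2 ≤ q)
    (hreg : G.IsRegularOfDegree (q + 1)) (x : X) (ω : Boundary G o) (n : ℕ) (t : Finset X)
    (ht : ∀ y ∈ t, G.dist x y = n) :
    ∑ y ∈ t, decayWeight q x y ω ≤ 2 * ((n : ℝ) + 1) * ((1 + (n : ℝ)) ^ 3)⁻¹ := by
  have hR := sqrt_pos hq
  rw [Finset.sum_congr rfl fun y hy => by rw [decayWeight, ht y hy], ← Finset.mul_sum]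
  calc _ ≤ (√(q : ℝ) ^ n)⁻¹ * ((1 + (n : ℝ)) ^ 3)⁻¹ * (2 * (n + 1) * √(q : ℝ) ^ n) := by
        gcongr
        exact sum_sphere_le hG hq hreg ω n x t ht
    _ = _ := by field_simp

theorem sum_decayWeight_le [G.LocallyFinite] (hG : G.IsTree) (hq : 2 ≤ q)
    (hreg : G.IsRegularOfDegree (q + 1)) (x : X) (ω : Boundary G o) (t : Finset X) :
    ∑ y ∈ t, decayWeight q x y ω ≤ decayConst := by
  classical
  rw [← Finset.sum_fiberwise_of_maps_to (t := t.image (G.dist x)) (g := G.dist x)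
    fun y hy => Finset.mem_image_of_mem _ hy]
  refine (Finset.sum_le_sum fun n _ => sum_decayWeight_sphere_le hG hq hreg x ω n _
    fun y hy => (Finset.mem_filter.1 hy).2).trans ?_
  exact summable_decayConst.sum_le_tsum _ fun _ _ => by positivity

theorem summable_decayWeight [G.LocallyFinite] (hG : G.IsTree) (hq : 2 ≤ q)
    (hreg : G.IsRegularOfDegree (q + 1)) (x : X) (ω : Boundary G o) :
    Summable fun y => decayWeight q x y ω :=
  summable_of_sum_le (fun y => decayWeight_nonneg x y ω) (sum_decayWeight_le hG hq hreg x ω)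

theorem tsum_decayWeight_le [G.LocallyFinite] (hG : G.IsTree) (hq : 2 ≤ q)
    (hreg : G.IsRegularOfDegree (q + 1)) (x : X) (ω : Boundary G o) :
    ∑' y, decayWeight q x y ω ≤ decayConst :=
  Real.tsum_le_of_sum_le (fun y => decayWeight_nonneg x y ω) (sum_decayWeight_le hG hq hreg x ω)

theorem summable_of_decay [G.LocallyFinite] (hG : G.IsTree) (hq : 2 ≤ q)
    (hreg : G.IsRegularOfDegree (q + 1)) {x : X} {ω : Boundary G o} {f : X → ℂ} {A : ℝ}
    (hf : ∀ y, ‖f y‖ ≤ A * decayWeight q x y ω) : Summable f :=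
  Summable.of_norm_bounded ((summable_decayWeight hG hq hreg x ω).mul_left A) hf

theorem norm_tsum_le_of_decay [G.LocallyFinite] (hG : G.IsTree) (hq : 2 ≤ q)
    (hreg : G.IsRegularOfDegree (q + 1)) {x : X} {ω : Boundary G o} {f : X → ℂ} {A : ℝ}
    (hA : 0 ≤ A) (hf : ∀ y, ‖f y‖ ≤ A * decayWeight q x y ω) : ‖∑' y, f y‖ ≤ A * decayConst := by
  refine (tsum_of_norm_bounded ((summable_decayWeight hG hq hreg x ω).mul_left A).hasSum hf).trans ?_
  rw [tsum_mul_left]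
  exact mul_le_mul_of_nonneg_left (tsum_decayWeight_le hG hq hreg x ω) hA

theorem sum_norm_le_of_decay [G.LocallyFinite] (hG : G.IsTree) (hq : 2 ≤ q)
    (hreg : G.IsRegularOfDegree (q + 1)) {x : X} {ω : Boundary G o} {f : X → ℂ} {A : ℝ}
    (hA : 0 ≤ A) (hf : ∀ y, ‖f y‖ ≤ A * decayWeight q x y ω) (t : Finset X) :
    ∑ y ∈ t, ‖f y‖ ≤ A * decayConst := by
  refine (Finset.sum_le_sum fun y _ => hf y).trans ?_
  rw [← Finset.mul_sum]
  exact mul_le_mul_of_nonneg_left (sum_decayWeight_le hG hq hreg x ω t) hA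

/-- A series dominated by `decayWeight` is continuous: it converges uniformly along spheres. -/
theorem continuousOn_tsum_of_decay [G.LocallyFinite] (hG : G.IsTree) (hq : 2 ≤ q)
    (hreg : G.IsRegularOfDegree (q + 1)) (x : X) {Y : Type*} [TopologicalSpace Y] {S : Set Y}
    (φ : Y → Boundary G o) {f : X → Y → ℂ} (hcont : ∀ y, ContinuousOn (f y) S) {A : ℝ} (hA : 0 ≤ A)
    (hf : ∀ y, ∀ p ∈ S, ‖f y p‖ ≤ A * decayWeight q x y (φ p)) :
    ContinuousOn (fun p => ∑' y, f y p) S := by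
  have hfin := finite_sphere hG hq hreg x
  -- The bound in `y` moves with `ω`, so the Weierstrass test is not applied vertex by vertex; the
  -- sums over spheres do have a summable bound independent of `ω`.
  have h1 : ∀ p ∈ S, ∑' y, f y p = ∑' n : ℕ, ∑ y ∈ (hfin n).toFinset, f y p := by
    intro p hp
    have hs := (summable_of_decay hG hq hreg fun y => hf y p hp).hasSum
    rw [← (hs.tsum_fiberwise (G.dist x)).tsum_eq]
    congr 1
    funext n
    have h2 : G.dist x ⁻¹' {n} = ((hfin n).toFinset : Set X) := by
      ext y; simp
    rw [h2]
    exact Finset.tsum_subtype' (hfin n).toFinset fun y => f y p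
  refine ContinuousOn.congr ?_ h1
  refine continuousOn_tsum (fun n => continuousOn_finsetSum _ fun y _ => hcont y)
    (summable_decayConst.mul_left A) fun n p hp => ?_
  refine (norm_sum_le_of_le _ fun y _ => hf y p hp).trans ?_
  rw [← Finset.mul_sum]
  exact mul_le_mul_of_nonneg_left (sum_decayWeight_sphere_le hG hq hreg x (φ p) n _
    fun y hy => by simpa using hy) hA

/-- Decay of the kernel, in the form in which it is summed. -/
theorem exists_kernel_decayWeight [G.LocallyFinite] (hG : G.IsTree) (hq : 2 ≤ q)
    (hreg : G.IsRegularOfDegree (q + 1)) (o : X) (m : ℕ) :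
    ∃ C, 0 ≤ C ∧ ∀ (a : SymbolFun G o), IsSymbol q a → ∀ M, SymbolBound q (m + 4) M a →
      ∀ (x y : X) (ω : Boundary G o), ‖kernel q a x y‖ * (1 + (G.dist x y : ℝ)) ^ m *
        √(q : ℝ) ^ (height ω y - height ω x) ≤ C * M * decayWeight q x y ω := by
  obtain ⟨C, hC0, hC⟩ := exists_kernel_decay hG hq hreg o (m + 3)
  refine ⟨C, hC0, fun a ha M hM x y ω => ?_⟩
  have hR := sqrt_pos hq
  have hd : (0 : ℝ) < 1 + G.dist x y := by positivity
  calc _ ≤ C * M * ((√(q : ℝ) ^ G.dist x y)⁻¹ * ((1 + (G.dist x y : ℝ)) ^ (m + 3))⁻¹) *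
        (1 + (G.dist x y : ℝ)) ^ m * √(q : ℝ) ^ (height ω y - height ω x) := by
        gcongr
        exact hC a ha M hM x y
    _ = _ := by
        rw [decayWeight, pow_add]
        field_simp

theorem IsSymbol.exists_kernel_decayWeight [G.LocallyFinite] (hG : G.IsTree) (hq : 2 ≤ q)
    (hreg : G.IsRegularOfDegree (q + 1)) {a : SymbolFun G o} (ha : IsSymbol q a) (m : ℕ) :
    ∃ A, 0 ≤ A ∧ ∀ (x y : X) (ω : Boundary G o), ‖kernel q a x y‖ * (1 + (G.dist x y : ℝ)) ^ m *
      √(q : ℝ) ^ (height ω y - height ω x) ≤ A * decayWeight q x y ω := by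
  obtain ⟨C, hC0, hC⟩ := TreeCalculus.exists_kernel_decayWeight hG hq hreg o m
  obtain ⟨M, hM0, hM⟩ := ha.exists_symbolBound (m + 4)
  exact ⟨C * M, by positivity, hC a ha M hM⟩

/-- Factor the wave to `y` through `z`; the two waves between `x` and `z` multiply to the density of
`ν_z` with respect to `ν_x`. Taking for `F` the Plancherel density gives orthogonality of waves;
including a symbol at `z` gives its kernel. -/
theorem integral_wave_mul_wave_neg [G.LocallyFinite] (hG : G.IsTree) (hq : 2 ≤ q)
    (hreg : G.IsRegularOfDegree (q + 1)) (o x y z : X) (F : Boundary G o → ℝ → ℂ) :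
    ∫ ω, (∫ s in (0 : ℝ)..tau q, wave q x y ω s * wave q x z ω (-s) * F ω s)
      ∂(boundaryMeasure G q o x) =
    ∫ ω, (∫ s in (0 : ℝ)..tau q, wave q z y ω s * F ω s) ∂(boundaryMeasure G q o z) := by
  rw [integral_boundaryMeasure hG hq hreg x z]
  refine integral_congr_ae (ae_of_all _ fun ω => ?_)
  beta_reduce
  rw [← intervalIntegral.integral_const_mul]
  congr 1
  funext s
  rw [← wave_mul_wave_neg hq x z ω s, ← wave_mul_wave hq x z y]
  ring

/-- Fourier inversion: a symbol is recovered from its kernel. -/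
theorem IsSymbol.hasSum_kernel_mul_wave [G.LocallyFinite] (hG : G.IsTree) (hq : 2 ≤ q)
    (hreg : G.IsRegularOfDegree (q + 1)) {b : SymbolFun G o} (hb : IsSymbol q b) (x : X)
    (ω : Boundary G o) {s : ℝ} (hs : s ∈ Set.Icc 0 (tau q)) :
    HasSum (fun z => kernel q b x z * wave q x z ω (-s)) (b x ω s) := by
  classical
  have hcount : Countable X := countable_of_locallyFinite hG.connected x
  obtain ⟨A, hA0, hA⟩ := hb.exists_kernel_decayWeight hG hq hreg 0
  have hbd : ∀ (z : X) (ω : Boundary G o) (s : ℝ), ‖kernel q b x z * wave q x z ω (-s)‖ ≤ A * decayWeight q x z ω := by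
    intro z ω s
    have := hA x z ω
    rwa [pow_zero, mul_one, ← norm_wave hq x z ω (-s), ← norm_mul] at this
  have hterm : ∀ z, IsAdmissible (G := G) (o := o) q fun ω s =>
      kernel q b x z * wave q x z ω (-s) := fun z =>
    (IsAdmissible.of_continuous continuous_const).mul (isAdmissible_wave_neg hG hq x z)
  have hb' : IsAdmissible (G := G) (o := o) q fun ω s =>
      ∑' z, kernel q b x z * wave q x z ω (-s) := by
    refine ⟨?_, A * decayConst, fun ω s _ => norm_tsum_le_of_decay hG hq hreg hA0
      fun z => hbd z ω s⟩
    exact continuousOn_tsum_of_decay hG hq hreg x (fun p : Boundary G o × ℝ => p.1)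
      (f := fun z p => kernel q b x z * wave q x z p.1 (-p.2))
      (fun z => (hterm z).continuousOn) hA0 fun z p _ => hbd z p.1 p.2
  have hsum : ∀ (ω : Boundary G o) (s : ℝ), HasSum (fun z => kernel q b x z * wave q x z ω (-s))
      (∑' z, kernel q b x z * wave q x z ω (-s)) := fun ω s =>
    (summable_of_decay hG hq hreg fun z => hbd z ω s).hasSum
  -- The inversion series has the same kernel as `b`: integrated termwise against the wave to `y`,
  -- only the term `z = y` survives. Injectivity identifies the two.
  have hzero := eq_zero_of_integral_wave_eq_zero hG hq hreg x ((hb.isAdmissible x).sub hb')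
    fun y => by
      have hw := isAdmissible_wave (o := o) hG hq x y
      have hd := isAdmissible_density (G := G) (o := o) hq
      obtain ⟨W, hW⟩ := (hw.mul hd).bounded
      have h1 := hasSum_integral_of_isAdmissible hG hq hreg x
        (F := fun z ω s => kernel q b x z * wave q x z ω (-s) *
          (wave q x y ω s * (plancherelDensity q s : ℂ)))
        (F₀ := fun ω s => (∑' z, kernel q b x z * wave q x z ω (-s)) *
          (wave q x y ω s * (plancherelDensity q s : ℂ)))
        (fun z => (hterm z).mul (hw.mul hd)) (hb'.mul (hw.mul hd)) (C := A * decayConst * W)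
        (fun t ω s hs => by
          simp_rw [norm_mul _ (wave q x y ω s * (plancherelDensity q s : ℂ))]
          rw [← Finset.sum_mul]
          exact mul_le_mul (sum_norm_le_of_decay hG hq hreg hA0 (fun z => hbd z ω s) t)
            (hW ω s hs) (norm_nonneg _) (mul_nonneg hA0 decayConst_nonneg))
        (fun ω s _ => (hsum ω s).mul_right _)
      have h2 : ∀ z, ∫ ω, (∫ s in (0 : ℝ)..tau q, kernel q b x z * wave q x z ω (-s) *
          (wave q x y ω s * (plancherelDensity q s : ℂ))) ∂(boundaryMeasure G q o x) =
          if z = y then kernel q b x y else 0 := by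
        intro z
        have h3 : ∀ ω : Boundary G o, ∫ s in (0 : ℝ)..tau q, kernel q b x z * wave q x z ω (-s) *
            (wave q x y ω s * (plancherelDensity q s : ℂ)) = kernel q b x z *
            ∫ s in (0 : ℝ)..tau q, wave q x y ω s * wave q x z ω (-s) *
              (plancherelDensity q s : ℂ) := by
          intro ω
          rw [← intervalIntegral.integral_const_mul]
          congr 1
          funext s
          ring
        simp_rw [h3]
        rw [integral_const_mul, integral_wave_mul_wave_neg hG hq hreg o x y z
          fun _ s => (plancherelDensity q s : ℂ), integral_wave_density_eq hG hq hreg]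
        split_ifs with h
        · rw [h, mul_one]
        · rw [mul_zero]
      simp_rw [h2] at h1
      have h4 := h1.unique (hasSum_ite_eq y (kernel q b x y))
      have h5 : ∀ ω, ∫ s in (0 : ℝ)..tau q, wave q x y ω s *
          (b x ω s - ∑' z, kernel q b x z * wave q x z ω (-s)) * (plancherelDensity q s : ℂ) =
          (∫ s in (0 : ℝ)..tau q, wave q x y ω s * b x ω s * (plancherelDensity q s : ℂ)) -
          ∫ s in (0 : ℝ)..tau q, (∑' z, kernel q b x z * wave q x z ω (-s)) *
            (wave q x y ω s * (plancherelDensity q s : ℂ)) := by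
        intro ω
        rw [← intervalIntegral.integral_sub
          (((hw.mul (hb.isAdmissible x)).mul hd).intervalIntegrable hq ω)
          ((hb'.mul (hw.mul hd)).intervalIntegrable hq ω)]
        congr 1
        funext s
        ring
      simp_rw [h5]
      rw [integral_sub (((hw.mul (hb.isAdmissible x)).mul hd).integrable hG hq hreg x)
        ((hb'.mul (hw.mul hd)).integrable hG hq hreg x), h4]
      exact sub_self _
  have h6 := sub_eq_zero.1 (hzero ω s hs)
  rw [h6]
  exact hsum ω s

end Series

/-! ### The symbol of a composition -/

section Composition

variable {X : Type*} {G : SimpleGraph X} {o : X} {q : ℕ}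

theorem nonempty_boundary [G.LocallyFinite] (hG : G.IsTree) (hq : 2 ≤ q)
    (hreg : G.IsRegularOfDegree (q + 1)) (o : X) : Nonempty (Boundary G o) := by
  have := isProbabilityMeasure_boundaryMeasure hG hq hreg o o
  exact (boundaryMeasure G q o o).nonempty_of_neZero

theorem IsSymbol.exists_norm_kernel_mul_wave_le [G.LocallyFinite] (hG : G.IsTree) (hq : 2 ≤ q)
    (hreg : G.IsRegularOfDegree (q + 1)) {a : SymbolFun G o} (ha : IsSymbol q a) :
    ∃ A, 0 ≤ A ∧ ∀ (x y : X) (ω : Boundary G o) (s : ℝ),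
      ‖kernel q a x y * wave q x y ω s‖ ≤ A * decayWeight q x y ω := by
  obtain ⟨A, hA0, hA⟩ := ha.exists_kernel_decayWeight hG hq hreg 0
  refine ⟨A, hA0, fun x y ω s => ?_⟩
  have := hA x y ω
  rwa [pow_zero, mul_one, ← norm_wave hq x y ω s, ← norm_mul] at this

theorem summable_mul_of_tsum_le {f : X → ℝ} {g : X → X → ℝ} {B : ℝ} (hf : ∀ y, 0 ≤ f y)
    (hg : ∀ y z, 0 ≤ g y z) (h : Summable f) (h' : ∀ y, Summable (g y))
    (hB : ∀ y, ∑' z, g y z ≤ B) : Summable fun p : X × X => f p.1 * g p.1 p.2 := by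
  have h0 : 0 ≤ fun p : X × X => f p.1 * g p.1 p.2 := fun p => mul_nonneg (hf p.1) (hg p.1 p.2)
  rw [summable_prod_of_nonneg h0]
  refine ⟨fun y => (h' y).mul_left (f y), ?_⟩
  simp_rw [tsum_mul_left]
  exact Summable.of_nonneg_of_le (fun y => mul_nonneg (hf y) (tsum_nonneg (hg y)))
    (fun y => mul_le_mul_of_nonneg_left (hB y) (hf y)) (h.mul_right B)

/-- Splitting the wave at the middle vertex gives a summable factor in `y` times inner series in `z`
whose sums of norms are bounded independently of `y`. All rearrangements in the composition rest on
this. -/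
theorem summable_kernel_mul_kernel_mul_wave [G.LocallyFinite] (hG : G.IsTree) (hq : 2 ≤ q)
    (hreg : G.IsRegularOfDegree (q + 1)) {a b : SymbolFun G o} (ha : IsSymbol q a)
    (hb : IsSymbol q b) (x : X) (ω : Boundary G o) (s : ℝ) :
    Summable fun p : X × X => wave q x p.2 ω s * (kernel q a x p.1 * kernel q b p.1 p.2) := by
  obtain ⟨A, hA0, hA⟩ := ha.exists_norm_kernel_mul_wave_le hG hq hreg
  obtain ⟨B, hB0, hB⟩ := hb.exists_norm_kernel_mul_wave_le hG hq hreg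
  have h1 := summable_mul_of_tsum_le
    (f := fun y => ‖kernel q a x y * wave q x y ω s‖)
    (g := fun y z => ‖kernel q b y z * wave q y z ω s‖) (B := B * decayConst)
    (fun _ => norm_nonneg _) (fun _ _ => norm_nonneg _)
    (summable_of_decay hG hq hreg fun y => hA x y ω s).norm
    (fun y => (summable_of_decay hG hq hreg fun z => hB y z ω s).norm)
    fun y => Real.tsum_le_of_sum_le (fun _ => norm_nonneg _)
      (sum_norm_le_of_decay hG hq hreg hB0 fun z => hB y z ω s)
  have h2 : ∀ p : X × X, wave q x p.2 ω s * (kernel q a x p.1 * kernel q b p.1 p.2) =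
      (kernel q a x p.1 * wave q x p.1 ω s) * (kernel q b p.1 p.2 * wave q p.1 p.2 ω s) := by
    intro p
    rw [← wave_mul_wave hq x p.1 p.2]
    ring
  refine Summable.of_norm ?_
  simp only [h2, norm_mul (kernel q a x _ * wave q x _ ω s)]
  exact h1

/-- At fixed `z` the wave is a nonzero constant, which can be divided out of the double series. -/
theorem summable_kernel_mul_kernel [G.LocallyFinite] (hG : G.IsTree) (hq : 2 ≤ q)
    (hreg : G.IsRegularOfDegree (q + 1)) {a b : SymbolFun G o} (ha : IsSymbol q a)
    (hb : IsSymbol q b) (x z : X) : Summable fun y => kernel q a x y * kernel q b y z := by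
  obtain ⟨ω⟩ := nonempty_boundary hG hq hreg o
  have h := ((summable_kernel_mul_kernel_mul_wave hG hq hreg ha hb x ω 0).prod_symm).prod_factor z
  exact (summable_mul_left_iff (wave_ne_zero hq x z ω 0)).1 h

theorem summable_wave_mul_compKernel [G.LocallyFinite] (hG : G.IsTree) (hq : 2 ≤ q)
    (hreg : G.IsRegularOfDegree (q + 1)) {a b : SymbolFun G o} (ha : IsSymbol q a)
    (hb : IsSymbol q b) (x : X) (ω : Boundary G o) (s : ℝ) :
    Summable fun z => wave q x z ω s * compKernel q a b x z := by
  have h : Summable fun p : X × X => wave q x p.1 ω s * (kernel q a x p.2 * kernel q b p.2 p.1) :=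
    (summable_kernel_mul_kernel_mul_wave hG hq hreg ha hb x ω s).prod_symm
  have h1 := h.prod
  simp only [tsum_mul_left] at h1
  exact h1

/-- The symbol `a # b` in terms of `b` and of the kernel of `a`. -/
theorem sharp_eq_tsum [G.LocallyFinite] (hG : G.IsTree) (hq : 2 ≤ q)
    (hreg : G.IsRegularOfDegree (q + 1)) {a b : SymbolFun G o} (ha : IsSymbol q a)
    (hb : IsSymbol q b) (x : X) (ω : Boundary G o) {s : ℝ} (hs : s ∈ Set.Icc 0 (tau q)) :
    sharp q a b x ω s = ∑' y, kernel q a x y * wave q x y ω (-s) * b y ω s := by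
  have h := summable_kernel_mul_kernel_mul_wave hG hq hreg ha hb x ω (-s)
  have h1 := Summable.tsum_comm (f := fun y z => wave q x z ω (-s) *
    (kernel q a x y * kernel q b y z)) h
  simp only [tsum_mul_left (f := fun y => kernel q a x y * kernel q b y _)] at h1
  refine h1.trans ?_
  congr 1
  funext y
  -- After the exchange of sums, the inner series over `z` is the inversion formula for `b` at `y`.
  rw [← (hb.hasSum_kernel_mul_wave hG hq hreg y ω hs).tsum_eq, ← tsum_mul_left]
  congr 1
  funext z
  rw [← wave_mul_wave hq x y z]
  ring

theorem IsSymbol.exists_norm_kernel_mul_wave_mul_le [G.LocallyFinite] (hG : G.IsTree) (hq : 2 ≤ q)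
    (hreg : G.IsRegularOfDegree (q + 1)) {a b : SymbolFun G o} (ha : IsSymbol q a)
    (hb : IsSymbol q b) : ∃ A, 0 ≤ A ∧ ∀ (x y : X) (ω : Boundary G o), ∀ s ∈ Set.Icc 0 (tau q),
      ‖kernel q a x y * wave q x y ω (-s) * b y ω s‖ ≤ A * decayWeight q x y ω := by
  obtain ⟨A, hA0, hA⟩ := ha.exists_norm_kernel_mul_wave_le hG hq hreg
  obtain ⟨M, hM0, hM⟩ := hb.exists_symbolBound 0
  refine ⟨A * M, by positivity, fun x y ω s hs => ?_⟩
  rw [norm_mul, mul_right_comm]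
  exact mul_le_mul (hA x y ω (-s)) (hM.norm_le y ω hs) (norm_nonneg _)
    (mul_nonneg hA0 (decayWeight_nonneg _ _ _))

theorem isAdmissible_sharp_term [G.LocallyFinite] (hG : G.IsTree) (hq : 2 ≤ q)
    {b : SymbolFun G o} (hb : IsSymbol q b) (x y : X) (c : ℂ) :
    IsAdmissible q fun ω s => c * wave q x y ω (-s) * b y ω s :=
  ((IsAdmissible.of_continuous continuous_const).mul (isAdmissible_wave_neg hG hq x y)).mul
    (hb.isAdmissible y)

theorem isAdmissible_sharp [G.LocallyFinite] (hG : G.IsTree) (hq : 2 ≤ q)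
    (hreg : G.IsRegularOfDegree (q + 1)) {a b : SymbolFun G o} (ha : IsSymbol q a)
    (hb : IsSymbol q b) (x : X) : IsAdmissible q (sharp q a b x) := by
  obtain ⟨A, hA0, hA⟩ := ha.exists_norm_kernel_mul_wave_mul_le hG hq hreg hb
  refine ⟨?_, A * decayConst, fun ω s hs => ?_⟩
  · refine (continuousOn_tsum_of_decay hG hq hreg x (fun p : Boundary G o × ℝ => p.1)
      (f := fun y p => kernel q a x y * wave q x y p.1 (-p.2) * b y p.1 p.2)
      (fun y => (isAdmissible_sharp_term hG hq hb x y _).continuousOn) hA0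
      fun y p hp => hA x y p.1 p.2 hp.2).congr fun p hp => ?_
    exact sharp_eq_tsum hG hq hreg ha hb x p.1 hp.2
  · rw [sharp_eq_tsum hG hq hreg ha hb x ω hs]
    exact norm_tsum_le_of_decay hG hq hreg hA0 fun y => hA x y ω s hs

/-- The series of `sharp_eq_tsum` is integrated term by term. The change of base point from `x` to
`y` turns its `y`-term into the kernel of `b` at `(y, z)`, with the factor `kernel q a x y`. -/
theorem kernel_sharp [G.LocallyFinite] (hG : G.IsTree) (hq : 2 ≤ q)
    (hreg : G.IsRegularOfDegree (q + 1)) {a b : SymbolFun G o} (ha : IsSymbol q a)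
    (hb : IsSymbol q b) (x z : X) : kernel q (sharp q a b) x z = compKernel q a b x z := by
  have hcount : Countable X := countable_of_locallyFinite hG.connected x
  obtain ⟨A, hA0, hA⟩ := ha.exists_norm_kernel_mul_wave_mul_le hG hq hreg hb
  have hw := (isAdmissible_wave (o := o) hG hq x z).mul (isAdmissible_density (G := G) (o := o) hq)
  obtain ⟨W, hW⟩ := hw.bounded
  have h1 := hasSum_integral_of_isAdmissible hG hq hreg x
    (F := fun y ω s => kernel q a x y * wave q x y ω (-s) * b y ω s *
      (wave q x z ω s * (plancherelDensity q s : ℂ)))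
    (F₀ := fun ω s => sharp q a b x ω s * (wave q x z ω s * (plancherelDensity q s : ℂ)))
    (fun y => (isAdmissible_sharp_term hG hq hb x y _).mul hw)
    ((isAdmissible_sharp hG hq hreg ha hb x).mul hw) (C := A * decayConst * W)
    (fun t ω s hs => by
      simp_rw [norm_mul _ (wave q x z ω s * (plancherelDensity q s : ℂ))]
      rw [← Finset.sum_mul]
      exact mul_le_mul (sum_norm_le_of_decay hG hq hreg hA0 (fun z => hA x z ω s hs) t)
        (hW ω s hs) (norm_nonneg _) (mul_nonneg hA0 decayConst_nonneg))
    (fun ω s hs => by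
      rw [sharp_eq_tsum hG hq hreg ha hb x ω hs]
      exact (summable_of_decay hG hq hreg fun y => hA x y ω s hs).hasSum.mul_right _)
  have h2 : ∀ y, ∫ ω, (∫ s in (0 : ℝ)..tau q, kernel q a x y * wave q x y ω (-s) * b y ω s *
      (wave q x z ω s * (plancherelDensity q s : ℂ))) ∂(boundaryMeasure G q o x) =
      kernel q a x y * kernel q b y z := by
    intro y
    have h3 : ∀ ω : Boundary G o, ∫ s in (0 : ℝ)..tau q, kernel q a x y * wave q x y ω (-s) *
        b y ω s * (wave q x z ω s * (plancherelDensity q s : ℂ)) = kernel q a x y *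
        ∫ s in (0 : ℝ)..tau q, wave q x z ω s * wave q x y ω (-s) *
          (b y ω s * (plancherelDensity q s : ℂ)) := by
      intro ω
      rw [← intervalIntegral.integral_const_mul]
      congr 1
      funext s
      ring
    simp_rw [h3]
    rw [integral_const_mul, integral_wave_mul_wave_neg hG hq hreg o x z y
      fun ω s => b y ω s * (plancherelDensity q s : ℂ)]
    simp only [kernel, mul_assoc]
  simp_rw [h2] at h1
  rw [compKernel, h1.tsum_eq, kernel]
  congr 1
  funext ω
  congr 1
  funext s
  ring

theorem kernel_sub [G.LocallyFinite] (hG : G.IsTree) (hq : 2 ≤ q)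
    (hreg : G.IsRegularOfDegree (q + 1)) {a b : SymbolFun G o} {x : X}
    (ha : IsAdmissible q (a x)) (hb : IsAdmissible q (b x)) (z : X) :
    kernel q (a - b) x z = kernel q a x z - kernel q b x z := by
  have hw := isAdmissible_wave (o := o) hG hq x z
  have hd := isAdmissible_density (G := G) (o := o) hq
  unfold kernel
  rw [← integral_sub (((hw.mul ha).mul hd).integrable hG hq hreg x)
    (((hw.mul hb).mul hd).integrable hG hq hreg x)]
  congr 1
  funext ω
  rw [← intervalIntegral.integral_sub (((hw.mul ha).mul hd).intervalIntegrable hq ω)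
    (((hw.mul hb).mul hd).intervalIntegrable hq ω)]
  congr 1
  funext s
  simp only [Pi.sub_apply]
  ring

theorem kernel_sharp_sub_mul [G.LocallyFinite] (hG : G.IsTree) (hq : 2 ≤ q)
    (hreg : G.IsRegularOfDegree (q + 1)) {a b : SymbolFun G o} (ha : IsSymbol q a)
    (hb : IsSymbol q b) (x z : X) :
    kernel q (sharp q a b - a * b) x z = compKernel q a b x z - kernel q (a * b) x z := by
  rw [kernel_sub hG hq hreg (isAdmissible_sharp hG hq hreg ha hb x)
    ((ha.isAdmissible x).mul (hb.isAdmissible x)), kernel_sharp hG hq hreg ha hb]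

end Composition

/-! ### The remainder symbol -/

section Remainder

variable {X : Type*} {G : SimpleGraph X} {o : X} {q : ℕ}

theorem dS_congr {a b : SymbolFun G o} {x : X} {ω : Boundary G o}
    (h : ∀ s ∈ Set.Icc 0 (tau q), a x ω s = b x ω s) (k : ℕ) {s : ℝ}
    (hs : s ∈ Set.Icc 0 (tau q)) : dS q k a x ω s = dS q k b x ω s :=
  iteratedDerivWithin_congr h hs

theorem cylDefect_congr {a b : SymbolFun G o} {x y : X} {s : ℝ}
    (h : ∀ ω, a y ω s = b y ω s) (n : ℕ) (ω : Boundary G o) :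
    cylDefect q x n a y ω s = cylDefect q x n b y ω s := by
  simp only [cylDefect, h]

theorem IsSymbol.congr {a b : SymbolFun G o} (ha : IsSymbol q a) (hq : 2 ≤ q)
    (h : ∀ x ω, ∀ s ∈ Set.Icc 0 (tau q), a x ω s = b x ω s) : IsSymbol q b := by
  have hd : ∀ k x ω, ∀ s ∈ Set.Icc 0 (tau q), dS q k b x ω s = dS q k a x ω s :=
    fun k x ω s hs => (dS_congr (h x ω) k hs).symm
  refine ⟨fun x ω => (ha.smooth x ω).congr fun s hs => (h x ω s hs).symm,
    fun k x => (ha.continuousOn k x).congr fun p hp => hd k x p.1 p.2 hp.2, fun k => ?_,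
    fun l => ?_, fun k x ω => ?_⟩
  · obtain ⟨C, hC⟩ := ha.bounded k
    exact ⟨C, fun x ω s hs => by rw [hd k x ω s hs]; exact hC x ω s hs⟩
  · obtain ⟨C, hC⟩ := ha.regular l
    refine ⟨C, fun n x ω s hs => ?_⟩
    rw [← cylDefect_congr (fun ω => h x ω s hs)]
    exact hC n x ω s hs
  · have hτ := (tau_pos hq).le
    rw [hd k x ω 0 ⟨le_rfl, hτ⟩, hd k x ω (tau q) ⟨hτ, le_rfl⟩]
    exact ha.boundary k x ω

/-- The symbol `b` varies slowly in `x`: the differences `b(x, ω, s) - b(y, ω, s)` have seminorms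
bounded by `Λ` times a power of `1 + d(x, y)`. -/
structure VariationBound (q N m : ℕ) (Λ : ℝ) (b : SymbolFun G o) : Prop where
  nonneg : 0 ≤ Λ
  deriv_le : ∀ k ≤ N, ∀ x y ω, ∀ s ∈ Set.Icc 0 (tau q),
    ‖dS q k b y ω s - dS q k b x ω s‖ ≤ Λ * (1 + (G.dist x y : ℝ))
  defect_le : ∀ x y (n : ℕ) ω, ∀ s ∈ Set.Icc 0 (tau q),
    ‖cylDefect q x n b y ω s - cylDefect q x n b x ω s‖ ≤
      Λ * ((1 + (G.dist x y : ℝ)) ^ m / (1 + (n : ℝ)) ^ N)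

theorem exists_eval_le_one_add_pow (P : Polynomial ℝ) :
    ∃ C, 0 ≤ C ∧ ∀ t : ℝ, 0 ≤ t → P.eval t ≤ C * (1 + t) ^ P.natDegree := by
  refine ⟨∑ i ∈ Finset.range (P.natDegree + 1), |P.coeff i|, by positivity, fun t ht => ?_⟩
  rw [Polynomial.eval_eq_sum_range, Finset.sum_mul]
  refine Finset.sum_le_sum fun i hi => ?_
  have h1 : t ^ i ≤ (1 + t) ^ P.natDegree :=
    (pow_le_pow_left₀ ht (by linarith) i).trans
      (pow_le_pow_right₀ (by linarith) (Finset.mem_range_succ_iff.1 hi))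
  exact mul_le_mul (le_abs_self _) h1 (by positivity) (abs_nonneg _)

/-- Polynomial growth enters here: the degree gives the power `m` of `1 + d(x, y)`, which the decay
of the kernel of `a` can absorb. All dependence on `ε` is in the factor `C * ε`. -/
theorem IsSemiclassical.exists_variationBound {b : ℝ → SymbolFun G o} (hb : IsSemiclassical q b)
    (hpoly : HasPolynomialCross q b) (N : ℕ) :
    ∃ (m : ℕ) (C : ℝ), ∀ ε > 0, VariationBound q N m (C * ε) (b ε) := by
  choose L hL using hb.lipschitz
  obtain ⟨P, hP⟩ := hpoly N
  obtain ⟨D, hD0, hD⟩ := exists_eval_le_one_add_pow P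
  have hS0 : 0 ≤ ∑ k ∈ Finset.range (N + 1), |L k| := by positivity
  refine ⟨P.natDegree, ∑ k ∈ Finset.range (N + 1), |L k| + D, fun ε hε =>
    ⟨by positivity, fun k hk x y ω s hs => ?_, fun x y n ω s hs => ?_⟩⟩
  · have h1 := Finset.single_le_sum (f := fun k => |L k|) (fun _ _ => abs_nonneg _)
      (Finset.mem_range_succ_iff.2 hk)
    have h2 : L k ≤ ∑ k ∈ Finset.range (N + 1), |L k| + D := by
      have := le_abs_self (L k)
      linarith
    rw [norm_sub_rev]
    refine (hL k ε hε x y ω s hs).trans ?_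
    gcongr
    linarith
  · rw [norm_sub_rev]
    refine (hP ε hε x y n ω s hs).trans ?_
    have h1 := hD (G.dist x y) (Nat.cast_nonneg _)
    calc _ ≤ ε * (D * (1 + (G.dist x y : ℝ)) ^ P.natDegree / (1 + (n : ℝ)) ^ N) := by gcongr
      _ = D * ε * ((1 + (G.dist x y : ℝ)) ^ P.natDegree / (1 + (n : ℝ)) ^ N) := by ring
      _ ≤ _ := by gcongr; linarith

/-- The extension by `0` of a symbol to all values of the spectral parameter. -/
noncomputable def flatExtension (q : ℕ) (b : SymbolFun G o) : SymbolFun G o :=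
  fun x ω => (Set.Icc 0 (tau q)).indicator (b x ω)

theorem flatExtension_of_mem (b : SymbolFun G o) (x : X) (ω : Boundary G o) {s : ℝ}
    (hs : s ∈ Set.Icc 0 (tau q)) : flatExtension q b x ω s = b x ω s :=
  Set.indicator_of_mem hs _

theorem IsSymbol.contDiff_flatExtension (hq : 2 ≤ q) {b : SymbolFun G o} (hb : IsSymbol q b)
    (x : X) (ω : Boundary G o) : ContDiff ℝ (⊤ : ℕ∞) (flatExtension q b x ω) :=
  contDiff_indicator_Icc (tau_pos hq) (hb.smooth x ω) (fun k => (hb.boundary k x ω).1)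
    fun k => (hb.boundary k x ω).2

theorem IsSymbol.iteratedDeriv_flatExtension (hq : 2 ≤ q) {b : SymbolFun G o} (hb : IsSymbol q b)
    (k : ℕ) (x : X) (ω : Boundary G o) : iteratedDeriv k (flatExtension q b x ω) =
      (Set.Icc 0 (tau q)).indicator (dS q k b x ω) :=
  (iteratedDeriv_indicator_Icc (tau_pos hq) (hb.smooth x ω) (fun k => (hb.boundary k x ω).1)
    (fun k => (hb.boundary k x ω).2) k).1

theorem IsSymbol.iteratedDeriv_flatExtension_sub (hq : 2 ≤ q) {b : SymbolFun G o}
    (hb : IsSymbol q b) (k : ℕ) (x y : X) (ω : Boundary G o) (s : ℝ) :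
    iteratedDeriv k (fun s => flatExtension q b y ω s - flatExtension q b x ω s) s =
      (Set.Icc 0 (tau q)).indicator (fun s => dS q k b y ω s - dS q k b x ω s) s := by
  have h := fun x => (hb.contDiff_flatExtension hq x ω).contDiffAt (x := s)
  rw [iteratedDeriv_fun_sub ((h y).of_le (by exact_mod_cast le_top))
    ((h x).of_le (by exact_mod_cast le_top)), hb.iteratedDeriv_flatExtension hq,
    hb.iteratedDeriv_flatExtension hq]
  by_cases hs : s ∈ Set.Icc 0 (tau q)
  · simp only [Set.indicator_of_mem hs]
  · simp only [Set.indicator_of_notMem hs, sub_zero]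

/-- The contribution of `y` to the symbol `a # b - a b`. -/
noncomputable def remainderTerm (q : ℕ) (a b : SymbolFun G o) (y x : X) (ω : Boundary G o)
    (s : ℝ) : ℂ :=
  kernel q a x y * (wave q x y ω (-s) * (flatExtension q b y ω s - flatExtension q b x ω s))

/-- The symbol `a # b - a b`, extended by `0`. -/
noncomputable def remainderSymbol (q : ℕ) (a b : SymbolFun G o) : SymbolFun G o :=
  fun x ω s => ∑' y, remainderTerm q a b y x ω s

theorem contDiff_remainderTerm (hq : 2 ≤ q) (a : SymbolFun G o) {b : SymbolFun G o}
    (hb : IsSymbol q b) (y x : X) (ω : Boundary G o) :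
    ContDiff ℝ (⊤ : ℕ∞) (remainderTerm q a b y x ω) :=
  contDiff_const.mul ((contDiff_wave_neg hq x y ω).mul
    ((hb.contDiff_flatExtension hq y ω).sub (hb.contDiff_flatExtension hq x ω)))

theorem iteratedDeriv_remainderTerm (a b : SymbolFun G o) (k : ℕ) (y x : X) (ω : Boundary G o) (s : ℝ) :
    iteratedDeriv k (remainderTerm q a b y x ω) s = kernel q a x y * iteratedDeriv k
      (fun s => wave q x y ω (-s) * (flatExtension q b y ω s - flatExtension q b x ω s)) s :=
  iteratedDeriv_const_mul_field _ _

/-- By the Leibniz rule, up to `k` derivatives of the wave cost `k` powers of `1 + d(x, y)` and the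
variation of `b` one more; decay of order `k + 1` of the kernel pays for both. The constant depends
on `a` and `k` but not on `b`, so the size `Λ` passes through linearly. -/
theorem exists_norm_iteratedDeriv_remainderTerm_le [G.LocallyFinite] (hG : G.IsTree) (hq : 2 ≤ q)
    (hreg : G.IsRegularOfDegree (q + 1)) {a : SymbolFun G o} (ha : IsSymbol q a) (k : ℕ) :
    ∃ C, 0 ≤ C ∧ ∀ b, IsSymbol q b → ∀ N m Λ, VariationBound q N m Λ b → k ≤ N →
      ∀ (x y : X) (ω : Boundary G o) (s : ℝ), ‖iteratedDeriv k (remainderTerm q a b y x ω) s‖ ≤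
        C * Λ * decayWeight q x y ω := by
  obtain ⟨A, hA0, hA⟩ := ha.exists_kernel_decayWeight hG hq hreg (k + 1)
  have hlog := log_pos hq
  refine ⟨2 ^ k * (1 + Real.log q) ^ k * A, by positivity, fun b hb N m Λ hΛ hk x y ω s => ?_⟩
  have hΛ0 := hΛ.nonneg
  have h1 := norm_iteratedDeriv_mul_le (contDiff_wave_neg hq x y ω)
    ((hb.contDiff_flatExtension hq y ω).sub (hb.contDiff_flatExtension hq x ω)) k s
    (A := ((1 + Real.log q) * (1 + G.dist x y)) ^ k * √(q : ℝ) ^ (height ω y - height ω x))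
    (B := Λ * (1 + G.dist x y)) (fun j hj => ?_) (fun j hj => ?_)
  · rw [iteratedDeriv_remainderTerm a b, norm_mul]
    calc _ ≤ ‖kernel q a x y‖ * (2 ^ k * (((1 + Real.log q) * (1 + G.dist x y)) ^ k *
          √(q : ℝ) ^ (height ω y - height ω x) * (Λ * (1 + G.dist x y)))) := by
          gcongr
      _ = 2 ^ k * (1 + Real.log q) ^ k * Λ * (‖kernel q a x y‖ * (1 + G.dist x y) ^ (k + 1) *
          √(q : ℝ) ^ (height ω y - height ω x)) := by
          rw [mul_pow]; ring
      _ ≤ 2 ^ k * (1 + Real.log q) ^ k * Λ * (A * decayWeight q x y ω) :=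
          mul_le_mul_of_nonneg_left (hA x y ω) (by positivity)
      _ = _ := by ring
  · refine (norm_iteratedDeriv_wave_neg_le hG hq x y ω j s).trans ?_
    gcongr
    calc _ ≤ ((1 + Real.log q) * (1 + G.dist x y)) ^ j := by gcongr; linarith
      _ ≤ _ := by
        refine pow_le_pow_right₀ ?_ hj
        have : (0 : ℝ) ≤ G.dist x y := Nat.cast_nonneg _
        nlinarith
  · have h2 := hb.iteratedDeriv_flatExtension_sub hq j x y ω s
    by_cases hs : s ∈ Set.Icc 0 (tau q)
    · rw [Set.indicator_of_mem hs] at h2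
      refine (congrArg norm h2).trans_le ?_
      exact hΛ.deriv_le j (hj.trans hk) x y ω s hs
    · rw [Set.indicator_of_notMem hs] at h2
      refine (congrArg norm h2).trans_le ?_
      rw [norm_zero]
      positivity

/-- In the Leibniz formula each factor is jointly continuous: height differences are continuous into
the integers, and the derivatives of `b` are continuous by assumption. -/
theorem continuousOn_iteratedDeriv_remainderTerm [G.LocallyFinite] (hG : G.IsTree) (hq : 2 ≤ q)
    (a : SymbolFun G o) {b : SymbolFun G o} (hb : IsSymbol q b) (k : ℕ) (y x : X) :
    ContinuousOn (fun p : Boundary G o × ℝ => iteratedDeriv k (remainderTerm q a b y x p.1) p.2)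
      (Set.univ ×ˢ Set.Icc 0 (tau q)) := by
  have h1 : ∀ p ∈ (Set.univ : Set (Boundary G o)) ×ˢ Set.Icc 0 (tau q),
      iteratedDeriv k (remainderTerm q a b y x p.1) p.2 = kernel q a x y *
        ∑ i ∈ Finset.range (k + 1), (k.choose i : ℂ) *
          ((-((height p.1 y - height p.1 x : ℤ) : ℂ) * Real.log q * Complex.I) ^ i *
            wave q x y p.1 (-p.2)) * (dS q (k - i) b y p.1 p.2 - dS q (k - i) b x p.1 p.2) := by
    intro p hp
    have h2 := fun x => (hb.contDiff_flatExtension hq x p.1).contDiffAt (x := p.2)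
    rw [iteratedDeriv_remainderTerm a b, iteratedDeriv_fun_mul
      ((contDiff_wave_neg hq x y p.1).contDiffAt.of_le (by exact_mod_cast le_top))
      (((h2 y).sub (h2 x)).of_le (by exact_mod_cast le_top))]
    congr 1
    refine Finset.sum_congr rfl fun i _ => ?_
    rw [iteratedDeriv_wave_neg hq, hb.iteratedDeriv_flatExtension_sub hq,
      Set.indicator_of_mem hp.2]
  refine ContinuousOn.congr ?_ h1
  refine continuousOn_const.mul (continuousOn_finsetSum _ fun i _ => ?_)
  refine (continuousOn_const.mul (ContinuousOn.mul ?_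
    (continuous_wave_neg hG hq x y).continuousOn)).mul
    ((hb.continuousOn (k - i) y).sub (hb.continuousOn (k - i) x))
  have h3 : Continuous fun p : Boundary G o × ℝ => ((height p.1 y - height p.1 x : ℤ) : ℂ) :=
    (continuous_of_discreteTopology (f := fun n : ℤ => (n : ℂ))).comp
      ((continuous_height_sub hG x y).comp continuous_fst)
  exact (((h3.neg.mul continuous_const).mul continuous_const).pow i).continuousOn

/-- At fixed `ω` each derivative of the terms is dominated by a multiple of `decayWeight`, uniformly
in `s`, so the series may be differentiated termwise. The extension by zero makes its terms smooth
on the whole line. -/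
theorem contDiff_remainderSymbol [G.LocallyFinite] (hG : G.IsTree) (hq : 2 ≤ q)
    (hreg : G.IsRegularOfDegree (q + 1)) {a b : SymbolFun G o} (ha : IsSymbol q a)
    (hb : IsSymbol q b) (hvar : ∀ N, ∃ m Λ, VariationBound q N m Λ b) (x : X) (ω : Boundary G o) :
    ContDiff ℝ (⊤ : ℕ∞) (remainderSymbol q a b x ω) ∧
      ∀ k s, iteratedDeriv k (remainderSymbol q a b x ω) s =
        ∑' y, iteratedDeriv k (remainderTerm q a b y x ω) s := by
  choose C hC0 hC using fun k => exists_norm_iteratedDeriv_remainderTerm_le hG hq hreg ha k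
  choose m Λ hΛ using hvar
  have hsum : ∀ k : ℕ, (k : ℕ∞) ≤ (⊤ : ℕ∞) →
      Summable fun y => C k * Λ k * decayWeight q x y ω := fun k _ =>
    (summable_decayWeight hG hq hreg x ω).mul_left _
  have hbd : ∀ (k : ℕ) (y : X) (s : ℝ), (k : ℕ∞) ≤ (⊤ : ℕ∞) →
      ‖iteratedFDeriv ℝ k (remainderTerm q a b y x ω) s‖ ≤ C k * Λ k * decayWeight q x y ω := by
    intro k y s _
    rw [norm_iteratedFDeriv_eq_norm_iteratedDeriv]
    exact hC k b hb k (m k) (Λ k) (hΛ k) le_rfl x y ω s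
  have hcd := fun y => contDiff_remainderTerm hq a hb y x ω
  refine ⟨contDiff_tsum hcd hsum hbd, fun k s => ?_⟩
  have h1 := congrFun (iteratedFDeriv_tsum hcd hsum hbd (k := k) le_top) s
  have h2 : Summable fun y => iteratedFDeriv ℝ k (remainderTerm q a b y x ω) s :=
    Summable.of_norm_bounded (hsum k le_top) fun y => hbd k y s le_top
  rw [iteratedDeriv_eq_iteratedFDeriv]
  refine (congrArg (fun f => f fun _ => (1 : ℝ)) h1).trans ?_
  simp only [iteratedDeriv_eq_iteratedFDeriv]
  exact ContinuousMultilinearMap.tsum_eval h2 _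

theorem remainderTerm_of_mem (a b : SymbolFun G o) (y x : X) (ω : Boundary G o) {s : ℝ}
    (hs : s ∈ Set.Icc 0 (tau q)) : remainderTerm q a b y x ω s =
      kernel q a x y * (wave q x y ω (-s) * (b y ω s - b x ω s)) := by
  rw [remainderTerm, flatExtension_of_mem b y ω hs, flatExtension_of_mem b x ω hs]

theorem remainderSymbol_of_notMem (a b : SymbolFun G o) (x : X) (ω : Boundary G o) {s : ℝ}
    (hs : s ∉ Set.Icc 0 (tau q)) : remainderSymbol q a b x ω s = 0 := by
  simp only [remainderSymbol, remainderTerm, flatExtension, Set.indicator_of_notMem hs, sub_zero,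
    mul_zero, tsum_zero]

/-- Subtract from `sharp_eq_tsum` the inversion formula for `a`, multiplied by `b x ω s`. -/
theorem remainderSymbol_eq [G.LocallyFinite] (hG : G.IsTree) (hq : 2 ≤ q)
    (hreg : G.IsRegularOfDegree (q + 1)) {a b : SymbolFun G o} (ha : IsSymbol q a)
    (hb : IsSymbol q b) (x : X) (ω : Boundary G o) {s : ℝ} (hs : s ∈ Set.Icc 0 (tau q)) :
    remainderSymbol q a b x ω s = (sharp q a b - a * b) x ω s := by
  obtain ⟨A, hA0, hA⟩ := ha.exists_norm_kernel_mul_wave_mul_le hG hq hreg hb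
  have h1 := (summable_of_decay hG hq hreg fun y => hA x y ω s hs).hasSum.sub
    ((ha.hasSum_kernel_mul_wave hG hq hreg x ω hs).mul_right (b x ω s))
  rw [← sharp_eq_tsum hG hq hreg ha hb x ω hs] at h1
  refine Eq.trans ?_ h1.tsum_eq
  refine tsum_congr fun y => ?_
  rw [remainderTerm_of_mem a b y x ω hs]
  ring

theorem isAdmissible_sharp_sub_mul [G.LocallyFinite] (hG : G.IsTree) (hq : 2 ≤ q)
    (hreg : G.IsRegularOfDegree (q + 1)) {a b : SymbolFun G o} (ha : IsSymbol q a)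
    (hb : IsSymbol q b) (x : X) : IsAdmissible q ((sharp q a b - a * b) x) :=
  (isAdmissible_sharp hG hq hreg ha hb x).sub ((ha.isAdmissible x).mul (hb.isAdmissible x))

theorem wave_eq_of_mem_cylinder (hG : G.IsTree) (hq : 2 ≤ q) {x y z : X} {ω ω' : Boundary G o}
    (h : G.dist x y ≤ G.dist x z) (hω : ω ∈ cylinder G o x z) (hω' : ω' ∈ cylinder G o x z)
    (s : ℝ) : wave q x y ω' s = wave q x y ω s := by
  rw [wave_eq_zpow hq, wave_eq_zpow hq, height_sub_eq_of_mem_cylinder hG h hω,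
    height_sub_eq_of_mem_cylinder hG h hω']

/-- Averages over cylinders are integrals against probability measures. -/
theorem exists_measure_cylAverage_eq [G.LocallyFinite] (hG : G.IsTree) (hq : 2 ≤ q)
    (hreg : G.IsRegularOfDegree (q + 1)) {x z : X} {ω : Boundary G o}
    (hω : ω ∈ cylinder G o x z) : ∃ P : Measure (Boundary G o), IsProbabilityMeasure P ∧
      (∀ η, cylAverage q x (G.dist x z) η ω = ∫ ω', η ω' ∂P) ∧
      (∀ f : Boundary G o → ℂ, Integrable f (boundaryMeasure G q o x) → Integrable f P) ∧
      ∀ᵐ ω' ∂P, ω' ∈ cylinder G o x z := by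
  have := isProbabilityMeasure_boundaryMeasure hG hq hreg o x
  set ν := boundaryMeasure G q o x
  have h0 : ν (cylinder G o x z) ≠ 0 := by
    intro h
    have h1 := measureReal_cylinder (o := o) hG hq hreg x z
    rw [Measure.real, h] at h1
    exact (cylMass_pos hq _).ne h1
  have : NeZero (ν.restrict (cylinder G o x z)) := ⟨by rwa [Ne, Measure.restrict_eq_zero]⟩
  refine ⟨(ν.restrict (cylinder G o x z) Set.univ)⁻¹ • ν.restrict (cylinder G o x z),
    inferInstance, fun η => ?_, fun f hf => (hf.restrict).to_average, ?_⟩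
  · rw [cylAverage, cylinderAround_eq hG hω]
    rfl
  · exact Measure.ae_smul_measure (ae_restrict_mem (measurableSet_cylinder x z)) _

theorem finite_closedBall [G.LocallyFinite] (hG : G.IsTree) (hq : 2 ≤ q)
    (hreg : G.IsRegularOfDegree (q + 1)) (x : X) (n : ℕ) : {y | G.dist x y ≤ n}.Finite :=
  ((Set.finite_Iic n).biUnion fun m _ => finite_sphere hG hq hreg x m).subset fun y hy =>
    Set.mem_biUnion (x := G.dist x y) hy rfl

/-- For `d(x, y) ≤ n` the wave to `y` is constant on `Ω_n(x, ω)` and commutes with the average, so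
the defect falls on the difference of `b` at `y` and `x`, which the cross condition controls. For
`d(x, y) > n` no cancellation is needed: the decay of the kernel supplies `(1 + n) ^ (-N)`. -/
theorem exists_norm_cylDefect_le [G.LocallyFinite] (hG : G.IsTree) (hq : 2 ≤ q)
    (hreg : G.IsRegularOfDegree (q + 1)) {a : SymbolFun G o} (ha : IsSymbol q a) (N m : ℕ) :
    ∃ C, 0 ≤ C ∧ ∀ b, IsSymbol q b → ∀ Λ, VariationBound q N m Λ b →
      ∀ (n : ℕ) (x : X) (ω : Boundary G o), ∀ s ∈ Set.Icc 0 (tau q),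
        ‖cylDefect q x n (sharp q a b - a * b) x ω s‖ ≤ C * Λ / (1 + (n : ℝ)) ^ N := by
  classical
  obtain ⟨A, hA0, hA⟩ := ha.exists_kernel_decayWeight hG hq hreg m
  obtain ⟨B, hB0, hB⟩ := ha.exists_kernel_decayWeight hG hq hreg (N + 1)
  have hD := decayConst_nonneg
  -- The far vertices count twice, once at `ω` and once inside the average.
  refine ⟨(A + 2 * B) * decayConst, by positivity, fun b hb Λ hΛ n x ω s hs => ?_⟩
  have hΛ0 := hΛ.nonneg
  have hn : (0 : ℝ) < 1 + n := by positivity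
  obtain ⟨z, rfl, hz⟩ := exists_mem_cylinder hG ω x n
  set n := G.dist x z
  obtain ⟨P, hP, hav, hint, hae⟩ := exists_measure_cylAverage_eq hG hq hreg hz
  set r := sharp q a b - a * b with hr
  set F : X → Boundary G o → ℂ := fun y ω' => remainderTerm q a b y x ω' s
  have hF : ∀ y ω', F y ω' = kernel q a x y * (wave q x y ω' (-s) * (b y ω' s - b x ω' s)) :=
    fun y ω' => remainderTerm_of_mem a b y x ω' hs
  have hbint : ∀ y, Integrable (fun ω' => b y ω' s) P := fun y =>
    hint _ ((hb.isAdmissible y).integrable_left hG hq hreg x hs)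
  have hFint : ∀ y, Integrable (F y) P := by
    intro y
    refine hint _ ((((IsAdmissible.of_continuous (continuous_const (y := kernel q a x y))).mul
      ((isAdmissible_wave_neg hG hq x y).mul ((hb.isAdmissible y).sub (hb.isAdmissible x)))
      ).integrable_left hG hq hreg x hs).congr (ae_of_all _ fun ω' => ?_))
    exact (hF y ω').symm
  have hrint : Integrable (fun ω' => r x ω' s) P :=
    hint _ ((isAdmissible_sharp_sub_mul hG hq hreg ha hb x).integrable_left hG hq hreg x hs)
  have hFle : ∀ y ω', ‖F y ω'‖ ≤ ‖kernel q a x y‖ * (√(q : ℝ) ^ (height ω' y - height ω' x) *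
      (Λ * (1 + (G.dist x y : ℝ)))) := by
    intro y ω'
    rw [hF, norm_mul, norm_mul, norm_wave hq]
    have := hΛ.deriv_le 0 (Nat.zero_le _) x y ω' s hs
    simp only [dS_zero] at this
    gcongr
  set t := (finite_closedBall hG hq hreg x n).toFinset with ht
  have hmem : ∀ y, y ∈ t ↔ G.dist x y ≤ n := fun y => by simp [ht]
  -- the vertices far from `x`
  have hfar : ∀ ω', ‖r x ω' s - ∑ y ∈ t, F y ω'‖ ≤ B * Λ / (1 + (n : ℝ)) ^ N * decayConst := by
    intro ω'
    have hsum : Summable fun y => F y ω' := by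
      refine summable_of_decay hG hq hreg (x := x) (ω := ω') (A := Λ * B) fun y => ?_
      refine (hFle y ω').trans ?_
      calc _ ≤ Λ * (‖kernel q a x y‖ * (1 + (G.dist x y : ℝ)) ^ (N + 1) *
            √(q : ℝ) ^ (height ω' y - height ω' x)) := by
            have : 1 + (G.dist x y : ℝ) ≤ (1 + (G.dist x y : ℝ)) ^ (N + 1) :=
              le_self_pow₀ (by simp) (by simp)
            calc _ = Λ * (‖kernel q a x y‖ * (1 + (G.dist x y : ℝ)) *
                √(q : ℝ) ^ (height ω' y - height ω' x)) := by ring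
              _ ≤ _ := by gcongr
        _ ≤ Λ * (B * decayWeight q x y ω') := mul_le_mul_of_nonneg_left (hB x y ω') hΛ0
        _ = _ := by ring
    have h1 : HasSum (fun y => F y ω') (r x ω' s) := by
      rw [hr, ← remainderSymbol_eq hG hq hreg ha hb x ω' hs]
      exact hsum.hasSum
    have h2 : HasSum (fun y => if y ∈ t then F y ω' else 0) (∑ y ∈ t, F y ω') := by
      have : HasSum (fun y => if y ∈ t then F y ω' else 0) (∑ y ∈ t, if y ∈ t then F y ω' else 0) :=
        hasSum_sum_of_ne_finset_zero fun y hy => if_neg hy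
      rwa [Finset.sum_congr rfl fun y hy => if_pos hy] at this
    rw [← (h1.sub h2).tsum_eq]
    refine norm_tsum_le_of_decay hG hq hreg (x := x) (ω := ω') (by positivity) fun y => ?_
    split_ifs with hy
    · rw [sub_self, norm_zero]
      exact mul_nonneg (by positivity) (decayWeight_nonneg _ _ _)
    · rw [sub_zero]
      have hy' : n ≤ G.dist x y := by
        rw [hmem] at hy
        omega
      -- This factor introduces `(1 + n) ^ (-N)` at the cost of `N` powers of `1 + d(x, y)`.
      have h3 : 1 ≤ (1 + (G.dist x y : ℝ)) ^ N / (1 + (n : ℝ)) ^ N := by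
        rw [one_le_div (by positivity)]
        gcongr
      refine (hFle y ω').trans ?_
      calc _ ≤ ‖kernel q a x y‖ * (√(q : ℝ) ^ (height ω' y - height ω' x) *
            (Λ * (1 + (G.dist x y : ℝ)))) *
            ((1 + (G.dist x y : ℝ)) ^ N / (1 + (n : ℝ)) ^ N) :=
            le_mul_of_one_le_right (by positivity) h3
        _ = Λ / (1 + (n : ℝ)) ^ N * (‖kernel q a x y‖ * (1 + (G.dist x y : ℝ)) ^ (N + 1) *
            √(q : ℝ) ^ (height ω' y - height ω' x)) := by ring
        _ ≤ Λ / (1 + (n : ℝ)) ^ N * (B * decayWeight q x y ω') :=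
            mul_le_mul_of_nonneg_left (hB x y ω') (by positivity)
        _ = _ := by ring
  -- the vertices close to `x`
  have hnear : ∀ y ∈ t, ‖F y ω - ∫ ω', F y ω' ∂P‖ ≤
      A * Λ / (1 + (n : ℝ)) ^ N * decayWeight q x y ω := by
    intro y hy
    rw [hmem] at hy
    have h1 : ∫ ω', F y ω' ∂P = kernel q a x y * wave q x y ω (-s) *
        ((∫ ω', b y ω' s ∂P) - ∫ ω', b x ω' s ∂P) := by
      rw [← integral_sub (hbint y) (hbint x), ← integral_const_mul]
      refine integral_congr_ae ?_
      filter_upwards [hae] with ω' hω'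
      rw [hF, wave_eq_of_mem_cylinder hG hq hy hz hω', mul_assoc]
    have h2 : F y ω - ∫ ω', F y ω' ∂P = kernel q a x y * (wave q x y ω (-s) *
        (cylDefect q x n b y ω s - cylDefect q x n b x ω s)) := by
      rw [h1, hF, cylDefect, cylDefect, hav, hav]
      ring
    rw [h2, norm_mul, norm_mul, norm_wave hq]
    calc _ ≤ ‖kernel q a x y‖ * (√(q : ℝ) ^ (height ω y - height ω x) *
          (Λ * ((1 + (G.dist x y : ℝ)) ^ m / (1 + (n : ℝ)) ^ N))) := by
          gcongr
          exact hΛ.defect_le x y n ω s hs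
      _ = Λ / (1 + (n : ℝ)) ^ N * (‖kernel q a x y‖ * (1 + (G.dist x y : ℝ)) ^ m *
          √(q : ℝ) ^ (height ω y - height ω x)) := by ring
      _ ≤ Λ / (1 + (n : ℝ)) ^ N * (A * decayWeight q x y ω) :=
          mul_le_mul_of_nonneg_left (hA x y ω) (by positivity)
      _ = _ := by ring
  have hsplit : cylDefect q x n r x ω s = ∑ y ∈ t, (F y ω - ∫ ω', F y ω' ∂P) +
      ((r x ω s - ∑ y ∈ t, F y ω) - ∫ ω', (r x ω' s - ∑ y ∈ t, F y ω') ∂P) := by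
    rw [integral_sub hrint (integrable_finsetSum _ fun y _ => hFint y),
      integral_finsetSum _ fun y _ => hFint y, Finset.sum_sub_distrib, cylDefect, hav]
    ring
  have h3 : ‖∫ ω', (r x ω' s - ∑ y ∈ t, F y ω') ∂P‖ ≤
      B * Λ / (1 + (n : ℝ)) ^ N * decayConst := by
    refine (norm_integral_le_of_norm_le_const (ae_of_all _ hfar)).trans (le_of_eq ?_)
    simp
  have h4 : ‖∑ y ∈ t, (F y ω - ∫ ω', F y ω' ∂P)‖ ≤ A * Λ / (1 + (n : ℝ)) ^ N * decayConst := by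
    refine (norm_sum_le_of_le _ hnear).trans ?_
    rw [← Finset.mul_sum]
    exact mul_le_mul_of_nonneg_left (sum_decayWeight_le hG hq hreg x ω t) (by positivity)
  rw [hsplit]
  refine (norm_add_le_of_le h4 ((norm_sub_le _ _).trans (add_le_add (hfar ω) h3))).trans
    (le_of_eq ?_)
  ring

theorem exists_norm_dS_le [G.LocallyFinite] (hG : G.IsTree) (hq : 2 ≤ q)
    (hreg : G.IsRegularOfDegree (q + 1)) {a : SymbolFun G o} (ha : IsSymbol q a) (k : ℕ) :
    ∃ C, 0 ≤ C ∧ ∀ b, IsSymbol q b → (∀ N, ∃ m Λ, VariationBound q N m Λ b) →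
      ∀ N m Λ, VariationBound q N m Λ b → k ≤ N → ∀ (x : X) (ω : Boundary G o) (s : ℝ),
        ‖iteratedDeriv k (remainderSymbol q a b x ω) s‖ ≤ C * Λ := by
  obtain ⟨C, hC0, hC⟩ := exists_norm_iteratedDeriv_remainderTerm_le hG hq hreg ha k
  have hD := decayConst_nonneg
  refine ⟨C * decayConst, by positivity, fun b hb hvar N m Λ hΛ hk x ω s => ?_⟩
  have hΛ0 := hΛ.nonneg
  rw [(contDiff_remainderSymbol hG hq hreg ha hb hvar x ω).2]
  refine (norm_tsum_le_of_decay hG hq hreg (x := x) (ω := ω) (by positivity)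
    fun y => hC b hb N m Λ hΛ hk x y ω s).trans (le_of_eq ?_)
  ring

theorem dS_remainderSymbol [G.LocallyFinite] (hG : G.IsTree) (hq : 2 ≤ q)
    (hreg : G.IsRegularOfDegree (q + 1)) {a b : SymbolFun G o} (ha : IsSymbol q a)
    (hb : IsSymbol q b) (hvar : ∀ N, ∃ m Λ, VariationBound q N m Λ b) (k : ℕ) (x : X)
    (ω : Boundary G o) {s : ℝ} (hs : s ∈ Set.Icc 0 (tau q)) :
    dS q k (remainderSymbol q a b) x ω s = iteratedDeriv k (remainderSymbol q a b x ω) s :=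
  iteratedDerivWithin_eq_iteratedDeriv (uniqueDiffOn_Icc (tau_pos hq))
    ((contDiff_remainderSymbol hG hq hreg ha hb hvar x ω).1.contDiffAt.of_le
      (by exact_mod_cast le_top)) hs

/-- The properties are checked on the extension by zero and then transferred. That extension is
smooth on the line and vanishes outside `[0, τ]`, hence is flat at the ends. -/
theorem isSymbol_sharp_sub_mul [G.LocallyFinite] (hG : G.IsTree) (hq : 2 ≤ q)
    (hreg : G.IsRegularOfDegree (q + 1)) {a b : SymbolFun G o} (ha : IsSymbol q a)
    (hb : IsSymbol q b) (hvar : ∀ N, ∃ m Λ, VariationBound q N m Λ b) :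
    IsSymbol q (sharp q a b - a * b) := by
  have hcd := contDiff_remainderSymbol hG hq hreg ha hb hvar
  have hdS := dS_remainderSymbol hG hq hreg ha hb hvar
  have hτ := tau_pos hq
  have heq : ∀ x ω, ∀ s ∈ Set.Icc 0 (tau q), remainderSymbol q a b x ω s =
      (sharp q a b - a * b) x ω s := fun x ω s hs => remainderSymbol_eq hG hq hreg ha hb x ω hs
  refine IsSymbol.congr ⟨fun x ω => (hcd x ω).1.contDiffOn, fun k x => ?_, fun k => ?_, fun l => ?_,
    fun k x ω => ?_⟩ hq heq
  · obtain ⟨C, hC0, hC⟩ := exists_norm_iteratedDeriv_remainderTerm_le hG hq hreg ha k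
    obtain ⟨m, Λ, hΛ⟩ := hvar k
    have hΛ0 := hΛ.nonneg
    refine (continuousOn_tsum_of_decay hG hq hreg x (fun p : Boundary G o × ℝ => p.1)
      (f := fun y p => iteratedDeriv k (remainderTerm q a b y x p.1) p.2)
      (fun y => continuousOn_iteratedDeriv_remainderTerm hG hq a hb k y x) (A := C * Λ)
      (by positivity) fun y p _ => hC b hb k m Λ hΛ le_rfl x y p.1 p.2).congr fun p hp => ?_
    rw [hdS k x p.1 hp.2, (hcd x p.1).2]
  · obtain ⟨C, hC0, hC⟩ := exists_norm_dS_le hG hq hreg ha k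
    obtain ⟨m, Λ, hΛ⟩ := hvar k
    refine ⟨C * Λ, fun x ω s hs => ?_⟩
    rw [hdS k x ω hs]
    exact hC b hb hvar k m Λ hΛ le_rfl x ω s
  · obtain ⟨m, Λ, hΛ⟩ := hvar l
    obtain ⟨C, hC0, hC⟩ := exists_norm_cylDefect_le hG hq hreg ha l m
    refine ⟨C * Λ, fun n x ω s hs => ?_⟩
    rw [cylDefect_congr fun ω => heq x ω s hs]
    exact hC b hb Λ hΛ n x ω s hs
  · rw [hdS k x ω ⟨le_rfl, hτ.le⟩, hdS k x ω ⟨hτ.le, le_rfl⟩]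
    constructor
    · refine iteratedDeriv_eq_zero_of_eqOn (hcd x ω).1 (isOpen_Iio (a := (0 : ℝ)))
        (fun s hs => remainderSymbol_of_notMem a b x ω fun h => ?_) (by simp) k
      exact absurd h.1 (not_le.2 hs)
    · refine iteratedDeriv_eq_zero_of_eqOn (hcd x ω).1 (isOpen_Ioi (a := tau q))
        (fun s hs => remainderSymbol_of_notMem a b x ω fun h => ?_) (by simp) k
      exact absurd h.2 (not_le.2 hs)

theorem exists_norm_dS_sharp_sub_mul_le [G.LocallyFinite] (hG : G.IsTree) (hq : 2 ≤ q)
    (hreg : G.IsRegularOfDegree (q + 1)) {a : SymbolFun G o} (ha : IsSymbol q a) (k : ℕ) :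
    ∃ C, 0 ≤ C ∧ ∀ b, IsSymbol q b → (∀ N, ∃ m Λ, VariationBound q N m Λ b) →
      ∀ N m Λ, VariationBound q N m Λ b → k ≤ N → ∀ (x : X) (ω : Boundary G o),
        ∀ s ∈ Set.Icc 0 (tau q), ‖dS q k (sharp q a b - a * b) x ω s‖ ≤ C * Λ := by
  obtain ⟨C, hC0, hC⟩ := exists_norm_dS_le hG hq hreg ha k
  refine ⟨C, hC0, fun b hb hvar N m Λ hΛ hk x ω s hs => ?_⟩
  rw [← dS_congr (fun s hs => remainderSymbol_eq hG hq hreg ha hb x ω hs) k hs,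
    dS_remainderSymbol hG hq hreg ha hb hvar k x ω hs]
  exact hC b hb hvar N m Λ hΛ hk x ω s

/-- The seminorms of `a # b - a b` are controlled by the variation of `b`. -/
theorem exists_symbolBound_sharp_sub_mul [G.LocallyFinite] (hG : G.IsTree) (hq : 2 ≤ q)
    (hreg : G.IsRegularOfDegree (q + 1)) {a : SymbolFun G o} (ha : IsSymbol q a) (N m : ℕ) :
    ∃ C, 0 ≤ C ∧ ∀ b, IsSymbol q b → (∀ N, ∃ m Λ, VariationBound q N m Λ b) →
      ∀ Λ, VariationBound q N m Λ b → SymbolBound q N (C * Λ) (sharp q a b - a * b) := by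
  choose C hC0 hC using fun k => exists_norm_dS_sharp_sub_mul_le hG hq hreg ha k
  obtain ⟨D, hD0, hD⟩ := exists_norm_cylDefect_le hG hq hreg ha N m
  have hS0 : 0 ≤ ∑ k ∈ Finset.range (N + 1), C k := Finset.sum_nonneg fun k _ => hC0 k
  refine ⟨∑ k ∈ Finset.range (N + 1), C k + D, by positivity, fun b hb hvar Λ hΛ =>
    ⟨fun k hk x ω s hs => ?_, fun n x ω s hs => ?_⟩⟩
  · have h1 := Finset.single_le_sum (f := C) (fun k _ => hC0 k) (Finset.mem_range_succ_iff.2 hk)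
    refine (hC k b hb hvar N m Λ hΛ hk x ω s hs).trans ?_
    exact mul_le_mul_of_nonneg_right (by linarith) hΛ.nonneg
  · refine (hD b hb Λ hΛ n x ω s hs).trans ?_
    have := hΛ.nonneg
    gcongr
    linarith

end Remainder

/-! ### Operators on `L²` -/

section Schur

variable {X : Type*}

theorem tsum_sq_le_tsum_mul_tsum {r f g : X → ℝ} (hf : ∀ y, 0 ≤ f y) (hg : ∀ y, 0 ≤ g y)
    (hr : ∀ y, 0 ≤ r y) (h : ∀ y, r y ^ 2 = f y * g y) (hfs : Summable f) (hgs : Summable g) :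
    Summable r ∧ (∑' y, r y) ^ 2 ≤ (∑' y, f y) * ∑' y, g y := by
  have hs : Summable r := Summable.of_nonneg_of_le hr (fun y => by
    have := h y
    have := hf y
    have := hg y
    nlinarith [sq_nonneg (f y - g y), hr y, sq_nonneg (f y + g y)]) (hfs.add hgs)
  refine ⟨hs, le_of_tendsto (hs.hasSum.pow 2) (Eventually.of_forall fun t => ?_)⟩
  refine (Finset.sum_sq_le_sum_mul_sum_of_sq_le_mul t (fun y _ => hf y) (fun y _ => hg y)
    fun y _ => (h y).le).trans ?_
  exact mul_le_mul (hfs.sum_le_tsum t fun y _ => hf y) (hgs.sum_le_tsum t fun y _ => hg y)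
    (Finset.sum_nonneg fun y _ => hg y) (tsum_nonneg hf)

/-- Schur's test. -/
theorem schur_test {k : X → X → ℝ} {w : X → ℝ} {B : ℝ} (hk : ∀ x y, 0 ≤ k x y)
    (hw : ∀ x, 0 < w x) (h1 : ∀ x, Summable fun y => k x y * (w y / w x))
    (h1B : ∀ x, ∑' y, k x y * (w y / w x) ≤ B) (h2 : ∀ y, Summable fun x => k x y * (w x / w y))
    (h2B : ∀ y, ∑' x, k x y * (w x / w y) ≤ B) {f : X → ℝ} (hf0 : ∀ y, 0 ≤ f y)
    (hf : Summable fun y => f y ^ 2) :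
    (∀ x, Summable fun y => k x y * f y) ∧ (Summable fun x => (∑' y, k x y * f y) ^ 2) ∧
      ∑' x, (∑' y, k x y * f y) ^ 2 ≤ B ^ 2 * ∑' y, f y ^ 2 := by
  have hpos : ∀ x y, 0 ≤ k x y * (w x / w y) := fun x y =>
    mul_nonneg (hk x y) (div_pos (hw x) (hw y)).le
  have hprod : Summable fun p : X × X => f p.1 ^ 2 * (k p.2 p.1 * (w p.2 / w p.1)) :=
    summable_mul_of_tsum_le (g := fun y x => k x y * (w x / w y)) (fun y => sq_nonneg (f y))
      (fun y x => hpos x y) hf h2 h2B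
  have hswap : Summable fun p : X × X => f p.2 ^ 2 * (k p.1 p.2 * (w p.1 / w p.2)) :=
    hprod.prod_symm
  -- Cauchy–Schwarz, with the kernel shared between the factors `k x y * (w y / w x)` and `f y ^ 2 *
  -- (k x y * (w x / w y))`. The row bound controls the first; the column bound controls the second
  -- after summation over `x`.
  have hcs := fun x => tsum_sq_le_tsum_mul_tsum (r := fun y => k x y * f y)
    (f := fun y => k x y * (w y / w x)) (g := fun y => f y ^ 2 * (k x y * (w x / w y)))
    (fun y => mul_nonneg (hk x y) (div_pos (hw y) (hw x)).le)
    (fun y => mul_nonneg (sq_nonneg _) (hpos x y)) (fun y => mul_nonneg (hk x y) (hf0 y))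
    (fun y => by
      have := (hw x).ne'
      have := (hw y).ne'
      field_simp) (h1 x) (hswap.prod_factor x)
  have hle : ∀ x, (∑' y, k x y * f y) ^ 2 ≤ B * ∑' y, f y ^ 2 * (k x y * (w x / w y)) :=
    fun x => (hcs x).2.trans (mul_le_mul_of_nonneg_right (h1B x)
      (tsum_nonneg fun y => mul_nonneg (sq_nonneg _) (hpos x y)))
  have hs := hswap.prod.mul_left B
  have hsq := Summable.of_nonneg_of_le (fun x => sq_nonneg _) hle hs
  refine ⟨fun x => (hcs x).1, hsq, (hsq.tsum_le_tsum hle hs).trans ?_⟩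
  rw [tsum_mul_left, sq, mul_assoc]
  rcases isEmpty_or_nonempty X with hX | ⟨⟨x₀⟩⟩
  · simp
  have hB : 0 ≤ B := (tsum_nonneg fun x => hpos x x₀).trans (h2B x₀)
  refine mul_le_mul_of_nonneg_left ?_ hB
  have hcomm := Summable.tsum_comm (f := fun y x => f y ^ 2 * (k x y * (w x / w y))) hprod
  refine hcomm.trans_le ?_
  rw [← tsum_mul_left]
  simp only [tsum_mul_left (a := f _ ^ 2)]
  refine Summable.tsum_le_tsum (fun y => ?_) ?_ (hf.mul_left B)
  · rw [mul_comm B]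
    exact mul_le_mul_of_nonneg_left (h2B y) (sq_nonneg _)
  · have := hprod.prod
    simpa only [tsum_mul_left] using this

theorem L2.summable_norm_sq (f : L2 X) : Summable fun x => ‖f x‖ ^ 2 := by
  have := (memℓp_gen_iff (p := 2) (by simp)).1 (lp.memℓp f)
  simpa using this

theorem L2.norm_sq_eq (f : L2 X) : ‖f‖ ^ 2 = ∑' x, ‖f x‖ ^ 2 := by
  have := lp.norm_rpow_eq_tsum (p := 2) (by simp) f
  simpa using this

/-- The bounded operator with a given kernel. -/
theorem exists_operator_of_schur {k : X → X → ℂ} {w : X → ℝ} {B : ℝ} (hB : 0 ≤ B)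
    (hw : ∀ x, 0 < w x) (h1 : ∀ x, Summable fun y => ‖k x y‖ * (w y / w x))
    (h1B : ∀ x, ∑' y, ‖k x y‖ * (w y / w x) ≤ B)
    (h2 : ∀ y, Summable fun x => ‖k x y‖ * (w x / w y))
    (h2B : ∀ y, ∑' x, ‖k x y‖ * (w x / w y) ≤ B) :
    ∃ T : L2 X →L[ℂ] L2 X, ‖T‖ ≤ B ∧ ∀ f x, HasSum (fun y => k x y * f y) (T f x) := by
  have hS := fun f : L2 X => schur_test (fun x y => norm_nonneg (k x y)) hw h1 h1B h2 h2B
    (f := fun y => ‖f y‖) (fun y => norm_nonneg _) (L2.summable_norm_sq f)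
  have hsum : ∀ (f : L2 X) x, Summable fun y => k x y * f y := fun f x =>
    Summable.of_norm (by simpa only [norm_mul] using (hS f).1 x)
  have hle : ∀ (f : L2 X) x, ‖∑' y, k x y * f y‖ ^ 2 ≤ (∑' y, ‖k x y‖ * ‖f y‖) ^ 2 := by
    intro f x
    refine pow_le_pow_left₀ (norm_nonneg _) ?_ 2
    exact tsum_of_norm_bounded ((hS f).1 x).hasSum fun y => (norm_mul _ _).le
  have hmem : ∀ f : L2 X, Memℓp (fun x => ∑' y, k x y * f y) 2 := by
    intro f
    refine (memℓp_gen_iff (by simp)).2 ?_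
    have := Summable.of_nonneg_of_le (fun x => sq_nonneg _) (hle f) (hS f).2.1
    simpa using this
  let T₀ : L2 X →ₗ[ℂ] L2 X :=
    { toFun := fun f => ⟨_, hmem f⟩
      map_add' := fun f g => by
        ext x
        have := ((hsum f x).hasSum.add (hsum g x).hasSum).tsum_eq
        simp only [← mul_add] at this
        exact this
      map_smul' := fun c f => by
        ext x
        have := ((hsum f x).hasSum.mul_left c).tsum_eq
        simp only [mul_left_comm c] at this
        exact this }
  have hbd : ∀ f, ‖T₀ f‖ ≤ B * ‖f‖ := by
    intro f
    refine (pow_le_pow_iff_left₀ (norm_nonneg _) (by positivity) two_ne_zero).1 ?_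
    rw [mul_pow, L2.norm_sq_eq, L2.norm_sq_eq]
    exact ((L2.summable_norm_sq (T₀ f)).tsum_le_tsum (hle f) (hS f).2.1).trans (hS f).2.2
  exact ⟨T₀.mkContinuous B hbd, T₀.mkContinuous_norm_le hB hbd, fun f x => (hsum f x).hasSum⟩

end Schur

/-! ### Bounded operators with a given symbol, and their composition -/

section Main

variable {X : Type*} {G : SimpleGraph X} {o : X} {q : ℕ}

/-- A kernel which decays rapidly is bounded on `L²`. -/
theorem exists_operator_of_decay [G.LocallyFinite] (hG : G.IsTree) (hq : 2 ≤ q)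
    (hreg : G.IsRegularOfDegree (q + 1)) (o : X) {k : X → X → ℂ} {A : ℝ} (hA : 0 ≤ A)
    (hk : ∀ x y, ‖k x y‖ ≤ A * ((√(q : ℝ) ^ G.dist x y)⁻¹ * ((1 + (G.dist x y : ℝ)) ^ 3)⁻¹)) :
    ∃ T : L2 X →L[ℂ] L2 X, ‖T‖ ≤ A * decayConst ∧ ∀ f x, HasSum (fun y => k x y * f y) (T f x) := by
  -- Any single end serves: with the weight `√q ^ height ω x`, the decay being symmetric in `x` and
  -- `y`, both rows and columns are dominated by `decayWeight`.
  obtain ⟨ω⟩ := nonempty_boundary hG hq hreg o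
  have hR := sqrt_pos hq
  have hdiv : ∀ x y, √(q : ℝ) ^ height ω y / √(q : ℝ) ^ height ω x =
      √(q : ℝ) ^ (height ω y - height ω x) := fun x y => (zpow_sub₀ hR.ne' _ _).symm
  have h1 : ∀ x y, ‖k x y‖ * (√(q : ℝ) ^ height ω y / √(q : ℝ) ^ height ω x) ≤
      A * decayWeight q x y ω := by
    intro x y
    rw [hdiv, decayWeight, ← mul_assoc]
    exact mul_le_mul_of_nonneg_right (hk x y) (by positivity)
  have h2 : ∀ y x, ‖k x y‖ * (√(q : ℝ) ^ height ω x / √(q : ℝ) ^ height ω y) ≤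
      A * decayWeight q y x ω := by
    intro y x
    rw [hdiv, decayWeight, ← mul_assoc, G.dist_comm]
    exact mul_le_mul_of_nonneg_right (hk x y) (by positivity)
  have hsum := fun x => (summable_decayWeight hG hq hreg x ω).mul_left A
  have hle : ∀ x, ∑' y, A * decayWeight q x y ω ≤ A * decayConst := by
    intro x
    rw [tsum_mul_left]
    exact mul_le_mul_of_nonneg_left (tsum_decayWeight_le hG hq hreg x ω) hA
  have h1s := fun x => Summable.of_nonneg_of_le (fun y => by positivity) (h1 x) (hsum x)
  have h2s := fun y => Summable.of_nonneg_of_le (fun x => by positivity) (h2 y) (hsum y)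
  exact exists_operator_of_schur (mul_nonneg hA decayConst_nonneg) (fun x => by positivity) h1s
    (fun x => ((h1s x).tsum_le_tsum (h1 x) (hsum x)).trans (hle x)) h2s
    fun y => ((h2s y).tsum_le_tsum (h2 y) (hsum y)).trans (hle y)

/-- The operators with a given symbol, with a bound of the norm by the seminorms of the symbol. -/
theorem exists_operator_of_symbolBound [G.LocallyFinite] (hG : G.IsTree) (hq : 2 ≤ q)
    (hreg : G.IsRegularOfDegree (q + 1)) (o : X) :
    ∃ C, 0 ≤ C ∧ ∀ a : SymbolFun G o, IsSymbol q a → ∀ M, 0 ≤ M → SymbolBound q 4 M a →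
      ∃ T : L2 X →L[ℂ] L2 X, ‖T‖ ≤ C * M ∧ ∀ f x, HasSum (fun y => kernel q a x y * f y) (T f x) := by
  obtain ⟨C, hC0, hC⟩ := exists_kernel_decay hG hq hreg o 3
  refine ⟨C * decayConst, mul_nonneg hC0 decayConst_nonneg, fun a ha M hM0 hM => ?_⟩
  obtain ⟨T, hT, hT'⟩ := exists_operator_of_decay hG hq hreg o (mul_nonneg hC0 hM0) (hC a ha M hM)
  exact ⟨T, hT.trans (le_of_eq (by ring)), hT'⟩

theorem op_eq_of_hasSum {k : X → ℂ} {f : X → ℂ} {u : X →₀ ℂ} (h : ∀ x, f x = u x) {c : ℂ}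
    (hc : HasSum (fun y => k y * f y) c) : c = ∑ y ∈ u.support, k y * u y := by
  simp only [h] at hc
  refine hc.unique (hasSum_sum_of_ne_finset_zero fun y hy => ?_)
  rw [Finsupp.notMem_support_iff.1 hy, mul_zero]

theorem isExtension_of_hasSum {a : SymbolFun G o} {T : L2 X →L[ℂ] L2 X}
    (h : ∀ f x, HasSum (fun y => kernel q a x y * f y) (T f x)) : IsExtension q T a :=
  fun f _ hu x => op_eq_of_hasSum hu (h f x)

/-- For finitely supported `f`, the image `B f` need not be finitely supported. Hence `A` must be
given by its kernel series on all of L², while `IsExtension` is enough for `B`. -/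
theorem comp_apply_eq_sum [G.LocallyFinite] (hG : G.IsTree) (hq : 2 ≤ q)
    (hreg : G.IsRegularOfDegree (q + 1)) {a b : SymbolFun G o} (ha : IsSymbol q a)
    (hb : IsSymbol q b) {A B : L2 X →L[ℂ] L2 X}
    (hA : ∀ f x, HasSum (fun y => kernel q a x y * f y) (A f x)) (hB : IsExtension q B b)
    {f : L2 X} {u : X →₀ ℂ} (hu : ∀ x, f x = u x) (x : X) :
    A (B f) x = ∑ z ∈ u.support, compKernel q a b x z * u z := by
  refine (hA (B f) x).unique ?_
  have h1 : ∀ y, kernel q a x y * B f y =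
      ∑ z ∈ u.support, kernel q a x y * kernel q b y z * u z := by
    intro y
    rw [hB f u hu y, Op, Finset.mul_sum]
    exact Finset.sum_congr rfl fun z _ => (mul_assoc _ _ _).symm
  simp only [h1]
  exact hasSum_sum fun z _ =>
    (summable_kernel_mul_kernel hG hq hreg ha hb x z).hasSum.mul_right (u z)

end Main

end TreeCalculus

theorem mainTheorem5 {X : Type*} (G : SimpleGraph X) [G.LocallyFinite] (q : ℕ) (hq : 2 ≤ q)
    (hG : G.IsTree) (hreg : G.IsRegularOfDegree (q + 1)) (o : X)
    (a : SymbolFun G o) (b : ℝ → SymbolFun G o)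
    (ha : IsSymbol q a) (hb : IsSemiclassical q b) (hpoly : HasPolynomialCross q b) :
    -- the operators extend to `L²`, and the `L²` estimate of order `ε` holds
    (∃ A : L2 X →L[ℂ] L2 X, IsExtension q A a ∧ ∃ C : ℝ, ∀ ε > 0, ∃ B D : L2 X →L[ℂ] L2 X,
      IsExtension q B (b ε) ∧ IsExtension q D (a * b ε) ∧ ‖A.comp B - D‖ ≤ C * ε ∧
      -- the remainder is the operator with symbol `a # b - a b`
      IsExtension q (A.comp B - D) (sharp q a (b ε) - a * b ε)) ∧
    -- the series defining `a # b` converge absolutely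
    (∀ ε > 0, (∀ x z, Summable fun y => kernel q a x y * kernel q (b ε) y z) ∧
      ∀ (x : X) (ω : Boundary G o), ∀ s ∈ Set.Icc 0 (tau q),
        Summable fun z => wave q x z ω (-s) * compKernel q a (b ε) x z) ∧
    -- the remainder symbol is in `S`, and its seminorms are of order `ε`
    (∀ ε > 0, IsSymbol q (sharp q a (b ε) - a * b ε)) ∧
    (∀ k : ℕ, ∃ C : ℝ, ∀ ε > 0, ∀ (x : X) (ω : Boundary G o), ∀ s ∈ Set.Icc 0 (tau q),
      ‖dS q k (sharp q a (b ε) - a * b ε) x ω s‖ ≤ C * ε) ∧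
    (∀ l : ℕ, ∃ C : ℝ, ∀ ε > 0, ∀ (n : ℕ) (x : X) (ω : Boundary G o), ∀ s ∈ Set.Icc 0 (tau q),
      ‖cylDefect q x n (sharp q a (b ε) - a * b ε) x ω s‖ ≤ C * ε / (1 + (n : ℝ)) ^ l) := by
  choose m C hC using fun N => hb.exists_variationBound hpoly N
  have hvar : ∀ ε > 0, ∀ N, ∃ m Λ, VariationBound q N m Λ (b ε) := fun ε hε N =>
    ⟨m N, C N * ε, hC N ε hε⟩
  refine ⟨?_, fun ε hε => ⟨summable_kernel_mul_kernel hG hq hreg ha (hb.isSymbol ε hε),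
    fun x ω s _ => summable_wave_mul_compKernel hG hq hreg ha (hb.isSymbol ε hε) x ω (-s)⟩,
    fun ε hε => isSymbol_sharp_sub_mul hG hq hreg ha (hb.isSymbol ε hε) (hvar ε hε),
    fun k => ?_, fun l => ?_⟩
  · obtain ⟨K, hK0, hK⟩ := exists_operator_of_symbolBound hG hq hreg o
    obtain ⟨M, hM0, hM⟩ := ha.exists_symbolBound 4
    -- Seminorms of order `4` bound the operator: Schur's test needs three powers of decay, and the
    -- sum over the geodesic uses up one more.
    obtain ⟨E, hE0, hE⟩ := exists_symbolBound_sharp_sub_mul hG hq hreg ha 4 (m 4)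
    obtain ⟨A, -, hA⟩ := hK a ha M hM0 hM
    refine ⟨A, isExtension_of_hasSum hA, K * (E * C 4), fun ε hε => ?_⟩
    have hbε := hb.isSymbol ε hε
    obtain ⟨M', hM'0, hM'⟩ := hbε.exists_symbolBound 4
    obtain ⟨B, -, hB⟩ := hK (b ε) hbε M' hM'0 hM'
    obtain ⟨R, hRle, hR⟩ := hK _ (isSymbol_sharp_sub_mul hG hq hreg ha hbε (hvar ε hε))
      (E * (C 4 * ε)) (mul_nonneg hE0 (hC 4 ε hε).nonneg)
      (hE (b ε) hbε (hvar ε hε) (C 4 * ε) (hC 4 ε hε))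
    have hBext := isExtension_of_hasSum hB
    have hRext := isExtension_of_hasSum hR
    -- The extension of the operator of `a * b ε` is defined as `A.comp B - R`, with `R` the
    -- operator of the remainder, and recognised by its kernel. The estimate is then the bound on
    -- `R`, and no separate proof that the product is a symbol is required.
    refine ⟨B, A.comp B - R, hBext, fun f u hu x => ?_, ?_, ?_⟩
    · have h1 : (A.comp B - R) f x = A (B f) x - R f x := rfl
      rw [h1, comp_apply_eq_sum hG hq hreg ha hbε hA hBext hu, hRext f u hu x, Op, Op,
        ← Finset.sum_sub_distrib]
      refine Finset.sum_congr rfl fun z _ => ?_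
      rw [kernel_sharp_sub_mul hG hq hreg ha hbε]
      ring
    · rw [sub_sub_cancel]
      exact hRle.trans (le_of_eq (by ring))
    · rwa [sub_sub_cancel]
  · obtain ⟨E, hE0, hE⟩ := exists_norm_dS_sharp_sub_mul_le hG hq hreg ha k
    refine ⟨E * C k, fun ε hε x ω s hs => ?_⟩
    rw [mul_assoc]
    exact hE (b ε) (hb.isSymbol ε hε) (hvar ε hε) k (m k) _ (hC k ε hε) le_rfl x ω s hs
  · obtain ⟨E, hE0, hE⟩ := exists_norm_cylDefect_le hG hq hreg ha l (m l)
    refine ⟨E * C l, fun ε hε n x ω s hs => ?_⟩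
    rw [mul_assoc]
    exact hE (b ε) (hb.isSymbol ε hε) _ (hC l ε hε) n x ω s hs
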